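/- Let $k$ be an algebraically closed field of characteristic zero and let $H$ be a semisimple (hence finite-dimensional) Hopf algebra over $k$. Let $A\subseteq H$ be a Hopf subalgebra of index $[H:A]:=\dim H/\dim A=3$, and suppose that $A$ is not normal in $H$, i.e. it is not the case that $h_1\,a\,\mathcal S(h_2)\in A$ for all $h\in H$ and $a\in A$. Write $G(H^*)$ for the group of group-like elements of the dual Hopf algebra $H^*$, and put $A^+=A\cap\ker\epsilon$, so that $H/HA^+$ is a quotient coalgebra of $H$. Then: (a) There exist Hopf algebras $\overline H$ and $B$ over $k$, surjective Hopf algebra maps $p\colon H\to\overline H$ and $q\colon\overline H\to B$, and a surjective coalgebra map $r\colon B\to H/HA^+$ such that * $\overline H$ is of algebra type $(1,|G(H^*)|;\,2,\tfrac{|G(H^*)|}{2})$, i.e. as an algebra $\overline H\simeq k^{|G(H^*)|}\times M_2(k)^{|G(H^*)|/2}$; * $B\simeq k\mathbb S_3$ as Hopf algebras, where $k\mathbb S_3$ is the group algebra of the symmetric group on three letters; * the composite $r\circ q\circ p\colon H\to H/HA^+$ is the canonical projection. (b) $|G(H^*)|$ is even. (c) $3\,|G(H^*)|$ divides $\dim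 H$. -/

import Mathlib

open scoped TensorProduct

universe u v

noncomputable section

/-! ### The coalgebra structure on the dual of a finite-dimensional algebra -/

section DualCoalgebra

variable {k A : Type*} [Field k] [Ring A] [Algebra k A] [FiniteDimensional k A]

/-- The dual of a finite-dimensional algebra is a coalgebra: the comultiplication is the transpose
of the multiplication (under the identification of `A^* ⊗ A^*` with `(A ⊗ A)^*`), and the counit is
evaluation at `1`. -/
instance instCoalgebraStructDual : CoalgebraStruct k (Module.Dual k A) where
  comul := (TensorProduct.dualDistribEquiv k A A).symm.toLinearMap ∘ₗ
    Module.Dual.transpose (R := k) (LinearMap.mul' k A)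
  counit := Module.Dual.eval k A 1

theorem dual_counit_apply (f : Module.Dual k A) :
    Coalgebra.counit (R := k) f = f 1 := rfl

theorem dual_comul_apply (f : Module.Dual k A) (x y : A) :
    TensorProduct.dualDistrib k A A (Coalgebra.comul (R := k) f) (x ⊗ₜ[k] y) = f (x * y) := by
  have h : TensorProduct.dualDistribEquiv k A A (Coalgebra.comul (R := k) f)
      = f ∘ₗ LinearMap.mul' k A :=
    (TensorProduct.dualDistribEquiv k A A).apply_symm_apply _
  have h' : TensorProduct.dualDistrib k A A (Coalgebra.comul (R := k) f)
      = f ∘ₗ LinearMap.mul' k A := h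
  rw [h']
  simp

theorem dual_rTensor_counit (t : Module.Dual k A ⊗[k] Module.Dual k A) (y : A) :
    TensorProduct.lid k _ ((Coalgebra.counit (R := k) (A := Module.Dual k A)).rTensor _ t) y
      = TensorProduct.dualDistrib k A A t (1 ⊗ₜ[k] y) := by
  induction t with
  | zero => simp
  | add a b ha hb => simp only [map_add, LinearMap.add_apply, ha, hb]
  | tmul f g => simp [dual_counit_apply]

theorem dual_lTensor_counit (t : Module.Dual k A ⊗[k] Module.Dual k A) (y : A) :
    TensorProduct.rid k _ ((Coalgebra.counit (R := k) (A := Module.Dual k A)).lTensor _ t) y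
      = TensorProduct.dualDistrib k A A t (y ⊗ₜ[k] 1) := by
  induction t with
  | zero => simp
  | add a b ha hb => simp only [map_add, LinearMap.add_apply, ha, hb]
  | tmul f g => simp [dual_counit_apply, mul_comm]

theorem dual_lTensor_comul (t : Module.Dual k A ⊗[k] Module.Dual k A) (x y z : A) :
    TensorProduct.dualDistrib k A (A ⊗[k] A) ((TensorProduct.dualDistrib k A A).lTensor _
      ((Coalgebra.comul (R := k) (A := Module.Dual k A)).lTensor _ t)) (x ⊗ₜ[k] (y ⊗ₜ[k] z))
      = TensorProduct.dualDistrib k A A t (x ⊗ₜ[k] (y * z)) := by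
  induction t with
  | zero => simp
  | add a b ha hb => simp only [map_add, LinearMap.add_apply, ha, hb]
  | tmul f g => simp [dual_comul_apply]

set_option linter.unusedSectionVars false in
theorem dual_assoc_tmul (s : Module.Dual k A ⊗[k] Module.Dual k A) (g : Module.Dual k A)
    (x y z : A) :
    TensorProduct.dualDistrib k A (A ⊗[k] A) ((TensorProduct.dualDistrib k A A).lTensor _
      (TensorProduct.assoc k _ _ _ (s ⊗ₜ[k] g))) (x ⊗ₜ[k] (y ⊗ₜ[k] z))
      = TensorProduct.dualDistrib k A A s (x ⊗ₜ[k] y) * g z := by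
  induction s with
  | zero => simp
  | add a b ha hb =>
    simp only [map_add, LinearMap.add_apply, TensorProduct.add_tmul, ha, hb, add_mul]
  | tmul f g => simp [mul_assoc]

theorem dual_rTensor_comul (t : Module.Dual k A ⊗[k] Module.Dual k A) (x y z : A) :
    TensorProduct.dualDistrib k A (A ⊗[k] A) ((TensorProduct.dualDistrib k A A).lTensor _
      (TensorProduct.assoc k _ _ _
        ((Coalgebra.comul (R := k) (A := Module.Dual k A)).rTensor _ t)))
        (x ⊗ₜ[k] (y ⊗ₜ[k] z))
      = TensorProduct.dualDistrib k A A t ((x * y) ⊗ₜ[k] z) := by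
  induction t with
  | zero => simp
  | add a b ha hb => simp only [map_add, LinearMap.add_apply, ha, hb]
  | tmul f g => rw [LinearMap.rTensor_tmul, dual_assoc_tmul, dual_comul_apply]; simp

theorem dual_tensor_injective : Function.Injective (fun t : Module.Dual k A ⊗[k]
    (Module.Dual k A ⊗[k] Module.Dual k A) => TensorProduct.dualDistrib k A (A ⊗[k] A)
      ((TensorProduct.dualDistrib k A A).lTensor _ t)) := by
  have h1 : Function.Injective (TensorProduct.dualDistrib k A (A ⊗[k] A)) :=
    (TensorProduct.dualDistribEquiv k A (A ⊗[k] A)).injective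
  have h2 : Function.Injective ((TensorProduct.dualDistrib k A A).lTensor (Module.Dual k A)) :=
    ((TensorProduct.dualDistribEquiv k A A).lTensor (Module.Dual k A)).injective
  exact h1.comp h2

instance instCoalgebraDual : Coalgebra k (Module.Dual k A) where
  coassoc := by
    ext f : 1
    apply dual_tensor_injective
    apply TensorProduct.ext
    ext x : 1
    apply TensorProduct.ext'
    intro y z
    change TensorProduct.dualDistrib k A (A ⊗[k] A) ((TensorProduct.dualDistrib k A A).lTensor _
      (TensorProduct.assoc k _ _ _
        ((Coalgebra.comul (R := k) (A := Module.Dual k A)).rTensor _ (Coalgebra.comul f))))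
        (x ⊗ₜ[k] (y ⊗ₜ[k] z)) =
      TensorProduct.dualDistrib k A (A ⊗[k] A) ((TensorProduct.dualDistrib k A A).lTensor _
      ((Coalgebra.comul (R := k) (A := Module.Dual k A)).lTensor _ (Coalgebra.comul f)))
        (x ⊗ₜ[k] (y ⊗ₜ[k] z))
    rw [dual_rTensor_comul, dual_lTensor_comul, dual_comul_apply, dual_comul_apply, mul_assoc]
  rTensor_counit_comp_comul := by
    ext f : 1
    apply (TensorProduct.lid k (Module.Dual k A)).injective
    ext y
    change TensorProduct.lid k _ ((Coalgebra.counit (R := k) (A := Module.Dual k A)).rTensor _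
      (Coalgebra.comul f)) y = _
    rw [dual_rTensor_counit, dual_comul_apply]
    simp
  lTensor_counit_comp_comul := by
    ext f : 1
    apply (TensorProduct.rid k (Module.Dual k A)).injective
    ext y
    change TensorProduct.rid k _ ((Coalgebra.counit (R := k) (A := Module.Dual k A)).lTensor _
      (Coalgebra.comul f)) y = _
    rw [dual_lTensor_counit, dual_comul_apply]
    simp

end DualCoalgebra

/-! ### Hopf subalgebras -/

/-- A Hopf subalgebra of `H`: a subalgebra `A` with `Δ(A) ⊆ A ⊗ A` and `S(A) ⊆ A`. -/
structure HopfSubalgebra (k H : Type*) [Field k] [Ring H] [HopfAlgebra k H] extends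
    Subalgebra k H where
  comul_mem' : ∀ a ∈ toSubalgebra, Coalgebra.comul (R := k) a ∈ LinearMap.range
    (TensorProduct.mapIncl (Subalgebra.toSubmodule toSubalgebra)
      (Subalgebra.toSubmodule toSubalgebra))
  antipode_mem' : ∀ a ∈ toSubalgebra, HopfAlgebra.antipode k a ∈ toSubalgebra

namespace HopfSubalgebra

variable {k H : Type*} [Field k] [Ring H] [HopfAlgebra k H]

/-- The index `[H : A] = dim H / dim A` (for finite-dimensional `H`), as a rational number. -/
def index (A : HopfSubalgebra k H) : ℚ :=
  (Module.finrank k H : ℚ) / (Module.finrank k A.toSubalgebra : ℚ)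

/-- The left adjoint action `(ad h)(a) = h₁ a S(h₂)` of `H` on itself. -/
def leftAdjoint (h a : H) : H :=
  LinearMap.mul' k H (TensorProduct.map (LinearMap.mulRight k a) (HopfAlgebra.antipode k)
    (Coalgebra.comul (R := k) h))

/-- A Hopf subalgebra `A` is normal if it is stable under the left adjoint action. -/
def IsNormal (A : HopfSubalgebra k H) : Prop :=
  ∀ h : H, ∀ a ∈ A.toSubalgebra, leftAdjoint (k := k) h a ∈ A.toSubalgebra

/-- The left ideal `HA⁺` of `H` generated by the augmentation ideal `A⁺ = A ∩ ker ε`, as a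
`k`-subspace of `H`. -/
def leftAugIdeal (A : HopfSubalgebra k H) : Submodule k H :=
  (Ideal.span {a : H | a ∈ A.toSubalgebra ∧ Coalgebra.counit (R := k) a = 0}).restrictScalars k

theorem mul_mem_leftAugIdeal (A : HopfSubalgebra k H) (h : H) {x : H}
    (hx : x ∈ A.leftAugIdeal) : h * x ∈ A.leftAugIdeal :=
  Ideal.mul_mem_left (Ideal.span _) h hx

theorem mkQ_of_mem (A : HopfSubalgebra k H) {a : H} (ha : a ∈ A.toSubalgebra) :
    A.leftAugIdeal.mkQ a = Coalgebra.counit (R := k) a • A.leftAugIdeal.mkQ 1 := by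
  rw [← map_smul, ← sub_eq_zero, ← map_sub, Submodule.mkQ_apply, Submodule.Quotient.mk_eq_zero]
  refine Ideal.subset_span ⟨?_, ?_⟩
  · exact A.toSubalgebra.sub_mem ha (A.toSubalgebra.smul_mem A.toSubalgebra.one_mem _)
  · simp

theorem map_mkQ_mapIncl (A : HopfSubalgebra k H)
    (s : Subalgebra.toSubmodule A.toSubalgebra ⊗[k] Subalgebra.toSubmodule A.toSubalgebra) :
    TensorProduct.map A.leftAugIdeal.mkQ A.leftAugIdeal.mkQ (TensorProduct.mapIncl _ _ s)
      = Coalgebra.counit (R := k) (TensorProduct.lid k H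
          ((Coalgebra.counit (R := k) (A := H)).rTensor H (TensorProduct.mapIncl _ _ s))) •
        (A.leftAugIdeal.mkQ 1 ⊗ₜ[k] A.leftAugIdeal.mkQ 1) := by
  induction s with
  | zero => simp
  | add a b ha hb => simp only [map_add, ha, hb, add_smul]
  | tmul a b =>
    simp only [TensorProduct.mapIncl, TensorProduct.map_tmul, Submodule.subtype_apply,
      LinearMap.rTensor_tmul, TensorProduct.lid_tmul, map_smul]
    rw [A.mkQ_of_mem a.2, A.mkQ_of_mem b.2, TensorProduct.smul_tmul_smul, smul_eq_mul]

theorem map_mkQ_mul (A : HopfSubalgebra k H) (s t : H ⊗[k] H)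
    (ht : TensorProduct.map A.leftAugIdeal.mkQ A.leftAugIdeal.mkQ t = 0) :
    TensorProduct.map A.leftAugIdeal.mkQ A.leftAugIdeal.mkQ (s * t) = 0 := by
  induction s with
  | zero => simp
  | add a b ha hb => rw [add_mul, map_add, ha, hb, add_zero]
  | tmul a b =>
    have key : TensorProduct.map A.leftAugIdeal.mkQ A.leftAugIdeal.mkQ ((a ⊗ₜ[k] b) * t) =
        TensorProduct.map
          (A.leftAugIdeal.mapQ A.leftAugIdeal (LinearMap.mulLeft k a)
            fun _ hx => A.mul_mem_leftAugIdeal a hx)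
          (A.leftAugIdeal.mapQ A.leftAugIdeal (LinearMap.mulLeft k b)
            fun _ hx => A.mul_mem_leftAugIdeal b hx)
          (TensorProduct.map A.leftAugIdeal.mkQ A.leftAugIdeal.mkQ t) := by
      clear ht
      induction t with
      | zero => simp
      | add x y hx hy => rw [mul_add, map_add, hx, hy, map_add, map_add]
      | tmul x y =>
        simp only [Algebra.TensorProduct.tmul_mul_tmul, TensorProduct.map_tmul]
        rfl
    rw [key, ht, map_zero]

/-- `HA⁺` is a coideal, so that `H / HA⁺` is a quotient coalgebra of `H`. -/
instance instIsCoidealLeftAugIdeal (A : HopfSubalgebra k H) : A.leftAugIdeal.IsCoideal where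
  counit_eq_zero x hx := by
    refine Submodule.span_induction (p := fun x _ => Coalgebra.counit (R := k) x = 0)
      ?_ ?_ ?_ ?_ (show x ∈ Ideal.span _ from hx)
    · exact fun a ha => ha.2
    · simp
    · intro a b _ _ ha hb; rw [map_add, ha, hb, add_zero]
    · intro a b _ hb; rw [smul_eq_mul, Bialgebra.counit_mul, hb, mul_zero]
  map_mkQ_comul_eq_zero x hx := by
    refine Submodule.span_induction (p := fun x _ => TensorProduct.map A.leftAugIdeal.mkQ
      A.leftAugIdeal.mkQ (Coalgebra.comul (R := k) x) = 0)
      ?_ ?_ ?_ ?_ (show x ∈ Ideal.span _ from hx)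
    · rintro a ⟨ha, ha0⟩
      obtain ⟨s, hs⟩ := A.comul_mem' a ha
      rw [← hs, map_mkQ_mapIncl, hs, Coalgebra.rTensor_counit_comul]
      simp [ha0]
    · simp
    · intro a b _ _ ha hb; rw [map_add, map_add, ha, hb, add_zero]
    · intro a b _ hb
      rw [smul_eq_mul, Bialgebra.comul_mul]
      exact A.map_mkQ_mul _ _ hb

end HopfSubalgebra

/-! ### Algebra types -/

/-- The `k`-algebra `R` is of type `(1, n; d₁, n₁; …; d_r, n_r)`, where `l` is the list of the pairs
`(d_i, n_i)`: it is isomorphic to `k^(n) × ∏ i, M_{d_i}(k)^(n_i)`. -/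
def IsOfAlgebraType (k R : Type*) [Field k] [Ring R] [Algebra k R] (n : ℕ) (l : List (ℕ × ℕ)) :
    Prop :=
  Nonempty (R ≃ₐ[k] (Fin n → k) ×
    ((i : Fin l.length) → Fin (l.get i).2 → Matrix (Fin (l.get i).1) (Fin (l.get i).1) k))

end

/-! The quotient C = H/HA⁺ is a module coalgebra of dimension three. Its dual algebra is semisimple
(`isSemisimpleRing_convDual`), and 3 is a sum of positive squares only as 1+1+1, so C has a basis of
three group-like elements. The matrix coefficients u_ij ∈ H^* of the action of H in this basis form
a magic unitary: orbit maps of group-likes are coalgebra maps, which gives the column relations, and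
the antipode transposes the matrix, which gives the row relations. The entries of a magic unitary of
size three commute (`IsMagicUnitary.commute`), so they are sums of orthogonal idempotents d_σ
indexed by S₃, and h ↦ Σ d_σ(h) σ is a bialgebra map H → kS₃ through which the action on C factors.
If some d_σ vanished, the permutations with d_σ ≠ 0 would commute pairwise, H would act on C through
a commutative algebra, the integral e of A would be central and A would be normal. Hence the map is
onto, and its image is B.

A one-dimensional representation x, that is, an element of G = G(H^*), gives a coinner automorphism
of H that preserves HA⁺ and permutes the group-likes of C. So x normalizes the family d_σ, and the
products d_σ x span a subalgebra of H^* stable under the antipode; its annihilator is the Hopf ideal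
defining H̄. Evaluation at the integral Λ of H shows that the only linear relations among the d_σ x
come from the sign representation s, for which d_σ s = ±d_σ (`mul_char_apply_integral`). Therefore
H̄ is a product of |G|/2 copies of kS₃ as an algebra, |G| is even because s has order two, and the
idempotent |G|⁻¹ Σ_x d_1 x acts on H with rank dim H / (3|G|), which is then an integer.

Two inputs are proved on the way. The first is S² = 1 (Larson and Radford): the functional T(a) =
Tr(x ↦ a S²(x)) is an integral of H^*, Radford's formula for S⁴ makes S² of finite order, a
positivity argument gives Tr S² ≠ 0, and comparing with the regular character of H^* leaves only S²
= 1. The second is the integral e of A, with dim A · T(e) = dim H. It gives dim C = 3 and the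
description of A as the set of x with Δ(x)(1 ⊗ e) = x ⊗ e, from which centrality of e yields
normality. -/

noncomputable section

open Coalgebra HopfAlgebra WithConv

/-! ### Convolution on the dual of a coalgebra -/

/-- The dual of a coalgebra, with the convolution product. -/
abbrev ConvDual (k C : Type*) [CommSemiring k] [AddCommMonoid C] [Module k C] :=
  WithConv (C →ₗ[k] k)

theorem WithConv.congr_fun {k V W : Type*} [CommSemiring k] [AddCommMonoid V] [Module k V]
    [AddCommMonoid W] [Module k W] {f g : WithConv (V →ₗ[k] W)} (h : f = g) (x : V) :
    f x = g x := by rw [h]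

section Hit

variable {k C : Type*} [Field k] [AddCommGroup C] [Module k C] [Coalgebra k C]

/-- `x ↦ x₁ f(x₂)`. -/
def rightHit : ConvDual k C →ₗ[k] Module.End k C where
  toFun f := (TensorProduct.rid k C).toLinearMap ∘ₗ f.ofConv.lTensor C ∘ₗ comul
  map_add' f g := by ext; simp [LinearMap.lTensor_add]
  map_smul' c f := by ext; simp [LinearMap.lTensor_smul]

/-- `x ↦ f(x₁) x₂`. -/
def leftHit : ConvDual k C →ₗ[k] Module.End k C where
  toFun f := (TensorProduct.lid k C).toLinearMap ∘ₗ f.ofConv.rTensor C ∘ₗ comul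
  map_add' f g := by ext; simp [LinearMap.rTensor_add]
  map_smul' c f := by ext; simp [LinearMap.rTensor_smul]

theorem rightHit_repr (f : ConvDual k C) {x : C} {ι : Type*} (r : Repr k x ι) :
    rightHit f x = ∑ i ∈ r.index, f (r.right i) • r.left i := by
  simp [rightHit, ← r.eq]

theorem leftHit_repr (f : ConvDual k C) {x : C} {ι : Type*} (r : Repr k x ι) :
    leftHit f x = ∑ i ∈ r.index, f (r.left i) • r.right i := by
  simp [leftHit, ← r.eq]

/-- The hits are transposes of convolution by f. Together with `convDual_ext` this turns identities
between hits into associativity of convolution. -/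
theorem apply_rightHit (f g : ConvDual k C) (x : C) : g (rightHit f x) = (g * f) x := by
  rw [(ℛ k x).convMul_apply, rightHit_repr f (ℛ k x), map_sum]
  simp [mul_comm]

theorem apply_leftHit (f g : ConvDual k C) (x : C) : g (leftHit f x) = (f * g) x := by
  rw [(ℛ k x).convMul_apply, leftHit_repr f (ℛ k x), map_sum]
  simp

set_option linter.unusedSectionVars false in
variable (k) in
theorem convDual_ext {x y : C} (h : ∀ f : ConvDual k C, f x = f y) : x = y := by
  rw [← sub_eq_zero, ← Module.forall_dual_apply_eq_zero_iff k]
  intro f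
  simpa [sub_eq_zero] using h (toConv f)

theorem rightHit_mul (f g : ConvDual k C) : rightHit (f * g) = rightHit f * rightHit g := by
  ext x
  refine convDual_ext k fun h => ?_
  simp only [Module.End.mul_apply]
  rw [apply_rightHit, apply_rightHit, apply_rightHit, mul_assoc]

theorem leftHit_mul (f g : ConvDual k C) : leftHit (f * g) = leftHit g * leftHit f := by
  ext x
  refine convDual_ext k fun h => ?_
  simp only [Module.End.mul_apply]
  rw [apply_leftHit, apply_leftHit, apply_leftHit, mul_assoc]

theorem rightHit_one : rightHit (1 : ConvDual k C) = 1 := by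
  ext x
  refine convDual_ext k fun h => ?_
  rw [apply_rightHit, mul_one, Module.End.one_apply]

@[simp]
theorem convDual_one_apply (x : C) : (1 : ConvDual k C) x = counit (R := k) x := rfl

theorem convDual_mul_apply_map {C' : Type*} [AddCommGroup C'] [Module k C'] [Coalgebra k C']
    (φ : C' →ₗc[k] C) (f g : ConvDual k C) (x : C') :
    (f * g) (φ x) = ((toConv (f.ofConv ∘ₗ φ.toLinearMap) : ConvDual k C') *
      toConv (g.ofConv ∘ₗ φ.toLinearMap)) x := by
  have := LinearMap.congr_fun (LinearMap.convMul_comp_coalgHom_distrib f g φ) x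
  exact this

end Hit

/-! ### Convolution identities for the antipode -/

section Hopf

variable {k H : Type*} [Field k] [Ring H] [HopfAlgebra k H]

local notation "𝓢" => antipode k (A := H)

theorem convDual_mul_one (f g : ConvDual k H) : (f * g) 1 = f 1 * g 1 := by
  simp [LinearMap.convMul_apply, Bialgebra.comul_one, Algebra.TensorProduct.one_def]

/-- Δ(h) = (h₁ ⊗ 1)(1 ⊗ h₂) exhibits Δ as a convolution product of two algebra maps. An algebra map
has its composite with the antipode as convolution inverse, so the identities below follow by
cancelling one factor. -/
theorem comul_eq_convMul : (toConv (comul (R := k) (A := H)) : WithConv (H →ₗ[k] H ⊗[k] H)) =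
    toConv (Algebra.TensorProduct.includeLeft (R := k) (S := k) (A := H) (B := H)).toLinearMap *
      toConv (Algebra.TensorProduct.includeRight (R := k) (A := H) (B := H)).toLinearMap := by
  ext h
  rw [(ℛ k h).convMul_apply]
  simp [← (ℛ k h).eq]

theorem algHom_antipode_convMul {E : Type*} [Ring E] [Algebra k E] (φ : H →ₐ[k] E) :
    (toConv (φ.toLinearMap ∘ₗ antipode k) : WithConv (H →ₗ[k] E)) * toConv φ.toLinearMap = 1 := by
  have := LinearMap.algHom_comp_convMul_distrib φ
    (toConv (antipode k (A := H))) (toConv (LinearMap.id (R := k) (M := H)))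
  rw [LinearMap.antipode_mul_id] at this
  refine WithConv.ofConv_injective (this.symm.trans ?_)
  ext x; simp

theorem algHom_convMul_antipode {E : Type*} [Ring E] [Algebra k E] (φ : H →ₐ[k] E) :
    (toConv φ.toLinearMap : WithConv (H →ₗ[k] E)) * toConv (φ.toLinearMap ∘ₗ antipode k) = 1 := by
  have := LinearMap.algHom_comp_convMul_distrib φ
    (toConv (LinearMap.id (R := k) (M := H))) (toConv (antipode k (A := H)))
  rw [LinearMap.id_mul_antipode] at this
  refine WithConv.ofConv_injective (this.symm.trans ?_)
  ext x; simp

theorem sum_antipode_tmul_one_mul_comul (h : H) {ι : Type*} (r : Repr k h ι) :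
    ∑ i ∈ r.index, (𝓢 (r.left i) ⊗ₜ[k] (1 : H)) * comul (r.right i) = 1 ⊗ₜ h := by
  have h1 : (toConv ((Algebra.TensorProduct.includeLeft (R := k) (S := k) (A := H)
      (B := H)).toLinearMap ∘ₗ 𝓢) : WithConv (H →ₗ[k] H ⊗[k] H)) * toConv comul =
      toConv (Algebra.TensorProduct.includeRight (R := k) (A := H) (B := H)).toLinearMap := by
    rw [comul_eq_convMul, ← mul_assoc, algHom_antipode_convMul, one_mul]
  have h2 := WithConv.congr_fun h1 h
  rw [r.convMul_apply] at h2
  simpa using h2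

theorem sum_comul_mul_one_tmul_antipode (h : H) {ι : Type*} (r : Repr k h ι) :
    ∑ i ∈ r.index, comul (r.left i) * ((1 : H) ⊗ₜ[k] 𝓢 (r.right i)) = h ⊗ₜ 1 := by
  have h1 : (toConv comul : WithConv (H →ₗ[k] H ⊗[k] H)) *
      toConv ((Algebra.TensorProduct.includeRight (R := k) (A := H)
      (B := H)).toLinearMap ∘ₗ 𝓢) =
      toConv (Algebra.TensorProduct.includeLeft (R := k) (S := k) (A := H)
        (B := H)).toLinearMap := by
    rw [comul_eq_convMul, mul_assoc, algHom_convMul_antipode, mul_one]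
  have h2 := WithConv.congr_fun h1 h
  rw [r.convMul_apply] at h2
  simpa using h2

/-- The antipode is anticomultiplicative. -/
theorem comul_antipode (h : H) :
    comul (𝓢 h) = TensorProduct.map 𝓢 𝓢 (TensorProduct.comm k H H (comul h)) := by
  set i1 := (Algebra.TensorProduct.includeLeft (R := k) (S := k) (A := H) (B := H)) with hi1
  set i2 := (Algebra.TensorProduct.includeRight (R := k) (A := H) (B := H)) with hi2
  -- Both sides of the claim are convolution inverses of Δ, one on the left and one on the right.
  have hL : (toConv ((Bialgebra.comulAlgHom k H).toLinearMap ∘ₗ 𝓢) :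
      WithConv (H →ₗ[k] H ⊗[k] H)) * toConv comul = 1 :=
    algHom_antipode_convMul (Bialgebra.comulAlgHom k H)
  have hR : (toConv comul : WithConv (H →ₗ[k] H ⊗[k] H)) *
      (toConv (i2.toLinearMap ∘ₗ 𝓢) * toConv (i1.toLinearMap ∘ₗ 𝓢)) = 1 := by
    rw [comul_eq_convMul, mul_assoc, ← mul_assoc (toConv i2.toLinearMap),
      algHom_convMul_antipode, one_mul, algHom_convMul_antipode]
  have h1 := WithConv.congr_fun (left_inv_eq_right_inv hL hR) h
  rw [(ℛ k h).convMul_apply] at h1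
  refine h1.trans ?_
  rw [← (ℛ k h).eq]
  simp [i1, i2]

/-- `(f ∘ 𝓢) * (g ∘ 𝓢) = (g * f) ∘ S`. -/
theorem convDual_comp_antipode (f g : ConvDual k H) :
    (toConv (f.ofConv ∘ₗ 𝓢) : ConvDual k H) * toConv (g.ofConv ∘ₗ 𝓢) =
      toConv ((g * f).ofConv ∘ₗ 𝓢) := by
  ext h
  have : (g * f).ofConv (𝓢 h) = (g * f) (𝓢 h) := rfl
  rw [(ℛ k h).convMul_apply]
  simp only [LinearMap.comp_apply, this, LinearMap.convMul_apply, comul_antipode]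
  rw [← (ℛ k h).eq]
  simp [mul_comm]

end Hopf

/-! ### Integrals in a finite-dimensional Hopf algebra -/

section Integral

variable {k H : Type*} [Field k] [Ring H] [HopfAlgebra k H]

local notation "𝓢" => antipode k (A := H)

variable (k) in
/-- A two-sided integral `Λ` of `H`, normalized by `ε(Λ) = 1`. -/
structure IsNormalizedIntegral (Λ : H) : Prop where
  mul_left : ∀ h : H, h * Λ = counit (R := k) h • Λ
  mul_right : ∀ h : H, Λ * h = counit (R := k) h • Λ
  counit_eq : counit (R := k) Λ = 1

/-- The normalization of an integral in a semisimple Hopf algebra. -/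
theorem exists_isNormalizedIntegral [IsSemisimpleRing H] :
    ∃ Λ : H, IsNormalizedIntegral k Λ := by
  -- The integral is the component of 1 in a left ideal complementary to the augmentation ideal.
  obtain ⟨J, hJ⟩ := exists_isCompl (RingHom.ker (Bialgebra.counitAlgHom k H) : Submodule H H)
  have hmem : ∀ x : H, x ∈ (RingHom.ker (Bialgebra.counitAlgHom k H) : Submodule H H) ↔
      counit (R := k) x = 0 := fun x => by
    rw [RingHom.mem_ker]; rfl
  have h1 : (1 : H) ∈ (RingHom.ker (Bialgebra.counitAlgHom k H) : Submodule H H) ⊔ J := by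
    rw [hJ.sup_eq_top]; trivial
  obtain ⟨y, hy, Λ, hΛ, hyΛ⟩ := Submodule.mem_sup.1 h1
  rw [hmem] at hy
  have hε : counit (R := k) Λ = 1 := by
    have := congrArg (counit (R := k)) hyΛ
    rwa [map_add, hy, zero_add, Bialgebra.counit_one] at this
  have hl : ∀ h : H, h * Λ = counit (R := k) h • Λ := by
    intro h
    rw [← sub_eq_zero]
    refine (Submodule.disjoint_def.1 hJ.disjoint) _ ?_ ?_
    · rw [hmem]; simp [hε]
    · rw [← algebraMap_smul H (counit (R := k) h) Λ]
      exact J.sub_mem (J.smul_mem h hΛ) (J.smul_mem _ hΛ)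
  refine ⟨Λ, hl, fun h => ?_, hε⟩
  rw [← sub_eq_zero]
  -- The defect z is a left integral with ε(z) = 0. A left ideal K complementary to its span then
  -- contains z: writing 1 = az + w with w in K gives z = zw, because z² = ε(z)z = 0.
  set z := Λ * h - counit (R := k) h • Λ with hz
  have hzl : ∀ a : H, a * z = counit (R := k) a • z := by
    intro a
    rw [hz, mul_sub, ← mul_assoc, hl, mul_smul_comm, hl, smul_sub, smul_mul_assoc, smul_comm]
  have hεz : counit (R := k) z = 0 := by simp [hz, hε]
  obtain ⟨K, hK⟩ := exists_isCompl (Submodule.span H {z})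
  have h2 : (1 : H) ∈ Submodule.span H {z} ⊔ K := by
    rw [hK.sup_eq_top]; trivial
  obtain ⟨c, hc, w, hw, hcw⟩ := Submodule.mem_sup.1 h2
  obtain ⟨a, rfl⟩ := Submodule.mem_span_singleton.1 hc
  refine (Submodule.disjoint_def.1 hK.disjoint) _ (Submodule.mem_span_singleton_self z) ?_
  have : z = z * w := by
    conv_lhs => rw [← mul_one z, ← hcw, mul_add, smul_eq_mul, ← mul_assoc, hzl]
    simp [hεz]
  rw [this]
  exact K.smul_mem z hw

theorem IsNormalizedIntegral.unique {Λ Λ' : H} (h : IsNormalizedIntegral k Λ)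
    (h' : IsNormalizedIntegral k Λ') : Λ = Λ' := by
  have h1 := h.mul_left Λ'
  have h2 := h'.mul_right Λ
  rw [h'.counit_eq, one_smul] at h1
  rw [h.counit_eq, one_smul] at h2
  exact h1.symm.trans h2

theorem convDual_mul_apply_mul (f g : ConvDual k H) (t : H ⊗[k] H) (a b : H) :
    LinearMap.mul' k k (TensorProduct.map (f.ofConv ∘ₗ LinearMap.mulRight k a)
      (g.ofConv ∘ₗ LinearMap.mulRight k b) t) =
    LinearMap.mul' k k (TensorProduct.map f.ofConv g.ofConv (t * (a ⊗ₜ b))) := by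
  induction t with
  | zero => simp
  | add x y hx hy => simp only [map_add, add_mul, hx, hy]
  | tmul x y => simp

theorem convDual_mul_apply_mul' (f g : ConvDual k H) (t : H ⊗[k] H) (a b : H) :
    LinearMap.mul' k k (TensorProduct.map (f.ofConv ∘ₗ LinearMap.mulLeft k a)
      (g.ofConv ∘ₗ LinearMap.mulLeft k b) t) =
    LinearMap.mul' k k (TensorProduct.map f.ofConv g.ofConv ((a ⊗ₜ b) * t)) := by
  induction t with
  | zero => simp
  | add x y hx hy => simp only [map_add, mul_add, hx, hy]
  | tmul x y => simp

variable {Λ : H} (hΛ : IsNormalizedIntegral k Λ)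
include hΛ

/-- Substitute h ⊗ 1 = Σ Δ(h₁)(1 ⊗ S h₂); then Δ(Λ)Δ(h₁) = ε(h₁)Δ(Λ). -/
theorem IsNormalizedIntegral.comul_mul_tmul_one (h : H) :
    comul Λ * (h ⊗ₜ[k] 1) = comul Λ * (1 ⊗ₜ 𝓢 h) := by
  rw [← sum_comul_mul_one_tmul_antipode h (ℛ k h), Finset.mul_sum]
  simp_rw [← mul_assoc, ← Bialgebra.comul_mul, hΛ.mul_right, map_smul, smul_mul_assoc]
  conv_rhs => rw [← sum_counit_smul (ℛ k h)]
  simp [TensorProduct.tmul_sum, Finset.mul_sum]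

theorem IsNormalizedIntegral.one_tmul_mul_comul (h : H) :
    (1 ⊗ₜ[k] h) * comul Λ = (𝓢 h ⊗ₜ 1) * comul Λ := by
  rw [← sum_antipode_tmul_one_mul_comul h (ℛ k h), Finset.sum_mul]
  simp_rw [mul_assoc, ← Bialgebra.comul_mul, hΛ.mul_left, map_smul, mul_smul_comm]
  have h1 : ∑ i ∈ (ℛ k h).index, counit (R := k) ((ℛ k h).right i) • (ℛ k h).left i = h := by
    have := rightHit_repr (1 : ConvDual k H) (ℛ k h)
    rw [rightHit_one] at this
    exact this.symm
  conv_rhs => rw [← h1]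
  simp [TensorProduct.sum_tmul, Finset.sum_mul, ← TensorProduct.smul_tmul']

theorem IsNormalizedIntegral.mulRight_convMul (f g : ConvDual k H) (h : H) :
    ((toConv (f.ofConv ∘ₗ LinearMap.mulRight k h) : ConvDual k H) * g) Λ =
      (f * toConv (g.ofConv ∘ₗ LinearMap.mulRight k (𝓢 h))) Λ := by
  have h1 := convDual_mul_apply_mul f g (comul Λ) h 1
  have h2 := convDual_mul_apply_mul f g (comul Λ) 1 (𝓢 h)
  rw [hΛ.comul_mul_tmul_one, ← h2] at h1
  simpa [LinearMap.mulRight_one] using h1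

theorem IsNormalizedIntegral.convMul_mulLeft (f g : ConvDual k H) (h : H) :
    (f * toConv (g.ofConv ∘ₗ LinearMap.mulLeft k h)) Λ =
      ((toConv (f.ofConv ∘ₗ LinearMap.mulLeft k (𝓢 h)) : ConvDual k H) * g) Λ := by
  have h1 := convDual_mul_apply_mul' f g (comul Λ) 1 h
  have h2 := convDual_mul_apply_mul' f g (comul Λ) (𝓢 h) 1
  rw [hΛ.one_tmul_mul_comul, ← h2] at h1
  simpa [LinearMap.mulLeft_one] using h1

/-- This makes the image of f ↦ `leftHit f Λ` a left ideal. -/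
theorem IsNormalizedIntegral.mul_leftHit (f : ConvDual k H) (h : H) :
    h * leftHit f Λ = leftHit (toConv (f.ofConv ∘ₗ LinearMap.mulLeft k (𝓢 h))) Λ := by
  refine convDual_ext k fun g => ?_
  rw [apply_leftHit, ← hΛ.convMul_mulLeft, ← apply_leftHit]
  rfl

theorem IsNormalizedIntegral.leftHit_mul_antipode (f : ConvDual k H) (h : H) :
    leftHit f Λ * 𝓢 h = leftHit (toConv (f.ofConv ∘ₗ LinearMap.mulRight k h)) Λ := by
  refine convDual_ext k fun g => ?_
  rw [apply_leftHit, hΛ.mulRight_convMul, ← apply_leftHit]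
  rfl

end Integral

/-! ### Nondegeneracy of the integral in finite dimension -/

section FiniteDimensional

/-- The expansion of `Δ(x)` along a basis. -/
def basisRepr {k C ι : Type*} [Field k] [AddCommGroup C] [Module k C] [Coalgebra k C] [Fintype ι]
    (b : Module.Basis ι k C) (x : C) : Repr k x ι where
  index := Finset.univ
  left := b
  right i := leftHit (toConv (b.coord i)) x
  eq := by
    simp_rw [leftHit_repr _ (ℛ k x), TensorProduct.tmul_sum]
    rw [Finset.sum_comm, ← (ℛ k x).eq]
    refine Finset.sum_congr rfl fun j _ => ?_
    conv_rhs => rw [← b.sum_repr ((ℛ k x).left j), TensorProduct.sum_tmul]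
    simp [TensorProduct.smul_tmul]

variable {k H : Type*} [Field k] [Ring H] [HopfAlgebra k H] [FiniteDimensional k H]

local notation "𝓢" => antipode k (A := H)

variable {Λ : H} (hΛ : IsNormalizedIntegral k Λ)
include hΛ

/-- The hits of Λ form a left ideal by `mul_leftHit`, and 1 is among them because Σ S(Λ₁)Λ₂ = ε(Λ)1
= 1. -/
theorem IsNormalizedIntegral.exists_leftHit_eq (y : H) : ∃ f : ConvDual k H, leftHit f Λ = y := by
  have h1 : ∃ f : ConvDual k H, leftHit f Λ = 1 := by
    set b := Module.finBasis k H
    have := sum_antipode_mul_eq_smul (basisRepr b Λ)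
    rw [hΛ.counit_eq, one_smul] at this
    rw [← this]
    simp only [basisRepr, hΛ.mul_leftHit]
    refine ⟨∑ i, toConv ((b.coord i) ∘ₗ LinearMap.mulLeft k (𝓢 (𝓢 (b i)))), ?_⟩
    rw [map_sum, LinearMap.sum_apply]
  obtain ⟨f, hf⟩ := h1
  exact ⟨_, by rw [← hΛ.mul_leftHit f y, hf, mul_one]⟩

theorem IsNormalizedIntegral.rightHit_injective {f : ConvDual k H} (hf : rightHit f Λ = 0) :
    f = 0 := by
  ext y
  obtain ⟨g, rfl⟩ := hΛ.exists_leftHit_eq y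
  change f (leftHit g Λ) = 0
  rw [apply_leftHit, ← apply_rightHit, hf, map_zero]

theorem IsNormalizedIntegral.leftHit_injective {f : ConvDual k H} (hf : leftHit f Λ = 0) :
    f = 0 := by
  set P : ConvDual k H →ₗ[k] H := (LinearMap.applyₗ Λ) ∘ₗ leftHit with hP
  have hsurj : Function.Surjective P := hΛ.exists_leftHit_eq
  have hfin : Module.finrank k (ConvDual k H) = Module.finrank k H := by
    rw [(WithConv.linearEquiv k (H →ₗ[k] k)).finrank_eq]
    exact Subspace.dual_finrank_eq
  have : Module.Finite k (ConvDual k H) :=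
    Module.Finite.equiv (WithConv.linearEquiv k (H →ₗ[k] k)).symm
  have hinj := (LinearMap.injective_iff_surjective_of_finrank_eq_finrank hfin).2 hsurj
  exact hinj ((show P f = 0 from hf).trans (map_zero P).symm)

/-- If f hits Λ to 1, then h is the hit of Λ by f(S(h) · ), which vanishes with S(h). -/
theorem IsNormalizedIntegral.antipode_bijective : Function.Bijective 𝓢 := by
  have hinj : Function.Injective 𝓢 := by
    rw [injective_iff_map_eq_zero]
    intro h hh
    obtain ⟨f, hf⟩ := hΛ.exists_leftHit_eq 1
    have := hΛ.mul_leftHit f h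
    rw [hf, hh, mul_one] at this
    rw [this]
    have h0 : (toConv (f.ofConv ∘ₗ LinearMap.mulLeft k (0 : H)) : ConvDual k H) = 0 := by
      ext; simp
    rw [h0]; simp
  exact ⟨hinj, LinearMap.injective_iff_surjective.1 hinj⟩

theorem IsNormalizedIntegral.antipode_eq : 𝓢 Λ = Λ := by
  refine IsNormalizedIntegral.unique (k := k) ⟨fun h => ?_, fun h => ?_, ?_⟩ hΛ
  · obtain ⟨h, rfl⟩ := hΛ.antipode_bijective.2 h
    rw [← antipode_mul_antidistrib, hΛ.mul_right, map_smul, counit_antipode]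
  · obtain ⟨h, rfl⟩ := hΛ.antipode_bijective.2 h
    rw [← antipode_mul_antidistrib, hΛ.mul_left, map_smul, counit_antipode]
  · rw [counit_antipode, hΛ.counit_eq]

end FiniteDimensional

/-! ### The trace of the square of the antipode as an integral of the dual -/

theorem trace_of_apply_eq_sum {k V ι : Type*} [Field k] [AddCommGroup V] [Module k V]
    [FiniteDimensional k V] {s : Finset ι} {φ : ι → V →ₗ[k] k} {v : ι → V} {T : V →ₗ[k] V}
    (h : ∀ x, T x = ∑ i ∈ s, φ i x • v i) : LinearMap.trace k V T = ∑ i ∈ s, φ i (v i) := by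
  have : T = ∑ i ∈ s, (φ i).smulRight (v i) := by
    ext x; simp [h]
  simp [this]

section

variable {k H : Type*} [Field k] [Ring H] [HopfAlgebra k H]

local notation "𝓢" => antipode k (A := H)

variable (k H) in
/-- The functional `a ↦ Tr(x ↦ a S²(x))`. -/
def antipodeSqTrace : ConvDual k H :=
  toConv (LinearMap.trace k H ∘ₗ LinearMap.lcomp k H (𝓢 ∘ₗ 𝓢) ∘ₗ LinearMap.mul k H)

theorem antipodeSqTrace_apply (a : H) : antipodeSqTrace k H a =
    LinearMap.trace k H (LinearMap.mulLeft k a ∘ₗ 𝓢 ∘ₗ 𝓢) := rfl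

theorem antipode_antipode_mul (x y : H) : 𝓢 (𝓢 (x * y)) = 𝓢 (𝓢 x) * 𝓢 (𝓢 y) := by
  simp only [antipode_mul_antidistrib]

theorem antipodeSqTrace_mul_comm (x y : H) :
    antipodeSqTrace k H (x * y) = antipodeSqTrace k H (y * 𝓢 (𝓢 x)) := by
  simp only [antipodeSqTrace_apply]
  have h1 : LinearMap.mulLeft k (x * y) ∘ₗ 𝓢 ∘ₗ 𝓢 =
      LinearMap.mulLeft k x * (LinearMap.mulLeft k y ∘ₗ 𝓢 ∘ₗ 𝓢) := by ext; simp
  have h2 : LinearMap.mulLeft k (y * 𝓢 (𝓢 x)) ∘ₗ 𝓢 ∘ₗ 𝓢 =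
      (LinearMap.mulLeft k y ∘ₗ 𝓢 ∘ₗ 𝓢) * LinearMap.mulLeft k x := by
    ext; simp [antipode_antipode_mul]
  rw [h1, h2, LinearMap.trace_mul_comm]

variable [FiniteDimensional k H] {Λ : H} (hΛ : IsNormalizedIntegral k Λ)

include hΛ in
-- A functional l with `leftHit l Λ = 1` yields dual bases: x = Σ l(Λ₁ S⁻¹(x)) Λ₂. In them the trace
-- of x ↦ S(b)S²(x) is Σ l(Λ₁ S(Λ₂) b), which collapses to l(b).
theorem IsNormalizedIntegral.eq_antipodeSqTrace {l : ConvDual k H} (hl : leftHit l Λ = 1) (b : H) :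
    l b = antipodeSqTrace k H (𝓢 b) := by
  have hexp : ∀ x : H, x = ∑ i ∈ (ℛ k Λ).index,
      l ((ℛ k Λ).left i * (LinearEquiv.ofBijective 𝓢 hΛ.antipode_bijective).symm x) •
        (ℛ k Λ).right i := by
    intro x
    obtain ⟨y, rfl⟩ := (LinearEquiv.ofBijective 𝓢 hΛ.antipode_bijective).surjective x
    have h1 := hΛ.leftHit_mul_antipode l y
    rw [hl, one_mul, leftHit_repr _ (ℛ k Λ)] at h1
    rw [LinearEquiv.symm_apply_apply]
    exact h1
  rw [antipodeSqTrace_apply, trace_of_apply_eq_sum (s := (ℛ k Λ).index)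
    (φ := fun i => l.ofConv ∘ₗ LinearMap.mulLeft k ((ℛ k Λ).left i) ∘ₗ
      (LinearEquiv.ofBijective 𝓢 hΛ.antipode_bijective).symm.toLinearMap ∘ₗ
      LinearMap.mulLeft k (𝓢 b) ∘ₗ 𝓢 ∘ₗ 𝓢) (v := (ℛ k Λ).right)]
  · have h2 : ∀ r : H, (LinearEquiv.ofBijective 𝓢 hΛ.antipode_bijective).symm
        (𝓢 b * 𝓢 (𝓢 r)) = 𝓢 r * b := by
      intro r
      rw [LinearEquiv.symm_apply_eq]
      simp [antipode_mul_antidistrib]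
    simp only [LinearMap.comp_apply, LinearMap.mulLeft_apply, LinearEquiv.coe_coe, h2, ← mul_assoc]
    rw [← map_sum, ← Finset.sum_mul, sum_mul_antipode_eq_smul, hΛ.counit_eq, one_smul, one_mul]
  · intro x
    exact hexp _

include hΛ in
theorem IsNormalizedIntegral.leftHit_antipodeSqTrace_comp_antipode :
    leftHit (toConv ((antipodeSqTrace k H).ofConv ∘ₗ 𝓢)) Λ = 1 := by
  obtain ⟨l, hl⟩ := hΛ.exists_leftHit_eq 1
  have : (toConv ((antipodeSqTrace k H).ofConv ∘ₗ 𝓢) : ConvDual k H) = l := by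
    ext b
    exact (hΛ.eq_antipodeSqTrace hl b).symm
  rw [this, hl]

include hΛ in
theorem IsNormalizedIntegral.antipodeSqTrace_comp_antipode_mul (f : ConvDual k H) :
    (toConv ((antipodeSqTrace k H).ofConv ∘ₗ 𝓢) : ConvDual k H) * f =
      f 1 • toConv ((antipodeSqTrace k H).ofConv ∘ₗ 𝓢) := by
  rw [← sub_eq_zero]
  apply hΛ.leftHit_injective
  have h1 : leftHit f (1 : H) = f 1 • (1 : H) := by
    refine convDual_ext k fun g => ?_
    rw [apply_leftHit, convDual_mul_one, map_smul, smul_eq_mul]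
  rw [map_sub, leftHit_mul, map_smul, LinearMap.sub_apply, Module.End.mul_apply,
    LinearMap.smul_apply, hΛ.leftHit_antipodeSqTrace_comp_antipode, h1, sub_self]

include hΛ in
/-- `a ↦ Tr(x ↦ a S²(x))` is an integral of the dual. -/
theorem IsNormalizedIntegral.mul_antipodeSqTrace (f : ConvDual k H) :
    f * antipodeSqTrace k H = f 1 • antipodeSqTrace k H := by
  have h1 : ∀ f g : ConvDual k H, (toConv (f.ofConv ∘ₗ 𝓢) : ConvDual k H) =
      toConv (g.ofConv ∘ₗ 𝓢) → f = g := by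
    intro f g h
    ext x
    obtain ⟨x, rfl⟩ := hΛ.antipode_bijective.2 x
    exact WithConv.congr_fun h x
  apply h1
  rw [← convDual_comp_antipode, hΛ.antipodeSqTrace_comp_antipode_mul]
  ext x
  simp [antipode_one]

include hΛ in
theorem IsNormalizedIntegral.antipodeSqTrace_apply_self : antipodeSqTrace k H Λ = 1 := by
  have h := congrArg (counit (R := k)) hΛ.leftHit_antipodeSqTrace_comp_antipode
  change (1 : ConvDual k H) _ = _ at h
  rw [apply_leftHit, mul_one, Bialgebra.counit_one] at h
  have h2 : antipodeSqTrace k H (𝓢 Λ) = 1 := h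
  rwa [hΛ.antipode_eq] at h2

include hΛ in
theorem IsNormalizedIntegral.rightHit_antipodeSqTrace (x : H) :
    rightHit (antipodeSqTrace k H) x = antipodeSqTrace k H x • 1 := by
  refine convDual_ext k fun g => ?_
  rw [apply_rightHit, hΛ.mul_antipodeSqTrace, map_smul, smul_eq_mul, mul_comm]
  rfl

include hΛ in
-- Uniqueness of integrals of the dual: both sides have the same right hit of Λ, and that hit
-- determines a functional.
theorem IsNormalizedIntegral.eq_smul_antipodeSqTrace {f : ConvDual k H}
    (hf : ∀ g : ConvDual k H, g * f = g 1 • f) : f = f Λ • antipodeSqTrace k H := by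
  rw [← sub_eq_zero]
  apply hΛ.rightHit_injective
  rw [map_sub, map_smul, LinearMap.sub_apply, LinearMap.smul_apply, hΛ.rightHit_antipodeSqTrace,
    hΛ.antipodeSqTrace_apply_self, one_smul, sub_eq_zero]
  refine convDual_ext k fun g => ?_
  rw [apply_rightHit, hf, map_smul, smul_eq_mul, mul_comm]
  rfl

include hΛ in
theorem IsNormalizedIntegral.eq_smul_of_mul_eq {f : ConvDual k H}
    (hf : ∀ g : ConvDual k H, f * g = g 1 • f) :
    f = f Λ • toConv ((antipodeSqTrace k H).ofConv ∘ₗ 𝓢) := by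
  rw [← sub_eq_zero]
  apply hΛ.leftHit_injective
  rw [map_sub, map_smul, LinearMap.sub_apply, LinearMap.smul_apply,
    hΛ.leftHit_antipodeSqTrace_comp_antipode, sub_eq_zero]
  refine convDual_ext k fun g => ?_
  rw [apply_leftHit, hf, map_smul, smul_eq_mul, mul_comm]
  rfl

include hΛ in
theorem IsNormalizedIntegral.eq_zero_of_antipodeSqTrace_mul {z : H}
    (hz : ∀ y, antipodeSqTrace k H (z * y) = 0) : z = 0 := by
  obtain ⟨z, rfl⟩ := hΛ.antipode_bijective.2 z
  have h := hΛ.leftHit_mul_antipode (toConv ((antipodeSqTrace k H).ofConv ∘ₗ 𝓢)) z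
  rw [hΛ.leftHit_antipodeSqTrace_comp_antipode, one_mul] at h
  have h0 : (toConv ((toConv ((antipodeSqTrace k H).ofConv ∘ₗ 𝓢) : ConvDual k H).ofConv ∘ₗ
      LinearMap.mulRight k z) : ConvDual k H) = 0 := by
    ext x
    change antipodeSqTrace k H (𝓢 (x * z)) = 0
    rw [antipode_mul_antidistrib, hz]
  rw [h, h0]
  simp

include hΛ in
theorem IsNormalizedIntegral.eq_zero_of_antipodeSqTrace_mul' {z : H}
    (hz : ∀ y, antipodeSqTrace k H (y * z) = 0) : z = 0 := by
  apply hΛ.eq_zero_of_antipodeSqTrace_mul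
  intro y
  obtain ⟨y, rfl⟩ := hΛ.antipode_bijective.2 y
  obtain ⟨y, rfl⟩ := hΛ.antipode_bijective.2 y
  rw [← antipodeSqTrace_mul_comm, hz]

variable (k) in
/-- The distinguished group-like element attached to an integral. -/
def distinguished (Λ : H) : H := leftHit (antipodeSqTrace k H) Λ

include hΛ in
-- Right multiplication by f preserves left integrals of the dual, so it acts on their line by a
-- scalar, read off at Λ.
theorem IsNormalizedIntegral.antipodeSqTrace_mul (f : ConvDual k H) :
    antipodeSqTrace k H * f = f (distinguished k Λ) • antipodeSqTrace k H := by
  have h : ∀ g : ConvDual k H, g * (antipodeSqTrace k H * f) = g 1 • (antipodeSqTrace k H * f) := by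
    intro g
    rw [← mul_assoc, hΛ.mul_antipodeSqTrace, smul_mul_assoc]
  rw [hΛ.eq_smul_antipodeSqTrace h, ← apply_leftHit]
  rfl

include hΛ in
theorem IsNormalizedIntegral.leftHit_antipodeSqTrace (x : H) :
    leftHit (antipodeSqTrace k H) x = antipodeSqTrace k H x • distinguished k Λ := by
  refine convDual_ext k fun f => ?_
  rw [apply_leftHit, hΛ.antipodeSqTrace_mul, map_smul, smul_eq_mul, mul_comm]
  rfl

include hΛ in
theorem IsNormalizedIntegral.isGroupLikeElem_distinguished :
    IsGroupLikeElem k (distinguished k Λ) where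
  counit_eq_one := by
    have h : (1 : ConvDual k H) (leftHit (antipodeSqTrace k H) Λ) = 1 := by
      rw [apply_leftHit, mul_one, hΛ.antipodeSqTrace_apply_self]
    exact h
  comul_eq_tmul_self := by
    rw [← (basisRepr (Module.finBasis k H) (distinguished k Λ)).eq]
    have h : ∀ f : ConvDual k H, leftHit f (distinguished k Λ) =
        f (distinguished k Λ) • distinguished k Λ := by
      intro f
      conv_lhs => rw [distinguished, ← Module.End.mul_apply, ← leftHit_mul,
        hΛ.antipodeSqTrace_mul]
      rw [map_smul, LinearMap.smul_apply]
      rfl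
    simp only [basisRepr, h]
    simp_rw [← TensorProduct.smul_tmul]
    rw [← TensorProduct.sum_tmul]
    congr 1
    exact (Module.finBasis k H).sum_repr _

include hΛ in
-- Both sides are right integrals of the dual with value 1 at Λ: translating by the group-like g =
-- `distinguished k Λ` cancels the character f ↦ f(g) by which f acts on T from the right.
theorem IsNormalizedIntegral.antipodeSqTrace_antipode (x : H) :
    antipodeSqTrace k H (𝓢 x) = antipodeSqTrace k H (x * distinguished k Λ) := by
  set g := distinguished k Λ with hg
  have hgl : IsGroupLikeElem k g := hΛ.isGroupLikeElem_distinguished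
  set μ : ConvDual k H := toConv ((antipodeSqTrace k H).ofConv ∘ₗ LinearMap.mulRight k g) with hμ
  have key : ∀ f : ConvDual k H, μ * f = f 1 • μ := by
    intro f
    ext y
    have h1 := hΛ.leftHit_antipodeSqTrace (y * g)
    have h2 : leftHit (antipodeSqTrace k H) (y * g) = leftHit μ y * g := by
      refine convDual_ext k fun φ => ?_
      have h3 := convDual_mul_apply_mul (antipodeSqTrace k H) φ (comul y) g g
      rw [apply_leftHit]
      have h4 : φ (leftHit μ y * g) = (toConv (φ.ofConv ∘ₗ LinearMap.mulRight k g) : ConvDual k H)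
        (leftHit μ y) := rfl
      rw [h4, apply_leftHit, LinearMap.convMul_apply, LinearMap.convMul_apply, Bialgebra.comul_mul,
        hgl.comul_eq_tmul_self, ← h3]
    have h5 : leftHit μ y = μ y • 1 := by
      have h6 : leftHit μ y * g = (μ y • (1 : H)) * g := by
        rw [← h2, h1, smul_mul_assoc, one_mul]; rfl
      exact hgl.isUnit.mul_left_injective h6
    change (μ * f) y = f 1 * μ y
    rw [← apply_leftHit, h5, map_smul, smul_eq_mul, mul_comm]
  have hμΛ : μ Λ = 1 := by
    change antipodeSqTrace k H (Λ * g) = 1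
    rw [hΛ.mul_right, hgl.counit_eq_one, one_smul, hΛ.antipodeSqTrace_apply_self]
  have h := hΛ.eq_smul_of_mul_eq key
  rw [hμΛ, one_smul] at h
  exact WithConv.congr_fun h.symm x

include hΛ in
/-- Radford's formula for the fourth power of the antipode, in the unimodular case. -/
theorem IsNormalizedIntegral.distinguished_mul_antipode_pow_four (x : H) :
    distinguished k Λ * 𝓢 (𝓢 (𝓢 (𝓢 x))) = x * distinguished k Λ := by
  set g := distinguished k Λ with hg
  have hgl : IsGroupLikeElem k g := hΛ.isGroupLikeElem_distinguished
  rw [← sub_eq_zero]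
  apply hΛ.eq_zero_of_antipodeSqTrace_mul'
  intro w
  obtain ⟨w, rfl⟩ := hΛ.antipode_bijective.2 w
  obtain ⟨y, rfl⟩ := hΛ.antipode_bijective.2 w
  rw [mul_sub, map_sub, sub_eq_zero]
  -- Each side is a value of T ∘ S, and there T(ab) = T(b S²(a)) exchanges the two factors. The
  -- conclusion follows by moving the remaining factors around with the same twisted cyclicity.
  have h1 : antipodeSqTrace k H (x * y * g) = antipodeSqTrace k H (𝓢 (𝓢 y) * x * g) := by
    rw [← hΛ.antipodeSqTrace_antipode, ← hΛ.antipodeSqTrace_antipode, antipode_mul_antidistrib,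
      antipodeSqTrace_mul_comm, antipode_mul_antidistrib]
  rw [mul_assoc, mul_assoc, antipodeSqTrace_mul_comm] at h1
  rw [← h1, mul_assoc, antipodeSqTrace_mul_comm y, mul_assoc, ← mul_assoc g (𝓢 (𝓢 x)),
    antipodeSqTrace_mul_comm (g * 𝓢 (𝓢 x)), antipode_antipode_mul, hgl.antipode_antipode]

end

/-! ### Traces of automorphisms of finite order of a semisimple algebra -/

section Positivity

variable {k : Type*} [Field k] [IsAlgClosed k] [CharZero k]

/-- The polynomial X^M − 1 is separable, so f is diagonalizable, and g acts by μ⁻¹ on the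
μ-eigenspace. Sharing the eigenvalues and multiplicities between both traces is what later makes
them complex conjugates. -/
theorem exists_trace_eq_sum_of_pow_eq_one {V : Type*} [AddCommGroup V] [Module k V]
    [FiniteDimensional k V] {f g : Module.End k V} {M : ℕ} (hM : M ≠ 0) (hf : f ^ M = 1)
    (hfg : g * f = 1) : ∃ (s : Finset k) (m : k → ℕ), (∀ μ ∈ s, μ ^ M = 1) ∧
      LinearMap.trace k V f = ∑ μ ∈ s, (m μ : k) * μ ∧
      LinearMap.trace k V g = ∑ μ ∈ s, (m μ : k) * μ⁻¹ := by
  classical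
  have hss : f.IsSemisimple := by
    refine Module.End.isSemisimple_of_squarefree_aeval_eq_zero (p := Polynomial.X ^ M - 1) ?_ ?_
    · exact (Polynomial.X_pow_sub_one_separable_iff.2 (Nat.cast_ne_zero.2 hM)).squarefree
    · simp [hf]
  have hinternal : DirectSum.IsInternal (fun μ : k => f.eigenspace μ) :=
    DirectSum.isInternal_submodule_of_iSupIndep_of_iSup_eq_top f.eigenspaces_iSupIndep
      hss.iSup_eigenspace_eq_top
  have hfin : {μ : k | f.eigenspace μ ≠ ⊥}.Finite := by
    exact Module.End.finite_hasEigenvalue f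
  have hgf : ∀ μ : k, ∀ x ∈ f.eigenspace μ, μ ^ M • x = x ∧ g x = μ⁻¹ • x := by
    intro μ x hx
    rw [Module.End.mem_eigenspace_iff] at hx
    have h1 : ∀ j : ℕ, (f ^ j) x = μ ^ j • x := by
      intro j
      induction j with
      | zero => simp
      | succ j ih => rw [pow_succ', Module.End.mul_apply, ih, map_smul, hx, smul_smul, pow_succ]
    have h2 : μ ^ M • x = x := by rw [← h1, hf]; rfl
    refine ⟨h2, ?_⟩
    by_cases hμ : μ = 0
    · rw [hμ, zero_pow hM, zero_smul] at h2
      simp [← h2]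
    · have h3 : g (f x) = x := LinearMap.congr_fun hfg x
      rw [hx, map_smul] at h3
      rw [← h3, smul_smul, inv_mul_cancel₀ hμ, one_smul, h3]
  have hmf : ∀ μ : k, Set.MapsTo f (f.eigenspace μ) (f.eigenspace μ) := by
    intro μ x hx
    rw [SetLike.mem_coe, Module.End.mem_eigenspace_iff.1 hx]
    exact Submodule.smul_mem _ _ hx
  have hmg : ∀ μ : k, Set.MapsTo g (f.eigenspace μ) (f.eigenspace μ) := by
    intro μ x hx
    rw [SetLike.mem_coe, (hgf μ x hx).2]
    exact Submodule.smul_mem _ _ hx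
  refine ⟨hfin.toFinset, fun μ => Module.finrank k (f.eigenspace μ), ?_, ?_, ?_⟩
  · intro μ hμ
    rw [Set.Finite.mem_toFinset, Set.mem_ofPred_eq, Submodule.ne_bot_iff] at hμ
    obtain ⟨x, hx, hx0⟩ := hμ
    have h := (hgf μ x hx).1
    rw [← sub_eq_zero]
    refine (smul_eq_zero.1 ?_).resolve_right hx0
    rw [sub_smul, h, one_smul, sub_self]
  · rw [LinearMap.trace_eq_sum_trace_restrict' hinternal hfin hmf]
    refine Finset.sum_congr rfl fun μ _ => ?_
    have : f.restrict (hmf μ) = μ • LinearMap.id := by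
      ext x
      exact Module.End.mem_eigenspace_iff.1 x.2
    rw [this, map_smul, LinearMap.trace_id, smul_eq_mul, mul_comm]
  · rw [LinearMap.trace_eq_sum_trace_restrict' hinternal hfin hmg]
    refine Finset.sum_congr rfl fun μ _ => ?_
    have : g.restrict (hmg μ) = μ⁻¹ • LinearMap.id := by
      ext x
      exact (hgf μ x x.2).2
    rw [this, map_smul, LinearMap.trace_id, smul_eq_mul, mul_comm]

/-- Eigenvalues of a matrix of finite order are roots of unity, so both traces are algebraic
numbers, and an embedding into ℂ turns inversion of roots of unity into conjugation. -/
theorem exists_conj_trace_of_pow_eq_one {n : Type*} [Fintype n] [DecidableEq n]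
    (φ : algebraicClosure ℚ k →+* ℂ) {A B : Matrix n n k} {M : ℕ} (hM : M ≠ 0) (hA : A ^ M = 1)
    (hBA : B * A = 1) : ∃ a b : algebraicClosure ℚ k, (a : k) = A.trace ∧ (b : k) = B.trace ∧
      φ b = (starRingEnd ℂ) (φ a) := by
  obtain ⟨s, m, hs, h1, h2⟩ := exists_trace_eq_sum_of_pow_eq_one (f := Matrix.toLin' A)
    (g := Matrix.toLin' B) hM (by rw [← Matrix.toLin'_pow, hA, Matrix.toLin'_one]; rfl)
    (by rw [Module.End.mul_eq_comp, ← Matrix.toLin'_mul, hBA, Matrix.toLin'_one]; rfl)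
  rw [Matrix.trace_toLin'_eq] at h1 h2
  have halg : ∀ μ ∈ s, μ ∈ algebraicClosure ℚ k := by
    intro μ hμ
    rw [mem_algebraicClosure_iff']
    refine IsIntegral.of_pow (Nat.pos_of_ne_zero hM) ?_
    rw [hs μ hμ]
    exact isIntegral_one
  refine ⟨∑ μ ∈ s.attach, (m μ : algebraicClosure ℚ k) * ⟨μ, halg μ μ.2⟩,
    ∑ μ ∈ s.attach, (m μ : algebraicClosure ℚ k) * (⟨μ, halg μ μ.2⟩ : algebraicClosure ℚ k)⁻¹,
    ?_, ?_, ?_⟩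
  · rw [h1, ← Finset.sum_attach s]
    change (algebraicClosure ℚ k).val _ = _
    simp
  · rw [h2, ← Finset.sum_attach s]
    change (algebraicClosure ℚ k).val _ = _
    simp
  · simp only [map_sum, map_mul, map_natCast, map_inv₀]
    refine Finset.sum_congr rfl fun μ _ => ?_
    congr 1
    have h3 : (φ ⟨μ, halg μ μ.2⟩) ^ M = 1 := by
      rw [← map_pow]
      have : (⟨μ, halg μ μ.2⟩ : algebraicClosure ℚ k) ^ M = 1 := by
        ext; push_cast; exact hs μ μ.2
      rw [this, map_one]
    exact Complex.inv_eq_conj (Complex.norm_eq_one_of_pow_eq_one h3 hM)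

omit [IsAlgClosed k] [CharZero k] in
/-- The trace of `x ↦ v x w` on a product of matrix algebras. -/
theorem trace_mulLeft_mulRight {ι : Type*} [Fintype ι] [DecidableEq ι] {d : ι → ℕ}
    (v w : ∀ i, Matrix (Fin (d i)) (Fin (d i)) k) :
    LinearMap.trace k (∀ i, Matrix (Fin (d i)) (Fin (d i)) k)
      (LinearMap.mulLeft k v ∘ₗ LinearMap.mulRight k w) =
      ∑ i, (v i).trace * (w i).trace := by
  rw [LinearMap.trace_eq_matrix_trace k
    (Pi.basis fun i => Matrix.stdBasis k (Fin (d i)) (Fin (d i)))]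
  rw [Matrix.trace, Fintype.sum_sigma]
  refine Finset.sum_congr rfl fun i _ => ?_
  rw [Fintype.sum_prod_type, Matrix.trace, Matrix.trace, Finset.sum_mul_sum]
  refine Finset.sum_congr rfl fun p _ => Finset.sum_congr rfl fun q _ => ?_
  rw [Matrix.diag_apply, LinearMap.toMatrix_apply]
  rw [Pi.basis_apply, Pi.basis_repr, Matrix.stdBasis_eq_single]
  have h1 : (LinearMap.mulLeft k v ∘ₗ LinearMap.mulRight k w)
      (Pi.single i (Matrix.single p q 1)) i = v i * Matrix.single p q 1 * w i := by
    simp [mul_assoc]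
  rw [h1]
  change (v i * Matrix.single p q 1 * w i : Matrix (Fin (d i)) (Fin (d i)) k) p q = _
  rw [Matrix.mul_assoc, Matrix.mul_apply, Finset.sum_eq_single p]
  · simp
  · intro j _ hj; simp [Matrix.single_mul_apply_of_ne, hj]
  · simp

omit [IsAlgClosed k] [CharZero k] in
theorem linearMap_pi_matrix_eq_sum_trace {ι : Type*} [Fintype ι] [DecidableEq ι] {d : ι → ℕ}
    (φ : (∀ i, Matrix (Fin (d i)) (Fin (d i)) k) →ₗ[k] k) :
    ∃ v : ∀ i, Matrix (Fin (d i)) (Fin (d i)) k, ∀ a, φ a = ∑ i, (a i * v i).trace := by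
  refine ⟨fun i => Matrix.of fun q p => φ (Pi.single i (Matrix.single p q 1)), fun a => ?_⟩
  set v : ∀ i, Matrix (Fin (d i)) (Fin (d i)) k :=
    fun i => Matrix.of fun q p => φ (Pi.single i (Matrix.single p q 1)) with hv
  have : φ = ∑ i, Matrix.traceLinearMap (Fin (d i)) k k ∘ₗ LinearMap.mulRight k (v i) ∘ₗ
      LinearMap.proj i := by
    refine (Pi.basis fun i => Matrix.stdBasis k (Fin (d i)) (Fin (d i))).ext ?_
    rintro ⟨i, p, q⟩
    rw [Pi.basis_apply, Matrix.stdBasis_eq_single, LinearMap.sum_apply, Finset.sum_eq_single i]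
    · simp [hv, Matrix.trace_single_mul]
    · intro j _ hj
      simp [Pi.single_eq_of_ne hj]
    · simp
  rw [this]
  simp

/-- An automorphism of finite order of a product of matrix algebras, which is a Nakayama
automorphism of a nondegenerate functional, has nonzero trace. -/
theorem trace_ne_zero_of_nakayama {ι : Type*} [Fintype ι] [DecidableEq ι] {d : ι → ℕ}
    (φ : (∀ i, Matrix (Fin (d i)) (Fin (d i)) k) →ₗ[k] k)
    (T : Module.End k (∀ i, Matrix (Fin (d i)) (Fin (d i)) k))
    (hφ : ∀ x, (∀ y, φ (x * y) = 0) → x = 0) (hT : ∀ x y, φ (x * y) = φ (y * T x))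
    {M : ℕ} (hM : M ≠ 0) (hTM : T ^ M = 1)
    (hne : ∃ x, LinearMap.trace k _ (LinearMap.mulLeft k x ∘ₗ T) ≠ 0) :
    LinearMap.trace k _ T ≠ 0 := by
  obtain ⟨v, hv⟩ := linearMap_pi_matrix_eq_sum_trace φ
  set τ : (∀ i, Matrix (Fin (d i)) (Fin (d i)) k) →ₗ[k] k :=
    ∑ i, Matrix.traceLinearMap (Fin (d i)) k k ∘ₗ LinearMap.proj i with hτ
  have hτa : ∀ a, τ a = ∑ i, (a i).trace := fun a => by simp [hτ]
  have hτc : ∀ a b, τ (a * b) = τ (b * a) := fun a b => by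
    rw [hτa, hτa]
    exact Finset.sum_congr rfl fun i _ => Matrix.trace_mul_comm _ _
  have hφτ : ∀ a, φ a = τ (a * v) := fun a => by rw [hv, hτa]; rfl
  have hτ0 : ∀ a, (∀ y, τ (y * a) = 0) → a = 0 := by
    intro a ha
    funext i
    ext p q
    have := ha (Pi.single i (Matrix.single q p 1))
    rw [hτa, Finset.sum_eq_single i] at this
    · simpa [Matrix.trace_single_mul] using this
    · intro j _ hj
      simp [Pi.single_eq_of_ne hj]
    · simp
  -- Write φ = τ( · v) with τ the sum of the traces. Comparing the twisted cyclicity of φ with the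
  -- cyclicity of τ shows that T is conjugation by v, once v is known to be invertible.
  have hTv : ∀ x, T x * v = v * x := by
    intro x
    rw [← sub_eq_zero]
    apply hτ0
    intro y
    rw [mul_sub, map_sub, sub_eq_zero, ← mul_assoc, ← hφτ, ← hT, hφτ, mul_assoc, hτc, mul_assoc]
  have hvinj : Function.Injective (LinearMap.mulLeft k v) := by
    rw [injective_iff_map_eq_zero]
    intro x hx
    apply hφ
    intro y
    rw [LinearMap.mulLeft_apply] at hx
    rw [hT, hφτ, mul_assoc, hTv, hx, mul_zero, map_zero]
  obtain ⟨w, hw⟩ := LinearMap.injective_iff_surjective.1 hvinj 1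
  rw [LinearMap.mulLeft_apply] at hw
  have hvw : ∀ i, v i * w i = 1 := fun i => congrFun hw i
  have hwv : ∀ i, w i * v i = 1 := fun i => mul_eq_one_comm.1 (hvw i)
  have hwv' : w * v = 1 := funext hwv
  have hTx : ∀ x, T x = v * x * w := by
    intro x
    rw [← hTv, mul_assoc, hw, mul_one]
  have hTj : ∀ j : ℕ, ∀ x, (T ^ j) x * v ^ j = v ^ j * x := by
    intro j
    induction j with
    | zero => intro x; simp
    | succ j ih =>
      intro x
      rw [pow_succ, Module.End.mul_apply, pow_succ, ← mul_assoc, ih, mul_assoc, hTv, mul_assoc]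
  -- Since T has order dividing M, the element v^M is central, hence scalar in each block. Dividing
  -- v_i by an M-th root of that scalar makes it of finite order without changing tr(v_i) tr(w_i),
  -- provided w_i is multiplied by the same root.
  have hcomm : ∀ x, x * v ^ M = v ^ M * x := fun x => by
    rw [← hTj M x, hTM]; rfl
  have hscal : ∀ i, ∃ c : k, Matrix.scalar (Fin (d i)) c = v i ^ M := by
    intro i
    refine Matrix.mem_range_scalar_of_commute_single fun p q _ => ?_
    have := congrFun (hcomm (Pi.single i (Matrix.single p q 1))) i
    have h : Matrix.single p q 1 * v i ^ M = v i ^ M * Matrix.single p q 1 := by simpa using this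
    exact h
  choose c hc using hscal
  have hroot : ∀ i, ∃ z : k, z ^ M = c i := fun i => IsAlgClosed.exists_pow_nat_eq _
    (Nat.pos_of_ne_zero hM)
  choose z hz using hroot
  -- rescaled units of finite order
  have hblock : ∀ (φ₀ : algebraicClosure ℚ k →+* ℂ) (i : ι), ∃ t : algebraicClosure ℚ k,
      (t : k) = (v i).trace * (w i).trace ∧
      ∃ a : ℂ, φ₀ t = a * (starRingEnd ℂ) a ∧ ((w i).trace ≠ 0 → a ≠ 0) := by
    intro φ₀ i
    -- Blocks of size zero are allowed here; both traces are then zero.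
    rcases isEmpty_or_nonempty (Fin (d i)) with he | he
    · refine ⟨0, ?_, 0, ?_, ?_⟩ <;> simp [Matrix.trace]
    have hc0 : c i ≠ 0 := by
      intro h0
      have h1 : v i ^ M = 0 := by rw [← hc, h0, map_zero]
      have h2 : v i ^ M * w i ^ M = 1 := by
        rw [← (show Commute (v i) (w i) from (hvw i).trans (hwv i).symm).mul_pow, hvw, one_pow]
      rw [h1, zero_mul] at h2
      exact zero_ne_one h2
    have hz0 : z i ≠ 0 := by
      intro h0
      rw [← hz, h0, zero_pow hM] at hc0
      exact hc0 rfl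
    obtain ⟨a, b, ha, hb, hab⟩ := exists_conj_trace_of_pow_eq_one φ₀ (A := (z i)⁻¹ • v i)
      (B := z i • w i) hM
      (by rw [smul_pow, ← hc, ← hz, inv_pow]
          ext p q
          by_cases hpq : p = q <;> simp [Matrix.one_apply, Matrix.scalar_apply, hpq, hz0])
      (by rw [smul_mul_smul_comm, hwv, mul_inv_cancel₀ hz0, one_smul])
    refine ⟨a * b, ?_, φ₀ a, ?_, ?_⟩
    · push_cast
      rw [ha, hb, Matrix.trace_smul, Matrix.trace_smul, smul_eq_mul, smul_eq_mul]
      field_simp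
    · rw [map_mul, hab]
    · intro h1 h2
      rw [h2, map_zero, map_eq_zero] at hab
      rw [hab, Matrix.trace_smul, smul_eq_mul] at hb
      exact mul_ne_zero hz0 h1 hb.symm
  have hTr : LinearMap.trace k _ T = ∑ i, (v i).trace * (w i).trace := by
    rw [← trace_mulLeft_mulRight]
    congr 1
    refine LinearMap.ext fun x => ?_
    rw [LinearMap.comp_apply, LinearMap.mulRight_apply, LinearMap.mulLeft_apply, hTx, mul_assoc]
  have hTrx : ∀ x, LinearMap.trace k _ (LinearMap.mulLeft k x ∘ₗ T) =
      ∑ i, ((x * v) i).trace * (w i).trace := by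
    intro x
    rw [← trace_mulLeft_mulRight]
    congr 1
    refine LinearMap.ext fun y => ?_
    simp only [LinearMap.comp_apply, LinearMap.mulRight_apply, LinearMap.mulLeft_apply, hTx,
      mul_assoc]
  have : Algebra.IsAlgebraic ℚ (algebraicClosure ℚ k) := by
    convert algebraicClosure.isAlgebraic ℚ k <;> rfl
  let φ₀ : algebraicClosure ℚ k →+* ℂ :=
    (IsAlgClosed.lift (R := ℚ) (S := algebraicClosure ℚ k) (M := ℂ)).toRingHom
  choose t ht a hta ha using hblock φ₀
  have hsum : LinearMap.trace k _ T = ((∑ i, t i : algebraicClosure ℚ k) : k) := by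
    rw [hTr]
    change _ = (algebraicClosure ℚ k).val _
    rw [map_sum]
    exact Finset.sum_congr rfl fun i _ => (ht i).symm
  -- The trace of T maps to a sum of squared absolute values in ℂ. If it vanishes, every tr(w_i)
  -- vanishes, and then so does the trace of x ↦ aT(x) for every a, against `hne`.
  intro h0
  rw [hsum, ZeroMemClass.coe_eq_zero] at h0
  have h1 := congrArg φ₀ h0
  rw [map_sum, map_zero] at h1
  have h2 : ∑ i, Complex.normSq (a i) = 0 := by
    have : ((∑ i, Complex.normSq (a i) : ℝ) : ℂ) = 0 := by
      rw [← h1]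
      push_cast
      exact Finset.sum_congr rfl fun i _ => by rw [hta, Complex.mul_conj]
    exact_mod_cast this
  rw [Finset.sum_eq_zero_iff_of_nonneg fun i _ => Complex.normSq_nonneg _] at h2
  have hai : ∀ i, a i = 0 := fun i => Complex.normSq_eq_zero.1 (h2 i (Finset.mem_univ i))
  obtain ⟨x, hx⟩ := hne
  apply hx
  rw [hTrx]
  refine Finset.sum_eq_zero fun i _ => ?_
  rw [not_not.1 fun h => ha i h (hai i), mul_zero]

end Positivity

/-! ### The antipode of a semisimple Hopf algebra in characteristic zero is an involution -/

theorem LinearMap.trace_eq_of_comp_eq {k V W : Type*} [Field k] [AddCommGroup V] [Module k V]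
    [AddCommGroup W] [Module k W] (e : V →ₗ[k] W) (he : Function.Bijective e)
    {f : V →ₗ[k] V} {g : W →ₗ[k] W} (h : e ∘ₗ f = g ∘ₗ e) :
    LinearMap.trace k V f = LinearMap.trace k W g := by
  rw [← LinearMap.trace_conj' f (LinearEquiv.ofBijective e he)]
  congr 1
  ext w
  obtain ⟨v, rfl⟩ := he.2 w
  rw [LinearEquiv.conj_apply_apply]
  have : (LinearEquiv.ofBijective e he).symm (e v) = v :=
    (LinearEquiv.ofBijective e he).symm_apply_apply v
  rw [this]
  exact LinearMap.congr_fun h v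

theorem LinearMap.exists_trace_eq_natCast_of_isIdempotentElem {k V : Type*} [Field k]
    [AddCommGroup V] [Module k V] [FiniteDimensional k V] {f : V →ₗ[k] V}
    (hf : IsIdempotentElem f) : LinearMap.trace k V f = Module.finrank k (LinearMap.range f) :=
  (LinearMap.IsIdempotentElem.isProj_range f hf).trace

section

variable {k H : Type*} [Field k] [Ring H] [HopfAlgebra k H] [FiniteDimensional k H]

local notation "𝓢" => antipode k (A := H)

/-- Group-like elements are linearly independent, so finite dimension leaves only finitely many
powers of g. -/
theorem IsGroupLikeElem.exists_pow_eq_one {g : H} (hg : IsGroupLikeElem k g) :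
    ∃ M : ℕ, M ≠ 0 ∧ g ^ M = 1 := by
  have hfin : Finite (GroupLike k H) := (linearIndep_groupLikeVal (R := k) (A := H)).finite
  obtain ⟨a, b, hab, h⟩ := Finite.exists_ne_map_eq_of_infinite
    (fun n : ℕ => (⟨g ^ n, hg.pow⟩ : GroupLike k H))
  have h' : g ^ a = g ^ b := congrArg GroupLike.val h
  wlog hlt : a < b generalizing a b
  · exact this b a hab.symm h.symm h'.symm (by omega)
  refine ⟨b - a, by omega, ?_⟩
  have : g ^ a * g ^ (b - a) = g ^ a * 1 := by
    rw [← pow_add, Nat.add_sub_cancel' hlt.le, h', mul_one]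
  exact (hg.isUnit.pow a).mul_left_cancel this

variable {Λ : H} (hΛ : IsNormalizedIntegral k Λ)

include hΛ in
-- Radford's formula iterates to g^j S^{4j}(x) = x g^j; take j a period of the distinguished
-- group-like g.
theorem IsNormalizedIntegral.exists_antipode_sq_pow_eq_one :
    ∃ M : ℕ, M ≠ 0 ∧ (𝓢 ∘ₗ 𝓢 : Module.End k H) ^ M = 1 := by
  obtain ⟨M, hM, hg⟩ := hΛ.isGroupLikeElem_distinguished.exists_pow_eq_one
  refine ⟨2 * M, by omega, ?_⟩
  have key : ∀ j : ℕ, ∀ x : H, distinguished k Λ ^ j *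
      (((𝓢 ∘ₗ 𝓢 : Module.End k H) ^ 2) ^ j) x = x * distinguished k Λ ^ j := by
    intro j
    induction j with
    | zero => intro x; simp
    | succ j ih =>
      intro x
      have h1 : ((𝓢 ∘ₗ 𝓢 : Module.End k H) ^ 2) x = 𝓢 (𝓢 (𝓢 (𝓢 x))) := rfl
      rw [pow_succ (_ ^ 2), Module.End.mul_apply, pow_succ', mul_assoc, ih, h1, ← mul_assoc,
        hΛ.distinguished_mul_antipode_pow_four, mul_assoc]
  ext x
  have := key M x
  rw [hg, one_mul, mul_one, ← pow_mul] at this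
  exact this

include hΛ in
-- The form T is nondegenerate with S² as Nakayama automorphism, and S² has finite order, so the
-- positivity argument applies after transport to a product of matrix algebras. The required nonzero
-- twisted trace is T(Λ) = 1.
theorem IsNormalizedIntegral.antipodeSqTrace_one_ne_zero [IsAlgClosed k] [CharZero k]
    [IsSemisimpleRing H] : antipodeSqTrace k H 1 ≠ 0 := by
  obtain ⟨n, d, _, ⟨E⟩⟩ := IsSemisimpleRing.exists_algEquiv_pi_matrix_of_isAlgClosed k H
  obtain ⟨M, hM, hpow⟩ := hΛ.exists_antipode_sq_pow_eq_one
  have htr : ∀ x : H, antipodeSqTrace k H x = LinearMap.trace k _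
      (LinearMap.mulLeft k (E x) ∘ₗ E.toLinearEquiv.conj (𝓢 ∘ₗ 𝓢)) := by
    intro x
    rw [antipodeSqTrace_apply]
    refine LinearMap.trace_eq_of_comp_eq E.toLinearMap E.bijective ?_
    refine LinearMap.ext fun y => ?_
    simp [LinearEquiv.conj_apply]
  have h1 : antipodeSqTrace k H 1 = LinearMap.trace k _ (E.toLinearEquiv.conj (𝓢 ∘ₗ 𝓢)) := by
    rw [htr, map_one, LinearMap.mulLeft_one, LinearMap.id_comp]
  rw [h1]
  have hT : ∀ x, E.toLinearEquiv.conj (𝓢 ∘ₗ 𝓢) (E x) = E (𝓢 (𝓢 x)) := by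
    intro x
    simp [LinearEquiv.conj_apply]
  refine trace_ne_zero_of_nakayama ((antipodeSqTrace k H).ofConv ∘ₗ E.symm.toLinearMap) _
    ?_ ?_ hM ?_ ⟨E Λ, ?_⟩
  · intro x hx
    obtain ⟨x, rfl⟩ := E.surjective x
    rw [hΛ.eq_zero_of_antipodeSqTrace_mul (z := x), map_zero]
    intro y
    have := hx (E y)
    rw [← map_mul] at this
    simpa using this
  · intro x y
    obtain ⟨x, rfl⟩ := E.surjective x
    obtain ⟨y, rfl⟩ := E.surjective y
    rw [hT, ← map_mul, ← map_mul]
    have := antipodeSqTrace_mul_comm (k := k) x y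
    simpa using this
  · have hj : ∀ j : ℕ, ∀ x, (E.toLinearEquiv.conj (𝓢 ∘ₗ 𝓢) ^ j) (E x) =
        E (((𝓢 ∘ₗ 𝓢 : Module.End k H) ^ j) x) := by
      intro j
      induction j with
      | zero => intro x; rfl
      | succ j ih => intro x; rw [pow_succ, Module.End.mul_apply, hT, ih, pow_succ]; rfl
    refine LinearMap.ext fun x => ?_
    obtain ⟨x, rfl⟩ := E.surjective x
    rw [hj, hpow]
    rfl
  · rw [← htr, hΛ.antipodeSqTrace_apply_self]
    exact one_ne_zero

omit [FiniteDimensional k H] in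
theorem rightHit_mul_apply_repr (f : ConvDual k H) (x y : H) {ι : Type*} (r : Repr k x ι) :
    rightHit f (x * y) = ∑ i ∈ r.index, r.left i *
      rightHit (toConv (f.ofConv ∘ₗ LinearMap.mulLeft k (r.right i))) y := by
  have hxy : Coalgebra.comul (R := k) (x * y) = ∑ i ∈ r.index, ∑ j ∈ (ℛ k y).index,
      (r.left i * (ℛ k y).left j) ⊗ₜ[k] (r.right i * (ℛ k y).right j) := by
    rw [Bialgebra.comul_mul, ← r.eq, ← (ℛ k y).eq, Finset.sum_mul_sum]
    simp
  have h1 : rightHit f (x * y) = (TensorProduct.rid k H).toLinearMap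
      (f.ofConv.lTensor H (comul (x * y))) := rfl
  rw [h1, hxy]
  simp only [rightHit_repr _ (ℛ k y), Finset.mul_sum, map_sum]
  simp

/-- The multiplication operators `x ⊗ y ↦ x₁ ⊗ x₂ y`. -/
def galoisMap (k H : Type*) [Field k] [Ring H] [HopfAlgebra k H] : H ⊗[k] H →ₗ[k] H ⊗[k] H :=
  TensorProduct.lift ((LinearMap.mul k (H ⊗[k] H)).compl₁₂ comul
    (Algebra.TensorProduct.includeRight (R := k) (A := H) (B := H)).toLinearMap)

omit [FiniteDimensional k H] in
theorem galoisMap_tmul (x y : H) : galoisMap k H (x ⊗ₜ y) = comul x * (1 ⊗ₜ[k] y) := rfl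

/-- The element Σ x₁ ⊗ S(x₂)y is sent to x ⊗ y; injectivity is then a matter of dimension. -/
theorem galoisMap_bijective : Function.Bijective (galoisMap k H) := by
  have hs : Function.Surjective (galoisMap k H) := by
    rw [← LinearMap.range_eq_top, eq_top_iff, ← TensorProduct.span_tmul_eq_top, Submodule.span_le]
    rintro _ ⟨x, y, rfl⟩
    refine ⟨∑ i ∈ (ℛ k x).index, (ℛ k x).left i ⊗ₜ (𝓢 ((ℛ k x).right i) * y), ?_⟩
    have h1 : x ⊗ₜ[k] y = (x ⊗ₜ 1) * (1 ⊗ₜ y) := by simp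
    rw [h1, ← sum_comul_mul_one_tmul_antipode x (ℛ k x), map_sum, Finset.sum_mul]
    refine Finset.sum_congr rfl fun i _ => ?_
    rw [galoisMap_tmul, mul_assoc]
    simp
  exact ⟨LinearMap.injective_iff_surjective.2 hs, hs⟩

omit [FiniteDimensional k H] in
-- This is the isomorphism between the tensor square of the regular representation of H^* and a
-- multiple of the regular representation: the diagonal action corresponds to id ⊗ `rightHit f`. The
-- computation is coassociativity.
theorem galoisMap_tmul_rightHit (f : ConvDual k H) (x y : H) {ι : Type*} (r : Repr k x ι) :
    galoisMap k H (∑ i ∈ r.index, r.left i ⊗ₜ[k]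
      rightHit (toConv (f.ofConv ∘ₗ LinearMap.mulLeft k (r.right i))) y) =
    (rightHit f).lTensor H (galoisMap k H (x ⊗ₜ y)) := by
  set K : H ⊗[k] H →ₗ[k] H := TensorProduct.lift (LinearMap.mk₂ k
    (fun a b => a * rightHit (toConv (f.ofConv ∘ₗ LinearMap.mulLeft k b)) y)
    (fun a a' b => add_mul _ _ _) (fun c a b => smul_mul_assoc _ _ _)
    (fun a b b' => by
      rw [← mul_add, ← LinearMap.add_apply, ← map_add]
      congr 4; ext; simp [add_mul])
    (fun c a b => by
      rw [← mul_smul_comm, ← LinearMap.smul_apply, ← map_smul]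
      congr 4; ext; simp)) with hK
  have hKt : ∀ a b, K (a ⊗ₜ b) = a * rightHit (toConv (f.ofConv ∘ₗ LinearMap.mulLeft k b)) y :=
    fun a b => rfl
  have hKc : ∀ a, K (comul a) = rightHit f (a * y) := by
    intro a
    rw [rightHit_mul_apply_repr f a y (ℛ k a), ← (ℛ k a).eq, map_sum]
    simp only [hKt]
  have h := congrArg (K.lTensor H) (sum_tmul_tmul_eq r (fun i => ℛ k (r.left i))
    (fun i => ℛ k (r.right i)))
  simp only [map_sum, LinearMap.lTensor_tmul, hKt, galoisMap_tmul] at h ⊢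
  have e1 : ∀ i, comul (r.left i) * (1 : H) ⊗ₜ[k]
      rightHit (toConv (f.ofConv ∘ₗ LinearMap.mulLeft k (r.right i))) y =
      ∑ j ∈ (ℛ k (r.left i)).index, (ℛ k (r.left i)).left j ⊗ₜ[k]
        ((ℛ k (r.left i)).right j * rightHit (toConv (f.ofConv ∘ₗ LinearMap.mulLeft k
          (r.right i))) y) := by
    intro i
    conv_lhs => rw [← (ℛ k (r.left i)).eq]
    simp [Finset.sum_mul]
  have e2 : ∀ i, ∑ j ∈ (ℛ k (r.right i)).index, r.left i ⊗ₜ[k] ((ℛ k (r.right i)).left j *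
      rightHit (toConv (f.ofConv ∘ₗ LinearMap.mulLeft k ((ℛ k (r.right i)).right j))) y) =
      r.left i ⊗ₜ[k] rightHit f (r.right i * y) := by
    intro i
    rw [rightHit_mul_apply_repr f _ y (ℛ k (r.right i)), TensorProduct.tmul_sum]
  simp only [e1, h, e2]
  rw [← r.eq, Finset.sum_mul, map_sum]
  simp

variable (k H) in
/-- The character of the regular representation of the dual, as an element of `H`. -/
def dualRegularChar : H :=
  (Module.evalEquiv k H).symm (LinearMap.trace k H ∘ₗ rightHit ∘ₗ
    (WithConv.linearEquiv k (H →ₗ[k] k)).symm.toLinearMap)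

theorem apply_dualRegularChar (f : ConvDual k H) :
    f (dualRegularChar k H) = LinearMap.trace k H (rightHit f) := by
  exact LinearMap.congr_fun ((Module.evalEquiv k H).apply_symm_apply (LinearMap.trace k H ∘ₗ rightHit ∘ₗ
    (WithConv.linearEquiv k (H →ₗ[k] k)).symm.toLinearMap)) f.ofConv

/-- The square is the character of the tensor square of the regular representation of H^*, which
`galoisMap` identifies with dim H copies of the regular representation. -/
theorem dualRegularChar_mul_self :
    dualRegularChar k H * dualRegularChar k H =
      (Module.finrank k H : k) • dualRegularChar k H := by
  refine convDual_ext k fun f => ?_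
  rw [map_smul, apply_dualRegularChar, smul_eq_mul]
  set b := Module.finBasis k H
  have h1 : ∀ x y : H, f (x * y) = ∑ i, b.coord i x *
      f (b i * y) := by
    intro x y
    conv_lhs => rw [← b.sum_repr x, Finset.sum_mul, map_sum]
    simp
  have h2 : f (dualRegularChar k H * dualRegularChar k H) = LinearMap.trace k (H ⊗[k] H)
      (∑ i, TensorProduct.map (rightHit (toConv (b.coord i)))
        (rightHit (toConv (f.ofConv ∘ₗ LinearMap.mulLeft k (b i))))) := by
    rw [h1, map_sum]
    refine Finset.sum_congr rfl fun i _ => ?_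
    rw [LinearMap.trace_tensorProduct', ← apply_dualRegularChar, ← apply_dualRegularChar]
    rfl
  rw [h2, LinearMap.trace_eq_of_comp_eq (galoisMap k H) galoisMap_bijective
    (g := (rightHit f).lTensor H)]
  · rw [LinearMap.lTensor, LinearMap.trace_tensorProduct', LinearMap.trace_id]
  · refine TensorProduct.ext' fun x y => ?_
    rw [LinearMap.comp_apply, LinearMap.comp_apply, ← galoisMap_tmul_rightHit f x y (ℛ k x)]
    congr 1
    rw [LinearMap.sum_apply]
    simp only [TensorProduct.map_tmul, rightHit_repr _ (ℛ k x), TensorProduct.sum_tmul]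
    rw [Finset.sum_comm]
    refine Finset.sum_congr rfl fun j _ => ?_
    simp only [TensorProduct.smul_tmul]
    rw [← TensorProduct.tmul_sum]
    congr 1
    have h3 : (toConv (f.ofConv ∘ₗ LinearMap.mulLeft k ((ℛ k x).right j)) : ConvDual k H) =
        ∑ i, b.coord i ((ℛ k x).right j) • toConv (f.ofConv ∘ₗ LinearMap.mulLeft k (b i)) := by
      ext z
      exact (h1 ((ℛ k x).right j) z).trans (by simp)
    rw [h3, map_sum, LinearMap.sum_apply]
    simp

include hΛ in
-- As an integral of the dual, T acts on H by the rank-one operator x ↦ T(x)1, whose trace is T(1).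
theorem IsNormalizedIntegral.antipodeSqTrace_dualRegularChar :
    antipodeSqTrace k H (dualRegularChar k H) = antipodeSqTrace k H 1 := by
  rw [apply_dualRegularChar]
  have : rightHit (antipodeSqTrace k H) = (antipodeSqTrace k H).ofConv.smulRight (1 : H) := by
    ext x
    exact hΛ.rightHit_antipodeSqTrace x
  rw [this, LinearMap.trace_smulRight]

include hΛ in
-- S² is a coalgebra automorphism, so it conjugates the operator of f ∘ S² to that of f, and traces
-- agree.
theorem IsNormalizedIntegral.antipode_antipode_dualRegularChar :
    𝓢 (𝓢 (dualRegularChar k H)) = dualRegularChar k H := by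
  refine convDual_ext k fun f => ?_
  rw [apply_dualRegularChar]
  have h1 : f (𝓢 (𝓢 (dualRegularChar k H))) =
    (toConv (f.ofConv ∘ₗ 𝓢 ∘ₗ 𝓢) : ConvDual k H) (dualRegularChar k H) := rfl
  rw [h1, apply_dualRegularChar]
  refine LinearMap.trace_eq_of_comp_eq (𝓢 ∘ₗ 𝓢)
    (hΛ.antipode_bijective.comp hΛ.antipode_bijective) ?_
  ext x
  refine convDual_ext k fun g => ?_
  have h2 : g ((𝓢 ∘ₗ 𝓢) (rightHit (toConv (f.ofConv ∘ₗ 𝓢 ∘ₗ 𝓢)) x)) =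
    (toConv (g.ofConv ∘ₗ 𝓢 ∘ₗ 𝓢) : ConvDual k H) (rightHit (toConv (f.ofConv ∘ₗ 𝓢 ∘ₗ 𝓢)) x) := rfl
  rw [LinearMap.comp_apply, h2, apply_rightHit, LinearMap.comp_apply, apply_rightHit]
  have h3 := convDual_comp_antipode (k := k) (H := H) (toConv (g.ofConv ∘ₗ 𝓢))
    (toConv (f.ofConv ∘ₗ 𝓢))
  rw [convDual_comp_antipode f g] at h3
  exact WithConv.congr_fun h3 x

include hΛ in
/-- The theorem of Larson and Radford. -/
theorem IsNormalizedIntegral.antipode_antipode [IsAlgClosed k] [CharZero k]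
    [IsSemisimpleRing H] (x : H) : 𝓢 (𝓢 x) = x := by
  set n := Module.finrank k H with hn
  set X := dualRegularChar k H with hX
  set Q : Module.End k H := 𝓢 ∘ₗ 𝓢 with hQ
  have ht := hΛ.antipodeSqTrace_one_ne_zero
  have hnt : Nontrivial H := by
    by_contra h
    rw [not_nontrivial_iff_subsingleton] at h
    apply ht
    rw [Subsingleton.elim (1 : H) 0, map_zero]
  have hn0 : (n : k) ≠ 0 := Nat.cast_ne_zero.2 Module.finrank_pos.ne'
  -- The hit of 1 by T is T(1)·1 and also T(1)·g, so T(1) ≠ 0 forces g = 1; Radford's formula then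
  -- reads S⁴ = 1.
  have hg : distinguished k Λ = 1 := by
    have h1 := hΛ.leftHit_antipodeSqTrace 1
    have h2 : leftHit (antipodeSqTrace k H) (1 : H) = antipodeSqTrace k H 1 • 1 := by
      refine convDual_ext k fun g => ?_
      rw [apply_leftHit, convDual_mul_one, map_smul, smul_eq_mul]
    rw [h2] at h1
    exact (smul_right_injective _ ht h1).symm
  have hQQ : Q * Q = 1 := by
    ext y
    have := hΛ.distinguished_mul_antipode_pow_four y
    rwa [hg, one_mul, mul_one] at this
  set E : Module.End k H := (n : k)⁻¹ • LinearMap.mulLeft k X with hE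
  have hEE : E * E = E := by
    ext y
    simp only [hE, Module.End.mul_apply, LinearMap.smul_apply, LinearMap.mulLeft_apply,
      mul_smul_comm]
    rw [← mul_assoc, dualRegularChar_mul_self, smul_mul_assoc, smul_smul, smul_smul, mul_assoc,
      inv_mul_cancel₀ hn0, mul_one]
  have hEQ : E * Q = Q * E := by
    ext y
    simp only [hE, hQ, Module.End.mul_apply, LinearMap.smul_apply, LinearMap.mulLeft_apply,
      LinearMap.comp_apply, map_smul, antipode_antipode_mul]
    rw [hΛ.antipode_antipode_dualRegularChar]
  -- Tr(X S²) = T(X) = T(1) = Tr(S²), and E is X divided by n.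
  have htr : (n : k) * LinearMap.trace k H (E * Q) = LinearMap.trace k H Q := by
    have h1 : E * Q = (n : k)⁻¹ • (LinearMap.mulLeft k X ∘ₗ Q) := rfl
    have h2 : LinearMap.trace k H Q = antipodeSqTrace k H 1 := by
      rw [antipodeSqTrace_apply, LinearMap.mulLeft_one, LinearMap.id_comp]
    rw [h1, map_smul, ← antipodeSqTrace_apply, hΛ.antipodeSqTrace_dualRegularChar, h2,
      smul_eq_mul, mul_inv_cancel_left₀ hn0]
  have htQ : LinearMap.trace k H Q ≠ 0 := by
    rw [hQ, ← LinearMap.id_comp (𝓢 ∘ₗ 𝓢), ← LinearMap.mulLeft_one k, ← antipodeSqTrace_apply]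
    exact ht
  clear_value E
  set P : Module.End k H := (2⁻¹ : k) • (1 + Q) with hP
  set R : Module.End k H := (2⁻¹ : k) • (1 - Q) with hR
  have hPP : P * P = P := by
    rw [hP, smul_mul_smul_comm, add_mul, mul_add, mul_add, hQQ, one_mul, mul_one, one_mul]
    module
  have hRR : R * R = R := by
    rw [hR, smul_mul_smul_comm, sub_mul, mul_sub, mul_sub, hQQ, one_mul, mul_one, one_mul]
    module
  have hEP : E * P = P * E := by
    rw [hP, mul_smul_comm, smul_mul_assoc, mul_add, add_mul, hEQ, mul_one, one_mul]
  have hER : E * R = R * E := by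
    rw [hR, mul_smul_comm, smul_mul_assoc, mul_sub, sub_mul, hEQ, mul_one, one_mul]
  have hid : ∀ F : Module.End k H, F * F = F → E * F = F * E → IsIdempotentElem (E * F) := by
    intro F hF hEF
    rw [IsIdempotentElem, mul_assoc, ← mul_assoc F, ← hEF, mul_assoc E F F, hF, ← mul_assoc, hEE]
  have h1 := LinearMap.exists_trace_eq_natCast_of_isIdempotentElem (hid P hPP hEP)
  have h2 := LinearMap.exists_trace_eq_natCast_of_isIdempotentElem (hid R hRR hER)
  have h3 := LinearMap.exists_trace_eq_natCast_of_isIdempotentElem (f := P) hPP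
  have h4 := LinearMap.exists_trace_eq_natCast_of_isIdempotentElem (f := R) hRR
  set p := Module.finrank k (LinearMap.range (E * P))
  set q := Module.finrank k (LinearMap.range (E * R))
  set a := Module.finrank k (LinearMap.range P)
  set b := Module.finrank k (LinearMap.range R)
  have hPR : P - R = Q := by rw [hP, hR]; module
  have hPR' : P + R = 1 := by rw [hP, hR]; module
  have e1 : (n : k) * (p - q) = a - b := by
    rw [← h1, ← h2, ← h3, ← h4, ← map_sub, ← map_sub, ← mul_sub, hPR, htr]
  have e2 : (a : k) + b = n := by
    rw [← h3, ← h4, ← map_add, hPR', LinearMap.trace_one]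
  have e3 : (a : k) - b ≠ 0 := by
    rw [← h3, ← h4, ← map_sub, hPR]; exact htQ
  have e1' : (n : ℤ) * (p - q) = a - b := by exact_mod_cast e1
  have e2' : a + b = n := by exact_mod_cast e2
  have e3' : (a : ℤ) - b ≠ 0 := by exact_mod_cast e3
  -- With a and b the dimensions of the ±1-eigenspaces of S², n divides a − b ≠ 0 while a + b = n,
  -- so one of them is zero.
  have hab : a = 0 ∨ b = 0 := by
    by_contra! h
    have : (n : ℤ) ≤ |(a : ℤ) - b| := by
      refine Int.le_of_dvd (abs_pos.2 e3') ?_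
      rw [dvd_abs]
      exact ⟨_, e1'.symm⟩
    rcases abs_cases ((a : ℤ) - b) with h' | h' <;> omega
  rcases hab with h | h
  · have hP0 : P = 0 := LinearMap.IsIdempotentElem.eq_zero_of_trace_eq_zero
      (show IsIdempotentElem P from hPP) (by rw [h3, h, Nat.cast_zero])
    -- Here S² = −1, which is incompatible with S²(1) = 1.
    have hQ1 : (𝓢 (𝓢 (1 : H))) = -1 := by
      have : (P : Module.End k H) 1 = 0 := by rw [hP0]; rfl
      rw [hP, LinearMap.smul_apply, smul_eq_zero_iff_right (by norm_num)] at this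
      rw [eq_neg_iff_add_eq_zero, add_comm]
      exact this
    rw [antipode_one, antipode_one] at hQ1
    have h2 : (2 : k) • (1 : H) = 0 := by
      rw [two_smul]
      nth_rewrite 1 [hQ1]
      simp
    exact absurd h2 (smul_ne_zero two_ne_zero one_ne_zero)
  · have hR0 : R = 0 := LinearMap.IsIdempotentElem.eq_zero_of_trace_eq_zero
      (show IsIdempotentElem R from hRR) (by rw [h4, h, Nat.cast_zero])
    have : (R : Module.End k H) x = 0 := by rw [hR0]; rfl
    rw [hR, LinearMap.smul_apply, smul_eq_zero_iff_right (by norm_num)] at this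
    exact (sub_eq_zero.1 this).symm

end

/-! ### The integral of a Hopf subalgebra -/

section

variable {k H : Type*} [Field k] [Ring H] [HopfAlgebra k H]

local notation "𝓢" => antipode k (A := H)

theorem rightHit_map {C C' : Type*} [AddCommGroup C] [Module k C] [Coalgebra k C]
    [AddCommGroup C'] [Module k C'] [Coalgebra k C'] (π : C →ₗc[k] C') (f : ConvDual k C') (x : C) :
    rightHit f (π x) = π (rightHit (toConv (f.ofConv ∘ₗ π.toLinearMap)) x) := by
  refine convDual_ext k fun g => ?_
  have h : g (π (rightHit (toConv (f.ofConv ∘ₗ π.toLinearMap)) x)) =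
    (toConv (g.ofConv ∘ₗ π.toLinearMap) : ConvDual k C)
      (rightHit (toConv (f.ofConv ∘ₗ π.toLinearMap)) x) := rfl
  rw [h, apply_rightHit, apply_rightHit, convDual_mul_apply_map]

/-- Multiplicativity of Δ gives F ∘ ρ(b) = Σ ρ(b₁) F_{b₂}, where F is the operator of f and F_b that
of f ∘ ρ(b). Convolving with ρ ∘ S on the left solves for F_b. -/
theorem rightHit_comp_action {C : Type*} [AddCommGroup C] [Module k C] [Coalgebra k C]
    (π : H →ₗc[k] C) (hπ : Function.Surjective π) (ρ : H →ₐ[k] Module.End k C)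
    (hρ : ∀ a h, ρ a (π h) = π (a * h)) (f : ConvDual k C) (a : H) {ι : Type*} (r : Repr k a ι) :
    rightHit (toConv (f.ofConv ∘ₗ ρ a)) = ∑ i ∈ r.index,
      ρ (𝓢 (r.left i)) * rightHit f * ρ (r.right i) := by
  set Φ : WithConv (H →ₗ[k] Module.End k C) :=
    toConv (LinearMap.mulLeft k (rightHit f) ∘ₗ ρ.toLinearMap) with hΦ
  set Ψ : WithConv (H →ₗ[k] Module.End k C) := toConv
    (rightHit ∘ₗ (WithConv.linearEquiv k (C →ₗ[k] k)).symm.toLinearMap ∘ₗ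
      f.ofConv.compRight k ∘ₗ ρ.toLinearMap) with hΨ
  have h1 : Φ = toConv ρ.toLinearMap * Ψ := by
    ext b x
    obtain ⟨x, rfl⟩ := hπ x
    rw [(ℛ k b).convMul_apply, LinearMap.sum_apply]
    change rightHit f (ρ b (π x)) = ∑ i ∈ (ℛ k b).index, ρ ((ℛ k b).left i)
      (rightHit (toConv (f.ofConv ∘ₗ ρ ((ℛ k b).right i))) (π x))
    rw [hρ, rightHit_map, rightHit_mul_apply_repr _ b x (ℛ k b), map_sum]
    refine Finset.sum_congr rfl fun i _ => ?_
    rw [rightHit_map, ← hρ]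
    congr 4
    ext z
    exact congrArg f.ofConv (hρ _ _).symm
  have h2 : toConv (ρ.toLinearMap ∘ₗ 𝓢) * Φ = Ψ := by
    rw [h1, ← mul_assoc, algHom_antipode_convMul, one_mul]
  have h3 := WithConv.congr_fun h2 a
  rw [r.convMul_apply] at h3
  refine h3.symm.trans (Finset.sum_congr rfl fun i _ => ?_)
  rw [mul_assoc]
  rfl

theorem rightHit_comp_mulLeft (f : ConvDual k H) (a : H) {ι : Type*} (r : Repr k a ι) :
    rightHit (toConv (f.ofConv ∘ₗ LinearMap.mulLeft k a)) = ∑ i ∈ r.index,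
      LinearMap.mulLeft k (𝓢 (r.left i)) * rightHit f * LinearMap.mulLeft k (r.right i) :=
  rightHit_comp_action (CoalgHom.id k H) Function.surjective_id (Algebra.lmul k H)
    (fun _ _ => rfl) f a r

/-- Apply S to the usual antipode identity; S² = 1 is what allows the order of the factors to be
reversed. This form is needed after cyclic permutation under a trace. -/
theorem sum_mul_antipode_eq_smul_of_involutive (hS : ∀ x, 𝓢 (𝓢 x) = x) (a : H) {ι : Type*}
    (r : Repr k a ι) : ∑ i ∈ r.index, r.right i * 𝓢 (r.left i) = counit (R := k) a • 1 := by
  have := congrArg 𝓢 (sum_mul_antipode_eq_smul r)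
  simpa [antipode_mul_antidistrib, hS, antipode_one] using this

theorem antipodeSqTrace_eq_trace_mulLeft (hS : ∀ x, 𝓢 (𝓢 x) = x) (a : H) :
    antipodeSqTrace k H a = LinearMap.trace k H (LinearMap.mulLeft k a) := by
  rw [antipodeSqTrace_apply]
  congr 1
  ext x
  simp [hS]

theorem antipodeSqTrace_mul_comm' (hS : ∀ x, 𝓢 (𝓢 x) = x) (a b : H) :
    antipodeSqTrace k H (a * b) = antipodeSqTrace k H (b * a) := by
  rw [antipodeSqTrace_mul_comm, hS]

theorem antipodeSqTrace_one [FiniteDimensional k H] (hS : ∀ x, 𝓢 (𝓢 x) = x) :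
    antipodeSqTrace k H 1 = Module.finrank k H := by
  rw [antipodeSqTrace_eq_trace_mulLeft hS, LinearMap.mulLeft_one, LinearMap.trace_id]

theorem trace_mulRight [FiniteDimensional k H] (hS : ∀ x, 𝓢 (𝓢 x) = x) (a : H) :
    LinearMap.trace k H (LinearMap.mulRight k a) = antipodeSqTrace k H (𝓢 a) := by
  rw [antipodeSqTrace_eq_trace_mulLeft hS]
  refine LinearMap.trace_eq_of_comp_eq 𝓢 ((Function.Involutive.bijective hS)) ?_
  ext x
  simp [antipode_mul_antidistrib]

namespace HopfSubalgebra

variable (A : HopfSubalgebra k H)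

theorem exists_repr {a : H} (ha : a ∈ A.toSubalgebra) :
    ∃ r : Repr k a (Subalgebra.toSubmodule A.toSubalgebra × Subalgebra.toSubmodule A.toSubalgebra),
      ∀ i, r.left i ∈ A.toSubalgebra ∧ r.right i ∈ A.toSubalgebra := by
  obtain ⟨s, hs⟩ := A.comul_mem' a ha
  obtain ⟨S, hS⟩ := TensorProduct.exists_finset s
  refine ⟨⟨S, fun p => (p.1 : H), fun p => (p.2 : H), ?_⟩, fun p => ⟨p.1.2, p.2.2⟩⟩
  rw [← hs, hS, map_sum]
  simp [TensorProduct.mapIncl]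

theorem rightHit_mem (f : ConvDual k H) {a : H} (ha : a ∈ A.toSubalgebra) :
    rightHit f a ∈ A.toSubalgebra := by
  obtain ⟨r, hr⟩ := A.exists_repr ha
  rw [rightHit_repr f r]
  exact Subalgebra.sum_mem _ fun i _ => A.toSubalgebra.smul_mem (hr i).1 _

theorem rightHit_eq_zero {f : ConvDual k H} (hf : ∀ a ∈ A.toSubalgebra, f a = 0) {a : H}
    (ha : a ∈ A.toSubalgebra) : rightHit f a = 0 := by
  obtain ⟨r, hr⟩ := A.exists_repr ha
  rw [rightHit_repr f r]
  exact Finset.sum_eq_zero fun i _ => by rw [hf _ (hr i).2, zero_smul]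

/-- `e` is the normalized two-sided integral of the Hopf subalgebra `A`. -/
structure IsIntegral (e : H) : Prop where
  mem : e ∈ A.toSubalgebra
  mul_left : ∀ a ∈ A.toSubalgebra, a * e = counit (R := k) a • e
  mul_right : ∀ a ∈ A.toSubalgebra, e * a = counit (R := k) a • e
  counit_eq : counit (R := k) e = 1
  antipode_eq : 𝓢 e = e

variable [FiniteDimensional k H]

omit [FiniteDimensional k H] in
/-- A projection onto `A` computes traces of restrictions to `A`. -/
theorem trace_mul_comm_of_mapsTo {P T U : Module.End k H} (hP : ∀ x, P x ∈ A.toSubalgebra)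
    (hPA : ∀ x ∈ A.toSubalgebra, P x = x) (hT : ∀ x ∈ A.toSubalgebra, T x ∈ A.toSubalgebra)
    (hU : ∀ x ∈ A.toSubalgebra, U x ∈ A.toSubalgebra) :
    LinearMap.trace k H (T * U * P) = LinearMap.trace k H (U * T * P) := by
  have h1 : T * U * P = (T * P) * (U * P) := by
    ext x
    exact congrArg T (hPA _ (hU _ (hP x))).symm
  have h2 : U * T * P = (U * P) * (T * P) := by
    ext x
    exact congrArg U (hPA _ (hT _ (hP x))).symm
  rw [h1, h2, LinearMap.trace_mul_comm]

/-- The integral is a multiple of the element X representing f ↦ Tr(`rightHit f` restricted to A),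
the regular character of the dual of A. Cyclicity of the trace and the reversed antipode identity
give aX = ε(a)X, and ε(X) = dim A. The last clause holds because an operator x ↦ f(x)1 has trace
f(1); applied to T it yields dim A · T(e) = dim H. -/
theorem exists_isIntegral [CharZero k] (hS : ∀ x, 𝓢 (𝓢 x) = x) [Nontrivial H] :
    ∃ e : H, A.IsIntegral e ∧ ∀ f : ConvDual k H,
      (∀ x ∈ A.toSubalgebra, rightHit f x = f x • 1) →
      (Module.finrank k A.toSubalgebra : k) * f e = f 1 := by
  obtain ⟨π, hπ⟩ := (Subalgebra.toSubmodule A.toSubalgebra).subtype.exists_leftInverse_of_injective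
    (Submodule.ker_subtype _)
  -- Composing with a projection onto A computes traces of restrictions to A without leaving the
  -- endomorphisms of H.
  set P : Module.End k H := (Subalgebra.toSubmodule A.toSubalgebra).subtype ∘ₗ π with hP
  have hPm : ∀ x, P x ∈ A.toSubalgebra := fun x => (π x).2
  have hPA : ∀ x ∈ A.toSubalgebra, P x = x := fun x hx =>
    congrArg Subtype.val (LinearMap.congr_fun hπ ⟨x, hx⟩)
  have hPtr : LinearMap.trace k H P = Module.finrank k A.toSubalgebra :=
    (LinearMap.IsProj.mk hPm hPA : LinearMap.IsProj (Subalgebra.toSubmodule A.toSubalgebra) P).trace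
  set d := Module.finrank k A.toSubalgebra with hd
  have hd0 : (d : k) ≠ 0 := by
    have : Nontrivial A.toSubalgebra := inferInstance
    exact Nat.cast_ne_zero.2 Module.finrank_pos.ne'
  set X : H := (Module.evalEquiv k H).symm (LinearMap.trace k H ∘ₗ LinearMap.mulRight k P ∘ₗ
    rightHit ∘ₗ (WithConv.linearEquiv k (H →ₗ[k] k)).symm.toLinearMap) with hX
  have hXf : ∀ f : ConvDual k H, f X = LinearMap.trace k H (rightHit f * P) := fun f =>
    (LinearMap.congr_fun ((Module.evalEquiv k H).apply_symm_apply (LinearMap.trace k H ∘ₗ LinearMap.mulRight k P ∘ₗ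
    rightHit ∘ₗ (WithConv.linearEquiv k (H →ₗ[k] k)).symm.toLinearMap)) f.ofConv)
  have hXA : X ∈ A.toSubalgebra := by
    rw [← Subalgebra.mem_toSubmodule, ← Subspace.forall_mem_dualAnnihilator_apply_eq_zero_iff]
    intro f hf
    rw [Submodule.mem_dualAnnihilator] at hf
    have := hXf (toConv f)
    have h0 : rightHit (toConv f) * P = 0 := by
      ext x
      exact A.rightHit_eq_zero (f := toConv f) hf (hPm x)
    rw [h0, map_zero] at this
    exact this
  have hmul : ∀ a ∈ A.toSubalgebra, a * X = counit (R := k) a • X := by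
    intro a ha
    refine convDual_ext k fun f => ?_
    have h1 : f (a * X) = (toConv (f.ofConv ∘ₗ LinearMap.mulLeft k a) : ConvDual k H) X := rfl
    obtain ⟨r, hr⟩ := A.exists_repr ha
    rw [h1, hXf, rightHit_comp_mulLeft f a r, map_smul, hXf, Finset.sum_mul, map_sum]
    have h2 : ∀ i ∈ r.index, LinearMap.trace k H (LinearMap.mulLeft k (𝓢 (r.left i)) * rightHit f *
        LinearMap.mulLeft k (r.right i) * P) = LinearMap.trace k H (LinearMap.mulLeft k
          (r.right i * 𝓢 (r.left i)) * (rightHit f * P)) := by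
      intro i _
      rw [A.trace_mul_comm_of_mapsTo hPm hPA]
      · congr 1
        ext x
        simp [mul_assoc]
      · intro x hx
        exact A.toSubalgebra.mul_mem (A.antipode_mem' _ (hr i).1) (A.rightHit_mem f hx)
      · intro x hx
        exact A.toSubalgebra.mul_mem (hr i).2 hx
    rw [Finset.sum_congr rfl h2, ← map_sum, ← Finset.sum_mul]
    have h3 : ∑ i ∈ r.index, LinearMap.mulLeft k (r.right i * 𝓢 (r.left i)) =
        counit (R := k) a • (1 : Module.End k H) := by
      ext x
      rw [LinearMap.sum_apply]
      simp only [LinearMap.mulLeft_apply]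
      rw [← Finset.sum_mul, sum_mul_antipode_eq_smul_of_involutive hS]
      simp
    rw [h3, smul_mul_assoc, one_mul, map_smul]
  have hεX : counit (R := k) X = d := by
    have := hXf 1
    rw [rightHit_one, one_mul, hPtr] at this
    exact this
  set e := (d : k)⁻¹ • X with he
  have hea : ∀ a ∈ A.toSubalgebra, a * e = counit (R := k) a • e := by
    intro a ha
    rw [he, mul_smul_comm, hmul a ha, smul_comm]
  have hεe : counit (R := k) e = 1 := by
    rw [he, map_smul, hεX, smul_eq_mul, inv_mul_cancel₀ hd0]
  have heA : e ∈ A.toSubalgebra := A.toSubalgebra.smul_mem hXA _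
  -- S(e) is a right integral of A; evaluating S(e)e in both ways gives S(e) = e, so e is two-sided.
  have hSe : ∀ a ∈ A.toSubalgebra, 𝓢 e * a = counit (R := k) a • 𝓢 e := by
    intro a ha
    rw [← hS a, ← antipode_mul_antidistrib, hea _ (A.antipode_mem' a ha), map_smul,
      counit_antipode, counit_antipode, counit_antipode]
  have hSee : 𝓢 e = e := by
    have h1 := hea _ (A.antipode_mem' e heA)
    rw [hSe e heA, counit_antipode, hεe, one_smul, one_smul] at h1
    exact h1
  refine ⟨e, ⟨heA, hea, fun a ha => by rw [← hSee]; exact hSe a ha, hεe, hSee⟩, fun f hf => ?_⟩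
  rw [he, map_smul, smul_eq_mul, mul_inv_cancel_left₀ hd0, hXf]
  have : rightHit f * P = (f.ofConv ∘ₗ P).smulRight (1 : H) := by
    ext x
    exact hf _ (hPm x)
  rw [this, LinearMap.trace_smulRight, LinearMap.comp_apply, hPA 1 A.toSubalgebra.one_mem]

omit [FiniteDimensional k H]

variable {A} {e : H} (he : A.IsIntegral e)

include he

theorem IsIntegral.mul_self : e * e = e := by
  rw [he.mul_left e he.mem, he.counit_eq, one_smul]

/-- If xe = 0 then x = x(1 − e), and 1 − e lies in A⁺. -/
theorem IsIntegral.mem_leftAugIdeal {x : H} : x ∈ A.leftAugIdeal ↔ x * e = 0 := by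
  constructor
  · intro hx
    refine Submodule.span_induction (p := fun x _ => x * e = 0) ?_ ?_ ?_ ?_
      (show x ∈ Ideal.span _ from hx)
    · rintro a ⟨ha, ha0⟩
      rw [he.mul_left a ha, ha0, zero_smul]
    · exact zero_mul e
    · intro a b _ _ ha hb; rw [add_mul, ha, hb, add_zero]
    · intro a b _ hb; rw [smul_eq_mul, mul_assoc, hb, mul_zero]
  · intro hx
    have h1 : x = x * (1 - e) := by rw [mul_sub, mul_one, hx, sub_zero]
    rw [h1]
    refine A.mul_mem_leftAugIdeal x (Ideal.subset_span ⟨?_, ?_⟩)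
    · exact A.toSubalgebra.sub_mem A.toSubalgebra.one_mem he.mem
    · rw [map_sub, Bialgebra.counit_one, he.counit_eq, sub_self]

theorem IsIntegral.leftAugIdeal_eq_ker : A.leftAugIdeal = LinearMap.ker (LinearMap.mulRight k e) := by
  ext x
  rw [he.mem_leftAugIdeal]
  rfl

/-- HA⁺ is the kernel of the idempotent right multiplication by e, whose rank is its trace, and the
antipode carries this trace to that of left multiplication. -/
theorem IsIntegral.finrank_quotient [FiniteDimensional k H] (hS : ∀ x, 𝓢 (𝓢 x) = x) :
    (Module.finrank k (H ⧸ A.leftAugIdeal) : k) = antipodeSqTrace k H e := by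
  have h1 : IsIdempotentElem (LinearMap.mulRight k e) := by
    ext x
    simp [mul_assoc, he.mul_self]
  rw [← he.antipode_eq, ← trace_mulRight hS,
    LinearMap.exists_trace_eq_natCast_of_isIdempotentElem h1, he.leftAugIdeal_eq_ker,
    ((LinearMap.mulRight k e).quotKerEquivRange).finrank_eq]

theorem IsIntegral.comul_mul {a : H} (ha : a ∈ A.toSubalgebra) :
    comul a * (1 ⊗ₜ[k] e) = a ⊗ₜ e := by
  obtain ⟨r, hr⟩ := A.exists_repr ha
  have h1 : ∑ i ∈ r.index, counit (R := k) (r.right i) • r.left i = a := by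
    have := rightHit_repr (1 : ConvDual k H) r
    rw [rightHit_one] at this
    exact this.symm
  rw [← r.eq, Finset.sum_mul]
  conv_rhs => rw [← h1, TensorProduct.sum_tmul]
  refine Finset.sum_congr rfl fun i _ => ?_
  rw [Algebra.TensorProduct.tmul_mul_tmul, mul_one, he.mul_left _ (hr i).2, TensorProduct.smul_tmul]

end HopfSubalgebra

end

/-! ### Characterization of a Hopf subalgebra by its integral -/

section

variable {k H : Type*} [Field k] [Ring H] [HopfAlgebra k H]

local notation "𝓢" => antipode k (A := H)

/-- The element X of C representing f ↦ Tr(`rightHit f`) is fixed by Λ, by cyclicity of the trace.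
Lifting X to x in H, the identity Λx = ε(x)Λ gives X = ε(X)π(Λ), and ε(X) = dim C. -/
theorem IsNormalizedIntegral.trace_rightHit {C : Type*} [AddCommGroup C] [Module k C]
    [Coalgebra k C] [FiniteDimensional k C] {Λ : H} (hΛ : IsNormalizedIntegral k Λ)
    (hS : ∀ x, 𝓢 (𝓢 x) = x) (π : H →ₗc[k] C) (hπ : Function.Surjective π)
    (ρ : H →ₐ[k] Module.End k C) (hρ : ∀ a h, ρ a (π h) = π (a * h)) (f : ConvDual k C) :
    LinearMap.trace k C (rightHit f) = Module.finrank k C * f (π Λ) := by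
  set X : C := (Module.evalEquiv k C).symm (LinearMap.trace k C ∘ₗ
    rightHit ∘ₗ (WithConv.linearEquiv k (C →ₗ[k] k)).symm.toLinearMap) with hX
  have hXf : ∀ f : ConvDual k C, f X = LinearMap.trace k C (rightHit f) := fun f =>
    (LinearMap.congr_fun ((Module.evalEquiv k C).apply_symm_apply (LinearMap.trace k C ∘ₗ
    rightHit ∘ₗ (WithConv.linearEquiv k (C →ₗ[k] k)).symm.toLinearMap)) f.ofConv)
  have hεX : counit (R := k) X = Module.finrank k C := by
    have := hXf 1
    rw [rightHit_one, LinearMap.trace_one] at this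
    exact this
  have h1 : ρ Λ X = X := by
    refine convDual_ext k fun f => ?_
    have h2 : f (ρ Λ X) = (toConv (f.ofConv ∘ₗ ρ Λ) : ConvDual k C) X := rfl
    rw [h2, hXf, hXf, rightHit_comp_action π hπ ρ hρ f Λ (ℛ k Λ), map_sum]
    have h3 : ∀ i ∈ (ℛ k Λ).index, LinearMap.trace k C (ρ (𝓢 ((ℛ k Λ).left i)) * rightHit f *
        ρ ((ℛ k Λ).right i)) = LinearMap.trace k C
          (ρ ((ℛ k Λ).right i * 𝓢 ((ℛ k Λ).left i)) * rightHit f) := by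
      intro i _
      rw [LinearMap.trace_mul_comm, ← mul_assoc, map_mul ρ]
    rw [Finset.sum_congr rfl h3, ← map_sum, ← Finset.sum_mul, ← map_sum,
      sum_mul_antipode_eq_smul_of_involutive hS, hΛ.counit_eq, one_smul, map_one, one_mul]
  obtain ⟨x, hx⟩ := hπ X
  have h2 : X = counit (R := k) X • π Λ := by
    rw [← hx, CoalgHomClass.counit_comp_apply, ← map_smul, ← hΛ.mul_right, ← hρ, hx, h1]
  rw [← hXf, h2, map_smul, hεX, smul_eq_mul]

theorem IsNormalizedIntegral.trace_rightHit_self [FiniteDimensional k H] {Λ : H}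
    (hΛ : IsNormalizedIntegral k Λ) (hS : ∀ x, 𝓢 (𝓢 x) = x) (f : ConvDual k H) :
    LinearMap.trace k H (rightHit f) = Module.finrank k H * f Λ :=
  hΛ.trace_rightHit hS (CoalgHom.id k H) Function.surjective_id (Algebra.lmul k H)
    (fun _ _ => rfl) f

theorem rightHit_apply (f : ConvDual k H) (x : H) :
    rightHit f x = TensorProduct.rid k H (f.ofConv.lTensor H (comul x)) := rfl

theorem rid_lTensor_comp_mulRight (f : H →ₗ[k] k) (a b : H) (t : H ⊗[k] H) :
    TensorProduct.rid k H (f.lTensor H (t * (a ⊗ₜ b))) =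
      TensorProduct.rid k H ((f ∘ₗ LinearMap.mulRight k b).lTensor H t) * a := by
  induction t with
  | zero => simp
  | add x y hx hy => simp only [map_add, add_mul, hx, hy]
  | tmul x y => simp

namespace HopfSubalgebra

variable {A : HopfSubalgebra k H} {e : H}

variable [FiniteDimensional k H] {Λ : H}

/-- This prepares the identity μ * μ = T(e)μ for μ = T( · e). It rests on T(xe) = T(ex), on e
absorbing its own second tensor factors, and on T being an integral of the dual. -/
theorem IsIntegral.rightHit_mul (he : A.IsIntegral e) (hΛ : IsNormalizedIntegral k Λ)
    (hS : ∀ x, 𝓢 (𝓢 x) = x) (y : H) :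
    rightHit (toConv ((antipodeSqTrace k H).ofConv ∘ₗ LinearMap.mulRight k e)) y * e =
      antipodeSqTrace k H (y * e) • e := by
  set R := antipodeSqTrace k H with hR
  have h1 : (toConv (R.ofConv ∘ₗ LinearMap.mulRight k e) : ConvDual k H) =
      toConv (R.ofConv ∘ₗ LinearMap.mulLeft k e) := by
    ext x
    exact antipodeSqTrace_mul_comm' hS x e
  have h2 : rightHit (toConv (R.ofConv ∘ₗ LinearMap.mulRight k e)) (y * e) =
      rightHit (toConv (R.ofConv ∘ₗ LinearMap.mulRight k e)) y * e := by
    have h3 : comul (y * e) * (1 ⊗ₜ[k] e) = comul y * (e ⊗ₜ e) := by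
      rw [Bialgebra.comul_mul, mul_assoc, he.comul_mul he.mem]
    have h4 := rid_lTensor_comp_mulRight R.ofConv 1 e (comul (y * e))
    rw [h3, rid_lTensor_comp_mulRight, mul_one] at h4
    exact h4.symm
  rw [← h2, h1]
  obtain ⟨r, hr⟩ := A.exists_repr he.mem
  rw [rightHit_comp_mulLeft _ _ r, LinearMap.sum_apply]
  have h5 : ∀ i ∈ r.index, (LinearMap.mulLeft k (𝓢 (r.left i)) * rightHit R *
      LinearMap.mulLeft k (r.right i)) (y * e) = R (y * e) •
        𝓢 (counit (R := k) (r.right i) • r.left i) := by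
    intro i _
    simp only [Module.End.mul_apply, LinearMap.mulLeft_apply]
    rw [hΛ.rightHit_antipodeSqTrace, ← mul_assoc, antipodeSqTrace_mul_comm' hS (r.right i * y) e,
      ← mul_assoc, he.mul_right _ (hr i).2, smul_mul_assoc, map_smul,
      antipodeSqTrace_mul_comm' hS e y, map_smul, mul_smul_comm, mul_one, smul_assoc, smul_comm]
  rw [Finset.sum_congr rfl h5, ← Finset.smul_sum, ← map_sum]
  have h6 := rightHit_repr (1 : ConvDual k H) r
  rw [rightHit_one] at h6
  rw [show ∑ i ∈ r.index, counit (R := k) (r.right i) • r.left i = e from h6.symm, he.antipode_eq]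

/-- For μ = T( · e), the operator of T(e)⁻¹μ is idempotent and fixes every x satisfying the
equation, in particular A. Its trace is T(e)⁻¹ dim H = dim A, so its range is exactly A. -/
theorem IsIntegral.mem_of_comul_mul [CharZero k] (he : A.IsIntegral e)
    (hΛ : IsNormalizedIntegral k Λ) (hS : ∀ x, 𝓢 (𝓢 x) = x)
    (hd : (Module.finrank k A.toSubalgebra : k) * antipodeSqTrace k H e = Module.finrank k H)
    (hn : Module.finrank k H ≠ 0) {x : H}
    (hx : comul x * (1 ⊗ₜ[k] e) = x ⊗ₜ e) : x ∈ A.toSubalgebra := by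
  set R := antipodeSqTrace k H with hR
  set μ : ConvDual k H := toConv (R.ofConv ∘ₗ LinearMap.mulRight k e) with hμ
  have hRe : R e ≠ 0 := by
    intro h0
    rw [h0, mul_zero] at hd
    exact hn (by exact_mod_cast hd.symm)
  have hX : ∀ y : H, comul y * (1 ⊗ₜ[k] e) = y ⊗ₜ e → rightHit μ y = R e • y := by
    intro y hy
    have h1 := rid_lTensor_comp_mulRight R.ofConv 1 e (comul y)
    rw [hy, mul_one] at h1
    refine h1.symm.trans ?_
    simp
  have hμμ : μ * μ = R e • μ := by
    ext y
    change (μ * μ) y = R e * R (y * e)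
    rw [← apply_rightHit]
    change R (rightHit μ y * e) = _
    rw [he.rightHit_mul hΛ hS, map_smul, smul_eq_mul, mul_comm]
  set T : Module.End k H := (R e)⁻¹ • rightHit μ with hT
  have hTT : IsIdempotentElem T := by
    rw [IsIdempotentElem, hT, smul_mul_smul_comm, ← _root_.rightHit_mul, hμμ, map_smul, smul_smul,
      inv_mul_cancel_right₀ hRe]
  have hTx : ∀ y : H, comul y * (1 ⊗ₜ[k] e) = y ⊗ₜ e → y ∈ LinearMap.range T := by
    intro y hy
    refine ⟨y, ?_⟩
    rw [hT, LinearMap.smul_apply, hX y hy, smul_smul, inv_mul_cancel₀ hRe, one_smul]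
  have hle : Subalgebra.toSubmodule A.toSubalgebra ≤ LinearMap.range T :=
    fun a ha => hTx a (he.comul_mul ha)
  have htr := LinearMap.exists_trace_eq_natCast_of_isIdempotentElem hTT
  have hμΛ : μ Λ = 1 := by
    change R (Λ * e) = 1
    rw [hΛ.mul_right, he.counit_eq, one_smul, hΛ.antipodeSqTrace_apply_self]
  rw [hT, map_smul, hΛ.trace_rightHit_self hS, hμΛ, mul_one, smul_eq_mul, ← hd, mul_comm (_ : k),
    mul_inv_cancel_right₀ hRe] at htr
  have hfr : Module.finrank k (Subalgebra.toSubmodule A.toSubalgebra) =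
    Module.finrank k (LinearMap.range T) := by exact_mod_cast htr
  have := Submodule.eq_of_le_of_finrank_eq hle hfr
  rw [← Subalgebra.mem_toSubmodule, this]
  exact hTx x hx

/-- The convolution-constant function with value `c`. -/
def _root_.convConst (k H : Type*) [Field k] [Ring H] [HopfAlgebra k H] {E : Type*} [Ring E]
    [Algebra k E] (c : E) : WithConv (H →ₗ[k] E) := toConv ((counit (R := k) (A := H)).smulRight c)

omit [FiniteDimensional k H] in
theorem _root_.convConst_mul_apply {E : Type*} [Ring E] [Algebra k E] (c : E)
    (F : WithConv (H →ₗ[k] E)) (h : H) : (convConst k H c * F) h = c * F h := by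
  rw [(ℛ k h).convMul_apply]
  conv_rhs => rw [← sum_counit_smul (ℛ k h)]
  simp [convConst, Finset.mul_sum]

omit [FiniteDimensional k H] in
theorem _root_.mul_convConst_apply {E : Type*} [Ring E] [Algebra k E] (c : E)
    (F : WithConv (H →ₗ[k] E)) (h : H) : (F * convConst k H c) h = F h * c := by
  rw [(ℛ k h).convMul_apply]
  have h1 := rightHit_repr (1 : ConvDual k H) (ℛ k h)
  rw [rightHit_one] at h1
  conv_rhs => rw [show h = ∑ i ∈ (ℛ k h).index, counit (R := k) ((ℛ k h).right i) •
    (ℛ k h).left i from h1]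
  simp [convConst, Finset.sum_mul]

omit [FiniteDimensional k H] in
theorem leftAdjoint_eq_convMul (h a : H) : leftAdjoint (k := k) h a =
    (toConv LinearMap.id * convConst k H a * toConv 𝓢 : WithConv (H →ₗ[k] H)) h := by
  rw [(ℛ k h).convMul_apply]
  simp only [mul_convConst_apply]
  rw [leftAdjoint, ← (ℛ k h).eq]
  simp

omit [FiniteDimensional k H] in
-- As e is central, 1 ⊗ e can be moved next to Δ(a), where it replaces Δ(a) by a ⊗ e, and moved out
-- again. In the remaining Δ(h₁)(a ⊗ 1)Δ(S h₂) the second tensor factors meet as h S(h) and cancel.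
theorem comul_leftAdjoint_mul {a : H} (hcomul : comul a * (1 ⊗ₜ[k] e) = a ⊗ₜ e)
    (hcen : ∀ x, e * x = x * e) (h : H) :
    comul (leftAdjoint (k := k) h a) * (1 ⊗ₜ[k] e) = leftAdjoint (k := k) h a ⊗ₜ e := by
  set i1 := (Algebra.TensorProduct.includeLeft (R := k) (S := k) (A := H) (B := H)) with hi1
  set i2 := (Algebra.TensorProduct.includeRight (R := k) (A := H) (B := H)) with hi2
  set Δ : WithConv (H →ₗ[k] H ⊗[k] H) := toConv comul with hΔ
  set Δ' : WithConv (H →ₗ[k] H ⊗[k] H) := toConv ((Bialgebra.comulAlgHom k H).toLinearMap ∘ₗ 𝓢)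
    with hΔ'
  have hce : ∀ F : WithConv (H →ₗ[k] H ⊗[k] H), F * convConst k H (1 ⊗ₜ[k] e) =
      convConst k H (1 ⊗ₜ[k] e) * F := by
    intro F
    ext x
    rw [convConst_mul_apply, mul_convConst_apply]
    generalize F x = t
    induction t with
    | zero => simp
    | add x y hx hy => rw [add_mul, mul_add, hx, hy]
    | tmul x y => simp [hcen]
  have hcc : ∀ c d : H ⊗[k] H, convConst k H c * convConst k H d = convConst k H (c * d) := by
    intro c d
    ext x
    rw [convConst_mul_apply]
    simp [convConst]
  have h2 : Δ' = toConv (i2.toLinearMap ∘ₗ 𝓢) * toConv (i1.toLinearMap ∘ₗ 𝓢) := by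
    have hL : Δ' * Δ = 1 := algHom_antipode_convMul (Bialgebra.comulAlgHom k H)
    have hR : Δ * (toConv (i2.toLinearMap ∘ₗ 𝓢) * toConv (i1.toLinearMap ∘ₗ 𝓢)) = 1 := by
      rw [hΔ, comul_eq_convMul, mul_assoc, ← mul_assoc (toConv i2.toLinearMap),
        algHom_convMul_antipode, one_mul, algHom_convMul_antipode]
    exact left_inv_eq_right_inv hL hR
  have h3 : (toConv i2.toLinearMap : WithConv (H →ₗ[k] H ⊗[k] H)) * convConst k H (a ⊗ₜ 1) =
      convConst k H (a ⊗ₜ 1) * toConv i2.toLinearMap := by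
    ext x
    rw [convConst_mul_apply, mul_convConst_apply]
    simp [i2]
  have h4 : Δ * convConst k H (a ⊗ₜ 1) * Δ' = toConv i1.toLinearMap * convConst k H (a ⊗ₜ 1) *
      toConv (i1.toLinearMap ∘ₗ 𝓢) := by
    rw [h2, hΔ, comul_eq_convMul, mul_assoc (toConv _) (toConv _) (convConst _ _ _), h3]
    simp only [mul_assoc]
    rw [← mul_assoc (toConv i2.toLinearMap), algHom_convMul_antipode, one_mul]
  have h5 : comul (leftAdjoint (k := k) h a) = (Δ * convConst k H (comul a) * Δ' :
      WithConv (H →ₗ[k] H ⊗[k] H)) h := by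
    rw [leftAdjoint_eq_convMul]
    have h6 := LinearMap.algHom_comp_convMul_distrib (Bialgebra.comulAlgHom k H)
      (toConv LinearMap.id * convConst k H a) (toConv 𝓢)
    rw [LinearMap.algHom_comp_convMul_distrib (Bialgebra.comulAlgHom k H)
      (toConv LinearMap.id) (convConst k H a)] at h6
    refine (LinearMap.congr_fun h6 h).trans ?_
    have h7 : (toConv ((Bialgebra.comulAlgHom k H).toLinearMap ∘ₗ (convConst k H a).ofConv) :
        WithConv (H →ₗ[k] H ⊗[k] H)) = convConst k H (comul a) := by
      ext x
      simp [convConst]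
    rw [h7]
    rfl
  have h8 : leftAdjoint (k := k) h a ⊗ₜ[k] (1 : H) = (toConv i1.toLinearMap *
      convConst k H (a ⊗ₜ 1) * toConv (i1.toLinearMap ∘ₗ 𝓢) : WithConv (H →ₗ[k] H ⊗[k] H)) h := by
    rw [leftAdjoint_eq_convMul]
    have h6 := LinearMap.algHom_comp_convMul_distrib i1
      (toConv LinearMap.id * convConst k H a) (toConv 𝓢)
    rw [LinearMap.algHom_comp_convMul_distrib i1 (toConv LinearMap.id) (convConst k H a)] at h6
    refine (LinearMap.congr_fun h6 h).trans ?_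
    have h7 : (toConv (i1.toLinearMap ∘ₗ (convConst k H a).ofConv) :
        WithConv (H →ₗ[k] H ⊗[k] H)) = convConst k H (a ⊗ₜ 1) := by
      ext x
      simp [convConst, i1]
    rw [h7]
    rfl
  rw [h5, ← mul_convConst_apply, mul_assoc, hce, ← mul_assoc, mul_assoc Δ, hcc, hcomul,
    show a ⊗ₜ[k] e = (a ⊗ₜ 1) * (1 ⊗ₜ e) by simp, ← hcc, ← mul_assoc, mul_assoc, ← hce,
    ← mul_assoc, h4, mul_convConst_apply, ← h8]
  simp

/-- A Hopf subalgebra whose integral is central is normal. -/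
theorem IsIntegral.isNormal [CharZero k] (he : A.IsIntegral e)
    (hΛ : IsNormalizedIntegral k Λ) (hS : ∀ x, 𝓢 (𝓢 x) = x)
    (hd : (Module.finrank k A.toSubalgebra : k) * antipodeSqTrace k H e = Module.finrank k H)
    (hn : Module.finrank k H ≠ 0) (hcen : ∀ x, e * x * e = x * e) : A.IsNormal := by
  -- The antipode fixes e and reverses products, so it yields the mirror identity; the two together
  -- say that e is central.
  have hcen' : ∀ x, e * x * e = e * x := by
    intro x
    have := congrArg 𝓢 (hcen (𝓢 x))
    simpa [antipode_mul_antidistrib, hS, he.antipode_eq, mul_assoc] using this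
  intro h a ha
  exact he.mem_of_comul_mul hΛ hS hd hn (comul_leftAdjoint_mul (he.comul_mul ha)
    (fun x => (hcen' x).symm.trans (hcen x)) h)

end HopfSubalgebra

end

/-! ### The quotient coalgebra `H / HA⁺` -/

/-- The Jacobson radical is a nilpotent ideal, hence contained in the radical of the form (y, x) ↦
τ(yx). -/
theorem IsSemisimpleRing.of_trace_form {k R : Type*} [Field k] [Ring R] [Algebra k R]
    [FiniteDimensional k R] (τ : R → k) (hτ : ∀ x, IsNilpotent x → τ x = 0)
    (hnd : ∀ x, (∀ y, τ (y * x) = 0) → x = 0) : IsSemisimpleRing R := by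
  have : IsArtinianRing R := IsArtinianRing.of_finite k R
  rw [IsArtinianRing.isSemisimpleRing_iff_jacobson, eq_bot_iff]
  intro x hx
  obtain ⟨N, hN⟩ := IsArtinianRing.isNilpotent_jacobson_bot (R := R)
  refine hnd x fun y => hτ _ ⟨N, ?_⟩
  have h1 : x ∈ Ideal.jacobson (⊥ : Ideal R) := by
    rw [Ideal.jacobson_bot]; exact hx
  have h2 := Ideal.pow_mem_pow (Ideal.mul_mem_left _ y h1) N
  rw [hN] at h2
  exact h2

/-! ### Group-like bases of coalgebras with semisimple dual -/

section

variable {k C : Type*} [Field k] [AddCommGroup C] [Module k C] [Coalgebra k C]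
  [FiniteDimensional k C]

instance : FiniteDimensional k (ConvDual k C) :=
  Module.Finite.equiv (WithConv.linearEquiv k (C →ₗ[k] k)).symm

theorem isGroupLikeElem_of_convMul_apply {x : C} (h1 : counit (R := k) x = 1)
    (h : ∀ f g : ConvDual k C, (f * g) x = f x * g x) : IsGroupLikeElem k x where
  counit_eq_one := h1
  comul_eq_tmul_self := by
    have h2 : ∀ f : ConvDual k C, leftHit f x = f x • x := by
      intro f
      refine convDual_ext k fun g => ?_
      rw [apply_leftHit, h, map_smul, smul_eq_mul]
    rw [← (basisRepr (Module.finBasis k C) x).eq]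
    simp only [basisRepr, h2]
    simp_rw [← TensorProduct.smul_tmul]
    rw [← TensorProduct.sum_tmul]
    congr 1
    exact (Module.finBasis k C).sum_repr _

omit [FiniteDimensional k C] in
theorem IsGroupLikeElem.convMul_apply {x : C} (hx : IsGroupLikeElem k x) (f g : ConvDual k C) :
    (f * g) x = f x * g x := by
  rw [LinearMap.convMul_apply, hx.comul_eq_tmul_self]
  simp

/-- The squares of the block sizes sum to 3, so all blocks have size one and the dual is k³. Its
three projections to k are algebra maps, that is, evaluations at group-like elements. -/
theorem exists_basis_isGroupLikeElem [IsAlgClosed k] [IsSemisimpleRing (ConvDual k C)]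
    (hC : Module.finrank k C = 3) :
    ∃ b : Module.Basis (Fin 3) k C, ∀ i, IsGroupLikeElem k (b i) := by
  obtain ⟨n, d, hd, ⟨E⟩⟩ :=
    IsSemisimpleRing.exists_algEquiv_pi_matrix_of_isAlgClosed k (ConvDual k C)
  have hfr : ∑ i, d i * d i = 3 := by
    have h1 := E.toLinearEquiv.finrank_eq
    rw [(WithConv.linearEquiv k (C →ₗ[k] k)).finrank_eq, Subspace.dual_finrank_eq, hC,
      Module.finrank_pi_fintype] at h1
    simpa [Module.finrank_matrix] using h1.symm
  have hd1 : ∀ i, d i = 1 := by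
    intro i
    have h1 : d i * d i ≤ 3 := hfr ▸ Finset.single_le_sum (f := fun i => d i * d i)
      (fun _ _ => Nat.zero_le _) (Finset.mem_univ i)
    have h2 := (hd i).out
    have h3 : d i < 2 := by
      by_contra! h
      nlinarith
    omega
  have hn : n = 3 := by simpa [hd1] using hfr
  subst hn
  obtain rfl : d = fun _ => 1 := funext hd1
  set F : ConvDual k C →ₗ[k] (Fin 3 → k) := LinearMap.pi fun i =>
    (Matrix.entryLinearMap k k 0 0) ∘ₗ LinearMap.proj i ∘ₗ E.toLinearMap with hF
  have hFapp : ∀ f i, F f i = E f i 0 0 := fun f i => rfl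
  have hFmul : ∀ f g i, F (f * g) i = F f i * F g i := by
    intro f g i
    rw [hFapp, map_mul, Pi.mul_apply, Matrix.mul_apply]
    simp [hFapp]
  have hFinj : Function.Injective F := by
    rw [injective_iff_map_eq_zero]
    intro f hf
    apply E.injective
    rw [map_zero]
    funext i
    ext p q
    obtain rfl := Subsingleton.elim p 0
    obtain rfl := Subsingleton.elim q 0
    exact congrFun hf i
  set m : Fin 3 → C := fun i => (Module.evalEquiv k C).symm
    (LinearMap.proj i ∘ₗ F ∘ₗ (WithConv.linearEquiv k (C →ₗ[k] k)).symm.toLinearMap) with hm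
  have hmf : ∀ i (f : ConvDual k C), f (m i) = F f i := fun i f => by
    have h := (Module.evalEquiv k C).apply_symm_apply
      (LinearMap.proj i ∘ₗ F ∘ₗ (WithConv.linearEquiv k (C →ₗ[k] k)).symm.toLinearMap)
    exact LinearMap.congr_fun h f.ofConv
  have hgl : ∀ i, IsGroupLikeElem k (m i) := by
    intro i
    refine isGroupLikeElem_of_convMul_apply ?_ fun f g => ?_
    · have := hmf i 1
      rw [hFapp, map_one] at this
      exact this.trans (by simp)
    · simp only [hmf, hFmul]
  have hspan : ⊤ ≤ Submodule.span k (Set.range m) := by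
    intro x _
    rw [← Subspace.forall_mem_dualAnnihilator_apply_eq_zero_iff]
    intro f hf
    rw [Submodule.mem_dualAnnihilator] at hf
    have : (toConv f : ConvDual k C) = 0 := by
      apply hFinj
      rw [map_zero]
      funext i
      rw [← hmf]
      exact hf _ (Submodule.subset_span ⟨i, rfl⟩)
    exact WithConv.congr_fun this x
  refine ⟨basisOfTopLeSpanOfCardEqFinrank m hspan (by rw [hC]; rfl), fun i => ?_⟩
  rw [coe_basisOfTopLeSpanOfCardEqFinrank]
  exact hgl i

/-- Group-like elements are linearly independent, so a basis of them leaves no room for another. -/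
theorem Module.Basis.exists_eq_of_isGroupLikeElem {ι : Type*} [Fintype ι]
    (b : Module.Basis ι k C) (hb : ∀ i, IsGroupLikeElem k (b i)) {x : C}
    (hx : IsGroupLikeElem k x) : ∃ i, b i = x := by
  have hli := linearIndep_groupLikeVal (R := k) (A := C)
  have : Finite (GroupLike k C) := hli.finite
  have := Fintype.ofFinite (GroupLike k C)
  have h1 : Fintype.card (GroupLike k C) ≤ Fintype.card ι := by
    rw [← Module.finrank_eq_card_basis b]
    exact hli.fintype_card_le_finrank
  set φ : ι → GroupLike k C := fun i => ⟨b i, hb i⟩ with hφ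
  have hinj : Function.Injective φ := fun i j h => b.injective (congrArg GroupLike.val h)
  have hbij := (Fintype.bijective_iff_injective_and_card φ).2
    ⟨hinj, le_antisymm (Fintype.card_le_of_injective φ hinj) h1⟩
  obtain ⟨i, hi⟩ := hbij.2 ⟨x, hx⟩
  exact ⟨i, congrArg GroupLike.val hi⟩

end

/-! ### Semisimplicity of the dual of `H / HA⁺` -/

section

variable {k H : Type*} [Field k] [Ring H] [HopfAlgebra k H]

local notation "𝓢" => antipode k (A := H)

namespace HopfSubalgebra

/-- The action of `H` on `H / HA⁺`. -/
def action (A : HopfSubalgebra k H) : H →ₐ[k] Module.End k (H ⧸ A.leftAugIdeal) :=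
  AlgHom.ofLinearMap
    { toFun a := A.leftAugIdeal.mapQ A.leftAugIdeal (LinearMap.mulLeft k a)
        fun _ hx => A.mul_mem_leftAugIdeal a hx
      map_add' a b := by
        ext x
        exact congrArg A.leftAugIdeal.mkQ (add_mul a b x)
      map_smul' c a := by
        ext x
        exact congrArg A.leftAugIdeal.mkQ (smul_mul_assoc c a x) }
    (by ext x; exact congrArg A.leftAugIdeal.mkQ (one_mul x))
    (fun a b => by ext x; exact congrArg A.leftAugIdeal.mkQ (mul_assoc a b x))

/-- The form is evaluation at π(Λ), which by `trace_rightHit` is proportional to a trace and so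
kills nilpotents. For nondegeneracy, a functional on the quotient lifts to F with F(xe) = F(x), and
then the hit of Λ by F lies in He. If its class vanishes it is killed by e, so it is zero, and F =
0. -/
theorem isSemisimpleRing_convDual [CharZero k] [FiniteDimensional k H]
    {A : HopfSubalgebra k H} {e : H} (he : A.IsIntegral e) {Λ : H}
    (hΛ : IsNormalizedIntegral k Λ) (hS : ∀ x, 𝓢 (𝓢 x) = x)
    (h3 : Module.finrank k (H ⧸ A.leftAugIdeal) ≠ 0) :
    IsSemisimpleRing (ConvDual k (H ⧸ A.leftAugIdeal)) := by
  set π : H →ₗc[k] H ⧸ A.leftAugIdeal := Coalgebra.Quotient.mkQCoalgHom A.leftAugIdeal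
  have hπs : Function.Surjective π := A.leftAugIdeal.mkQ_surjective
  refine IsSemisimpleRing.of_trace_form (k := k) (fun f => f (π Λ)) ?_ ?_
  · intro f hf
    have h1 := hΛ.trace_rightHit hS π hπs A.action (fun _ _ => rfl) f
    have h2 : IsNilpotent (rightHit f) := by
      obtain ⟨N, hN⟩ := hf
      refine ⟨N, ?_⟩
      have : ∀ j : ℕ, rightHit (f ^ j) = rightHit f ^ j := by
        intro j
        induction j with
        | zero => rw [pow_zero, pow_zero, rightHit_one]
        | succ j ih => rw [pow_succ, pow_succ, rightHit_mul, ih]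
      rw [← this, hN, map_zero]
    rw [(LinearMap.isNilpotent_trace_of_isNilpotent h2).eq_zero] at h1
    exact (mul_eq_zero.1 h1.symm).resolve_left (Nat.cast_ne_zero.2 h3)
  · intro f hf
    have h1 : rightHit f (π Λ) = 0 := by
      refine convDual_ext k fun g => ?_
      rw [apply_rightHit, hf, map_zero]
    rw [rightHit_map] at h1
    set F : ConvDual k H := toConv (f.ofConv ∘ₗ π.toLinearMap) with hF
    have h2 : rightHit F Λ * e = 0 := he.mem_leftAugIdeal.1
      ((Submodule.Quotient.mk_eq_zero _).1 h1)
    have h3 : (toConv (F.ofConv ∘ₗ LinearMap.mulRight k e) : ConvDual k H) = F := by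
      ext x
      refine congrArg f.ofConv (?_ : π (x * e) = π x)
      rw [← sub_eq_zero, ← map_sub]
      refine (Submodule.Quotient.mk_eq_zero _).2 (he.mem_leftAugIdeal.2 ?_)
      rw [sub_mul, mul_assoc, he.mul_self, sub_self]
    have h4 : rightHit F Λ * e = rightHit F Λ := by
      have h5 := rid_lTensor_comp_mulRight F.ofConv e 1 (comul Λ)
      rw [hΛ.comul_mul_tmul_one, he.antipode_eq, rid_lTensor_comp_mulRight, mul_one,
        LinearMap.mulRight_one, LinearMap.comp_id] at h5
      exact h5.symm.trans (congrArg (rightHit · Λ) h3)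
    rw [h4] at h2
    have h7 := hΛ.rightHit_injective h2
    refine WithConv.ofConv_injective (LinearMap.ext fun x => ?_)
    obtain ⟨x, rfl⟩ := hπs x
    exact WithConv.congr_fun h7 x

end HopfSubalgebra

end

/-! ### Magic unitaries of size three -/

theorem Fin.exists_third (a b : Fin 3) (hab : a ≠ b) :
    ∃ c, c ≠ a ∧ c ≠ b ∧ (Finset.univ : Finset (Fin 3)) = {a, b, c} := by
  decide +revert

theorem Fin.sum_eq_of_ne {V : Type*} [AddCommMonoid V] {a b c : Fin 3} (hab : a ≠ b) (hca : c ≠ a)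
    (hcb : c ≠ b) (f : Fin 3 → V) : ∑ i, f i = f a + (f b + f c) := by
  have h : (Finset.univ : Finset (Fin 3)) = {a, b, c} := by decide +revert
  rw [h, Finset.sum_insert (by simp [hab, hca.symm]), Finset.sum_pair hcb.symm]

theorem sum_perm_fin_three {V : Type*} [AddCommMonoid V] (g : Fin 3 → Fin 3 → V)
    (hg : ∀ i, g i i = 0) :
    ∑ σ : Equiv.Perm (Fin 3), g (σ 0) (σ 1) = ∑ i, ∑ j, g i j := by
  have h1 : (Finset.univ : Finset (Equiv.Perm (Fin 3))).image (fun σ => (σ 0, σ 1)) =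
      (Finset.univ : Finset (Fin 3)).offDiag := by decide
  have h2 : ∀ σ τ : Equiv.Perm (Fin 3), (σ 0, σ 1) = (τ 0, τ 1) → σ = τ := by decide
  have h3 := Finset.sum_image (s := (Finset.univ : Finset (Equiv.Perm (Fin 3))))
    (g := fun σ => (σ 0, σ 1)) (f := fun p : Fin 3 × Fin 3 => g p.1 p.2)
    (fun σ _ τ _ h => h2 σ τ h)
  rw [← h3, h1, ← Finset.sum_product']
  refine Finset.sum_subset (Finset.subset_univ _) fun p _ hp => ?_
  have : p.1 = p.2 := by simpa using hp
  rw [this, hg]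

/-- A `3 × 3` matrix of idempotents, orthogonal and summing to one along rows and columns. -/
structure IsMagicUnitary {R : Type*} [Ring R] (u : Fin 3 → Fin 3 → R) : Prop where
  col_mul : ∀ i i' j, u i j * u i' j = if i = i' then u i j else 0
  row_mul : ∀ i j j', u i j * u i j' = if j = j' then u i j else 0
  col_sum : ∀ j, ∑ i, u i j = 1
  row_sum : ∀ i, ∑ j, u i j = 1

namespace IsMagicUnitary

variable {R : Type*} [Ring R] {u : Fin 3 → Fin 3 → R} (hu : IsMagicUnitary u)

include hu

/-- In size three there is only one column l besides j and j'. Expanding u_{i'j'} along its row and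
multiplying by the entries of row i, all terms cancel except u_ij u_{i'j'} u_ij, which therefore
equals both products. -/
theorem commute (i i' j j' : Fin 3) : u i j * u i' j' = u i' j' * u i j := by
  have hc : ∀ {i i'} j, i ≠ i' → u i j * u i' j = 0 := fun j h => by rw [hu.col_mul, if_neg h]
  have hr : ∀ i {j j'}, j ≠ j' → u i j * u i j' = 0 := fun i _ _ h => by rw [hu.row_mul, if_neg h]
  rcases eq_or_ne i i' with rfl | hi
  · rcases eq_or_ne j j' with rfl | hj
    · rfl
    · rw [hr i hj, hr i hj.symm]
  rcases eq_or_ne j j' with rfl | hj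
  · rw [hc j hi, hc j hi.symm]
  obtain ⟨l, hlj, hlj', -⟩ := Fin.exists_third j j' hj
  have hrow := fun p => (Fin.sum_eq_of_ne hj hlj hlj' (u p)).symm.trans (hu.row_sum p)
  have h1 : u i' j' = 1 - u i' j - u i' l := by rw [← hrow i']; abel
  have e1 : u i j * u i' j' * u i j' = 0 := by rw [mul_assoc, hc j' hi.symm, mul_zero]
  have e2 : u i j * u i' j' * u i l = 0 := by
    rw [h1, mul_sub, mul_sub, sub_mul, sub_mul, mul_one, hr i hlj.symm, hc j hi, zero_mul,
      mul_assoc, hc l hi.symm, mul_zero, sub_zero, sub_zero]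
  have e3 : u i j' * u i' j' * u i j = 0 := by rw [hc j' hi, zero_mul]
  have e4 : u i l * u i' j' * u i j = 0 := by
    rw [h1, mul_sub, mul_sub, sub_mul, sub_mul, mul_one, hr i hlj, mul_assoc, hc j hi.symm,
      hc l hi, zero_mul, mul_zero, sub_zero, sub_zero]
  have f1 : u i j * u i' j' = u i j * u i' j' * u i j := by
    conv_lhs => rw [← mul_one (u i j * u i' j'), ← hrow i, mul_add, mul_add, e1, e2, add_zero,
      add_zero]
  have f2 : u i' j' * u i j = u i j * u i' j' * u i j := by
    conv_lhs => rw [← one_mul (u i' j' * u i j), ← hrow i, add_mul, add_mul, ← mul_assoc,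
      ← mul_assoc, ← mul_assoc, e3, e4, add_zero, add_zero]
  rw [f1, f2]

/-- The idempotent attached to a permutation. -/
def _root_.permIdem (u : Fin 3 → Fin 3 → R) (σ : Equiv.Perm (Fin 3)) : R := u (σ 0) 0 * u (σ 1) 1

/-- Two factors along the graph of σ already imply the third: in the remaining column the other two
rows are orthogonal to them. So any two of the three factors give the same product. -/
theorem mul_eq_permIdem (σ : Equiv.Perm (Fin 3)) {a b : Fin 3} (hab : a ≠ b) :
    u (σ a) a * u (σ b) b = permIdem u σ := by
  have key : ∀ a b c : Fin 3, a ≠ b → c ≠ a → c ≠ b →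
      u (σ a) a * u (σ b) b = u (σ a) a * u (σ b) b * u (σ c) c := by
    intro a b c hab hca hcb
    have h1 := Fin.sum_eq_of_ne (σ.injective.ne hab) (σ.injective.ne hca) (σ.injective.ne hcb)
      fun i => u i c
    rw [hu.col_sum] at h1
    conv_lhs => rw [← mul_one (u (σ a) a * u (σ b) b), h1]
    rw [mul_add, mul_add, mul_assoc _ _ (u (σ b) c), hu.row_mul, if_neg hcb.symm, mul_zero,
      zero_add, mul_assoc _ _ (u (σ a) c), hu.commute (σ b), ← mul_assoc _ (u (σ a) c),
      hu.row_mul, if_neg hca.symm, zero_mul, zero_add]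
  have swap : ∀ a b : Fin 3, u (σ a) a * u (σ b) b = u (σ b) b * u (σ a) a :=
    fun a b => hu.commute _ _ _ _
  have turn : ∀ a b c : Fin 3, a ≠ b → c ≠ a → c ≠ b →
      u (σ a) a * u (σ b) b = u (σ a) a * u (σ c) c := by
    intro a b c hab hca hcb
    rw [key a b c hab hca hcb, key a c b hca.symm hab.symm hcb.symm, mul_assoc, swap b c, mul_assoc]
  have h01 : u (σ 0) 0 * u (σ 1) 1 = permIdem u σ := rfl
  have h02 : u (σ 0) 0 * u (σ 2) 2 = permIdem u σ := by
    rw [turn 0 2 1 (by decide) (by decide) (by decide), h01]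
  have h12 : u (σ 1) 1 * u (σ 2) 2 = permIdem u σ := by
    rw [turn 1 2 0 (by decide) (by decide) (by decide), swap, h01]
  fin_cases a <;> fin_cases b <;> first | exact absurd rfl hab | assumption | skip
  · exact (swap 1 0).trans h01
  · exact (swap 2 0).trans h02
  · exact (swap 2 1).trans h12

theorem mul_permIdem (i j : Fin 3) (σ : Equiv.Perm (Fin 3)) :
    u i j * permIdem u σ = if i = σ j then permIdem u σ else 0 := by
  obtain ⟨b, hb⟩ := exists_ne j
  rw [← hu.mul_eq_permIdem σ hb.symm, ← mul_assoc, hu.col_mul]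
  split_ifs with h
  · rw [h]
  · rw [zero_mul]

theorem permIdem_mul (σ τ : Equiv.Perm (Fin 3)) :
    permIdem u σ * permIdem u τ = if σ = τ then permIdem u σ else 0 := by
  split_ifs with h
  · rw [← h]
    conv_lhs => enter [1]; rw [permIdem]
    rw [mul_assoc, hu.mul_permIdem, if_pos rfl, hu.mul_permIdem, if_pos rfl]
  · obtain ⟨a, ha⟩ : ∃ a, σ a ≠ τ a := by
      by_contra! h'
      exact h (Equiv.ext h')
    obtain ⟨b, hb⟩ := exists_ne a
    rw [← hu.mul_eq_permIdem σ hb, mul_assoc, hu.mul_permIdem, if_neg ha, mul_zero]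

theorem sum_permIdem : ∑ σ, permIdem u σ = 1 := by
  have h := sum_perm_fin_three (fun i j => u i 0 * u j 1) fun i => by
    rw [hu.row_mul, if_neg (by decide)]
  refine h.trans ?_
  rw [← Finset.sum_mul_sum, hu.col_sum, hu.col_sum, one_mul]

theorem eq_sum_permIdem (i j : Fin 3) :
    u i j = ∑ σ : Equiv.Perm (Fin 3), if i = σ j then permIdem u σ else 0 := by
  conv_lhs => rw [← mul_one (u i j), ← hu.sum_permIdem, Finset.mul_sum]
  exact Finset.sum_congr rfl fun σ _ => hu.mul_permIdem i j σ

end IsMagicUnitary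

/-- Two non-commuting elements generate S₃, and these words suffice to reach every element. -/
theorem Equiv.Perm.fin_three_generated (σ τ ω : Equiv.Perm (Fin 3)) (h : σ * τ ≠ τ * σ) :
    ω = 1 ∨ ω = σ ∨ ω = τ ∨ ω = σ * τ ∨ ω = τ * σ ∨ ω = σ * τ * σ ∨ ω = σ * σ ∨ ω = τ * τ := by
  revert σ τ ω
  decide

/-! ### Module coalgebras with a basis of three group-like elements -/

section

variable {k H : Type*} [Field k] [Ring H] [HopfAlgebra k H]

local notation "𝓢" => antipode k (A := H)

variable {C : Type*} [AddCommGroup C] [Module k C]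

/-- The matrix coefficients of a representation. -/
def coefFn (b : Module.Basis (Fin 3) k C) (ρ : H →ₐ[k] Module.End k C) (i j : Fin 3) :
    ConvDual k H := toConv (b.coord i ∘ₗ LinearMap.applyₗ (b j) ∘ₗ ρ.toLinearMap)

theorem coefFn_apply (b : Module.Basis (Fin 3) k C) (ρ : H →ₐ[k] Module.End k C) (i j : Fin 3)
    (h : H) : coefFn b ρ i j h = b.coord i (ρ h (b j)) := rfl

theorem action_eq_sum_coefFn (b : Module.Basis (Fin 3) k C) (ρ : H →ₐ[k] Module.End k C)
    (h : H) (j : Fin 3) : ρ h (b j) = ∑ i, coefFn b ρ i j h • b i :=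
  (b.sum_repr _).symm

theorem coefFn_mul (b : Module.Basis (Fin 3) k C) (ρ : H →ₐ[k] Module.End k C) (i j : Fin 3)
    (h h' : H) : coefFn b ρ i j (h * h') = ∑ l, coefFn b ρ i l h * coefFn b ρ l j h' := by
  rw [coefFn_apply, map_mul, Module.End.mul_apply, action_eq_sum_coefFn b ρ h' j, map_sum, map_sum]
  simp [coefFn_apply, mul_comm]

theorem coefFn_one (b : Module.Basis (Fin 3) k C) (ρ : H →ₐ[k] Module.End k C) (i j : Fin 3) :
    coefFn b ρ i j 1 = if i = j then 1 else 0 := by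
  rw [coefFn_apply, map_one]
  simp [Finsupp.single_apply, eq_comm]

variable [Coalgebra k C]

omit [Coalgebra k C] in
theorem map_map_mul_tmul (π : H →ₗ[k] C) (ρ : H →ₐ[k] Module.End k C)
    (hρ : ∀ a h, ρ a (π h) = π (a * h)) (t s : H ⊗[k] H) (y z : C)
    (hs : TensorProduct.map π π s = y ⊗ₜ z) :
    TensorProduct.map π π (t * s) = TensorProduct.map (LinearMap.applyₗ y ∘ₗ ρ.toLinearMap)
      (LinearMap.applyₗ z ∘ₗ ρ.toLinearMap) t := by
  induction t with
  | zero => simp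
  | add t t' h h' => rw [add_mul, map_add, h, h', map_add]
  | tmul a a' =>
    have key : TensorProduct.map π π ((a ⊗ₜ[k] a') * s) =
        TensorProduct.map (ρ a) (ρ a') (TensorProduct.map π π s) := by
      clear hs
      induction s with
      | zero => simp
      | add x y hx hy => rw [mul_add, map_add, hx, hy, map_add, map_add]
      | tmul x y => simp [hρ]
    rw [key, hs]
    rfl

/-- The orbit map of a group-like element of a module coalgebra is a coalgebra map. -/
def orbitCoalgHom (π : H →ₗc[k] C) (hπ : Function.Surjective π) (ρ : H →ₐ[k] Module.End k C)
    (hρ : ∀ a h, ρ a (π h) = π (a * h)) (m : C) (hm : IsGroupLikeElem k m) : H →ₗc[k] C :=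
  { LinearMap.applyₗ m ∘ₗ ρ.toLinearMap with
    counit_comp := by
      obtain ⟨x, rfl⟩ := hπ m
      ext h
      have h1 : counit (R := k) (ρ h (π x)) = counit (R := k) h := by
        rw [hρ, CoalgHomClass.counit_comp_apply, Bialgebra.counit_mul]
        have := hm.counit_eq_one
        rw [CoalgHomClass.counit_comp_apply] at this
        rw [this, mul_one]
      exact h1
    map_comp_comul := by
      obtain ⟨x, rfl⟩ := hπ m
      ext h
      have h1 : TensorProduct.map π.toLinearMap π.toLinearMap (comul x) = π x ⊗ₜ[k] π x := by
        rw [← hm.comul_eq_tmul_self]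
        exact CoalgHomClass.map_comp_comul_apply π x
      have h2 : comul (ρ h (π x)) = TensorProduct.map π.toLinearMap π.toLinearMap
          (comul h * comul x) := by
        rw [hρ, ← Bialgebra.comul_mul]
        exact (CoalgHomClass.map_comp_comul_apply π (h * x)).symm
      exact (h2.trans (map_map_mul_tmul π.toLinearMap ρ hρ _ _ _ _ h1)).symm }

theorem coord_convMul_coord (b : Module.Basis (Fin 3) k C) (hb : ∀ i, IsGroupLikeElem k (b i))
    (i j : Fin 3) : (toConv (b.coord i) : ConvDual k C) * toConv (b.coord j) =
      if i = j then toConv (b.coord i) else 0 := by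
  apply WithConv.ofConv_injective
  refine b.ext fun l => ?_
  change ((toConv (b.coord i) : ConvDual k C) * toConv (b.coord j)) (b l) = _
  rw [(hb l).convMul_apply]
  split_ifs with h
  · subst h
    by_cases hl : l = i <;> simp [hl]
  · by_cases hl : l = i <;> by_cases hl' : l = j <;> simp_all

theorem sum_coord (b : Module.Basis (Fin 3) k C) (hb : ∀ i, IsGroupLikeElem k (b i)) :
    ∑ i, (toConv (b.coord i) : ConvDual k C) = 1 := by
  apply WithConv.ofConv_injective
  refine b.ext fun l => ?_
  change _ = counit (R := k) (b l)
  rw [(hb l).counit_eq_one]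
  simp

theorem comp_antipode_comp_antipode (hS : ∀ x, 𝓢 (𝓢 x) = x) (f : ConvDual k H) :
    (toConv ((toConv (f.ofConv ∘ₗ 𝓢) : ConvDual k H).ofConv ∘ₗ 𝓢) : ConvDual k H) = f := by
  ext x
  exact congrArg f.ofConv (hS x)

theorem one_comp_antipode : (toConv ((1 : ConvDual k H).ofConv ∘ₗ 𝓢) : ConvDual k H) = 1 := by
  ext x
  exact counit_antipode x

section Magic

variable {b : Module.Basis (Fin 3) k C} (hb : ∀ i, IsGroupLikeElem k (b i))
  {π : H →ₗc[k] C} (hπ : Function.Surjective π) {ρ : H →ₐ[k] Module.End k C}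
  (hρ : ∀ a h, ρ a (π h) = π (a * h))

include hb hπ hρ

/-- The orbit map of the group-like b_j is a coalgebra map, so its transpose is multiplicative, and
it sends the orthogonal idempotent coordinates to the column j. -/
theorem coefFn_col_mul (i i' j : Fin 3) : coefFn b ρ i j * coefFn b ρ i' j =
    if i = i' then coefFn b ρ i j else 0 := by
  ext h
  have h1 := convDual_mul_apply_map (orbitCoalgHom π hπ ρ hρ (b j) (hb j)) (toConv (b.coord i))
    (toConv (b.coord i')) h
  rw [coord_convMul_coord b hb] at h1
  refine h1.symm.trans ?_
  split_ifs <;> rfl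

theorem coefFn_col_sum (j : Fin 3) : ∑ i, coefFn b ρ i j = 1 := by
  ext h
  have h1 := WithConv.congr_fun (sum_coord b hb) (orbitCoalgHom π hπ ρ hρ (b j) (hb j) h)
  have h2 : (1 : ConvDual k C) (orbitCoalgHom π hπ ρ hρ (b j) (hb j) h) = (1 : ConvDual k H) h :=
    CoalgHomClass.counit_comp_apply _ h
  rw [h2] at h1
  refine Eq.trans ?_ h1
  simp only [WithConv.ofConv_sum, LinearMap.sum_apply]
  rfl

omit hb hπ hρ [Coalgebra k C] in
theorem sum_coefFn_mul_antipode (i j : Fin 3) :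
    ∑ l, coefFn b ρ i l * toConv ((coefFn b ρ l j).ofConv ∘ₗ 𝓢) =
      if i = j then 1 else 0 := by
  ext h
  simp only [WithConv.ofConv_sum, LinearMap.sum_apply, (ℛ k h).convMul_apply]
  rw [Finset.sum_comm]
  simp only [LinearMap.comp_apply, ← coefFn_mul]
  rw [← map_sum, sum_mul_antipode_eq_smul, map_smul, coefFn_one]
  split_ifs <;> simp

/-- Let w = u ∘ S, the inverse matrix of u. Orthogonality in the columns of w reduces uw = 1 to u_il
w_lj = δ_ij w_lj. This gives u_ji w_ij = w_ij, and after applying S with S² = 1 also u_ji w_ij =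
u_ji. -/
theorem coefFn_comp_antipode (hS : ∀ x : H, antipode k (antipode k x) = x) (i j : Fin 3) :
    toConv ((coefFn b ρ i j).ofConv ∘ₗ 𝓢) = coefFn b ρ j i := by
  set w : Fin 3 → Fin 3 → ConvDual k H := fun i j => toConv ((coefFn b ρ i j).ofConv ∘ₗ 𝓢) with hw
  have hww : ∀ l l' j, w l j * w l' j = if l = l' then w l j else 0 := by
    intro l l' j
    rw [hw]
    simp only
    rw [convDual_comp_antipode, coefFn_col_mul hb hπ hρ]
    by_cases h : l = l'
    · simp [h]
    · rw [if_neg h, if_neg fun h' => h h'.symm]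
      rfl
  have h1 : ∀ i l j, coefFn b ρ i l * w l j = if i = j then w l j else 0 := by
    intro i l j
    have := congrArg (· * w l j) (sum_coefFn_mul_antipode (b := b) (ρ := ρ) i j)
    simp only [Finset.sum_mul, mul_assoc] at this
    rw [Finset.sum_eq_single l] at this
    · have h2 := hww l l j
      rw [if_pos rfl] at h2
      change coefFn b ρ i l * (w l j * w l j) = _ at this
      rw [h2] at this
      rw [this]
      split_ifs <;> simp
    · intro l' _ hl'
      have h2 := hww l' l j
      rw [if_neg hl'] at h2
      change coefFn b ρ i l' * (w l' j * w l j) = 0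
      rw [h2, mul_zero]
    · simp
  have h2 := h1 j i j
  rw [if_pos rfl] at h2
  have h3 := congrArg (fun f : ConvDual k H => (toConv (f.ofConv ∘ₗ 𝓢) : ConvDual k H)) (h1 i j i)
  simp only [if_pos] at h3
  rw [← convDual_comp_antipode] at h3
  have h4 := comp_antipode_comp_antipode hS (coefFn b ρ j i)
  exact h2.symm.trans ((congrArg (· * w i j) h4).symm.trans (h3.trans h4))

theorem isMagicUnitary_coefFn (hS : ∀ x : H, antipode k (antipode k x) = x) :
    IsMagicUnitary (coefFn b ρ) where
  col_mul := coefFn_col_mul hb hπ hρ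
  col_sum := coefFn_col_sum hb hπ hρ
  row_mul i j j' := by
    rw [← coefFn_comp_antipode hb hπ hρ hS j i, ← coefFn_comp_antipode hb hπ hρ hS j' i,
      convDual_comp_antipode, coefFn_col_mul hb hπ hρ]
    by_cases h : j = j'
    · simp [h]
    · rw [if_neg h, if_neg fun h' => h h'.symm]
      rfl
  row_sum i := by
    rw [← (congrArg (fun f : ConvDual k H => (toConv (f.ofConv ∘ₗ 𝓢) : ConvDual k H))
      (coefFn_col_sum hb hπ hρ i)).trans one_comp_antipode]
    have h1 : ∀ j, coefFn b ρ i j = toConv ((coefFn b ρ j i).ofConv ∘ₗ 𝓢) :=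
      fun j => (coefFn_comp_antipode hb hπ hρ hS j i).symm
    rw [Finset.sum_congr rfl fun j _ => h1 j]
    ext h
    simp

end Magic

end

/-! ### The bialgebra map to the group algebra of `S₃` -/

section

variable {k H : Type*} [Field k] [Ring H] [HopfAlgebra k H]

local notation "𝓢" => antipode k (A := H)

theorem convMul_apply_mul (f g : ConvDual k H) (h h' : H) {ι ι' : Type*} (r : Repr k h ι)
    (r' : Repr k h' ι') : (f * g) (h * h') = ∑ i ∈ r.index, ∑ j ∈ r'.index,
      f (r.left i * r'.left j) * g (r.right i * r'.right j) := by
  rw [LinearMap.convMul_apply, Bialgebra.comul_mul, ← r.eq, ← r'.eq, Finset.sum_mul_sum]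
  simp

theorem convMul_apply_mul_eq_sum {f g : ConvDual k H} {κ κ' : Type*} [Fintype κ] [Fintype κ']
    {f₁ f₂ : κ → ConvDual k H} {g₁ g₂ : κ' → ConvDual k H}
    (hf : ∀ a b, f (a * b) = ∑ l, f₁ l a * f₂ l b) (hg : ∀ a b, g (a * b) = ∑ l, g₁ l a * g₂ l b)
    (h h' : H) : (f * g) (h * h') = ∑ l, ∑ m, (f₁ l * g₁ m) h * (f₂ l * g₂ m) h' := by
  rw [convMul_apply_mul f g h h' (ℛ k h) (ℛ k h')]
  simp only [hf, hg, (ℛ k h).convMul_apply, (ℛ k h').convMul_apply, Finset.sum_mul_sum]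
  calc _ = ∑ i ∈ (ℛ k h).index, ∑ l, ∑ j ∈ (ℛ k h').index, ∑ m, f₁ l ((ℛ k h).left i) *
        f₂ l ((ℛ k h').left j) * (g₁ m ((ℛ k h).right i) * g₂ m ((ℛ k h').right j)) :=
      Finset.sum_congr rfl fun i _ => Finset.sum_comm
    _ = ∑ l, ∑ i ∈ (ℛ k h).index, ∑ j ∈ (ℛ k h').index, ∑ m, f₁ l ((ℛ k h).left i) *
        f₂ l ((ℛ k h').left j) * (g₁ m ((ℛ k h).right i) * g₂ m ((ℛ k h').right j)) :=
      Finset.sum_comm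
    _ = ∑ l, ∑ i ∈ (ℛ k h).index, ∑ m, ∑ j ∈ (ℛ k h').index, f₁ l ((ℛ k h).left i) *
        f₂ l ((ℛ k h').left j) * (g₁ m ((ℛ k h).right i) * g₂ m ((ℛ k h').right j)) :=
      Finset.sum_congr rfl fun l _ => Finset.sum_congr rfl fun i _ => Finset.sum_comm
    _ = ∑ l, ∑ m, ∑ i ∈ (ℛ k h).index, ∑ j ∈ (ℛ k h').index, f₁ l ((ℛ k h).left i) *
        f₂ l ((ℛ k h').left j) * (g₁ m ((ℛ k h).right i) * g₂ m ((ℛ k h').right j)) :=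
      Finset.sum_congr rfl fun l _ => Finset.sum_comm
    _ = _ := Finset.sum_congr rfl fun l _ => Finset.sum_congr rfl fun m _ =>
      Finset.sum_congr rfl fun i _ => Finset.sum_congr rfl fun j _ => by ring

variable {C : Type*} [AddCommGroup C] [Module k C]
  {b : Module.Basis (Fin 3) k C} {ρ : H →ₐ[k] Module.End k C}

local notation "𝓭" => permIdem (coefFn b ρ)

/-- The expansion runs over pairs (l, m) of intermediate indices. Those with l = m vanish by column
orthogonality, and the others are the pairs (τ 0, τ 1). -/
theorem permIdem_coefFn_mul (hu : IsMagicUnitary (coefFn b ρ)) (σ : Equiv.Perm (Fin 3)) (h h' : H) :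
    𝓭 σ (h * h') = ∑ τ, 𝓭 (σ * τ⁻¹) h * 𝓭 τ h' := by
  rw [permIdem, convMul_apply_mul_eq_sum (fun a c => coefFn_mul b ρ (σ 0) 0 a c)
    (fun a c => coefFn_mul b ρ (σ 1) 1 a c)]
  rw [← sum_perm_fin_three (fun l m => (coefFn b ρ (σ 0) l * coefFn b ρ (σ 1) m) h *
    (coefFn b ρ l 0 * coefFn b ρ m 1) h')]
  · refine Finset.sum_congr rfl fun τ _ => ?_
    have h1 := hu.mul_eq_permIdem (σ * τ⁻¹) (τ.injective.ne (show (0 : Fin 3) ≠ 1 by decide))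
    rw [← h1]
    simp [permIdem]
  · intro l
    rw [hu.col_mul, if_neg (σ.injective.ne (by decide))]
    exact zero_mul _

theorem permIdem_coefFn_one (σ : Equiv.Perm (Fin 3)) : 𝓭 σ 1 = if σ = 1 then 1 else 0 := by
  rw [permIdem, convDual_mul_one, coefFn_one, coefFn_one]
  have : σ = 1 ↔ σ 0 = 0 ∧ σ 1 = 1 := by decide +revert
  simp only [this, ite_and]
  split_ifs <;> simp

theorem permIdem_comp_antipode [Coalgebra k C] (hb : ∀ i, IsGroupLikeElem k (b i))
    {π : H →ₗc[k] C} (hπ : Function.Surjective π)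
    (hρ : ∀ a h, ρ a (π h) = π (a * h)) (hS : ∀ x : H, antipode k (antipode k x) = x)
    (σ : Equiv.Perm (Fin 3)) : toConv ((𝓭 σ).ofConv ∘ₗ 𝓢) = 𝓭 σ⁻¹ := by
  have hu := isMagicUnitary_coefFn hb hπ hρ hS
  rw [permIdem, ← convDual_comp_antipode, coefFn_comp_antipode hb hπ hρ hS,
    coefFn_comp_antipode hb hπ hρ hS,
    ← hu.mul_eq_permIdem σ⁻¹ (σ.injective.ne (show (1 : Fin 3) ≠ 0 by decide))]
  simp

/-- The map `h ↦ ∑ d_σ(h) σ`, for a family `d` of functionals indexed by a group. -/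
def groupAlgMap {G : Type*} [Fintype G] (d : G → ConvDual k H) :
    H →ₗ[k] MonoidAlgebra k G :=
  ∑ σ, MonoidAlgebra.lsingle σ ∘ₗ (d σ).ofConv

theorem groupAlgMap_apply {G : Type*} [Fintype G] (d : G → ConvDual k H) (h : H) :
    groupAlgMap d h = ∑ σ, MonoidAlgebra.single σ (d σ h) := by
  simp [groupAlgMap]

theorem groupAlgMap_apply_coeff {G : Type*} [Fintype G] (d : G → ConvDual k H) (h : H)
    (σ : G) : (groupAlgMap d h).coeff σ = d σ h := by
  classical
  rw [groupAlgMap_apply]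
  simp [Finsupp.single_apply]

/-- A family of functionals indexed by a group, multiplicative in the appropriate sense, gives an
algebra map to the group algebra. -/
def groupAlgHom {G : Type*} [Group G] [Fintype G] [DecidableEq G] (d : G → ConvDual k H)
    (hd1 : ∀ σ, d σ 1 = if σ = 1 then 1 else 0)
    (hd : ∀ σ h h', d σ (h * h') = ∑ τ, d (σ * τ⁻¹) h * d τ h') :
    H →ₐ[k] MonoidAlgebra k G :=
  AlgHom.ofLinearMap (groupAlgMap d)
    (by
      rw [groupAlgMap_apply, Finset.sum_eq_single 1]
      · rw [hd1, if_pos rfl]; rfl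
      · intro σ _ hσ; rw [hd1, if_neg hσ, MonoidAlgebra.single_zero]
      · simp)
    (fun h h' => by
      rw [groupAlgMap_apply, groupAlgMap_apply, groupAlgMap_apply, Finset.sum_mul_sum,
        Finset.sum_comm]
      simp only [hd, ← MonoidAlgebra.lsingle_apply (R := k), map_sum]
      rw [Finset.sum_comm]
      refine Finset.sum_congr rfl fun τ _ => ?_
      refine Fintype.sum_equiv (Equiv.mulRight τ⁻¹) _ _ fun σ => ?_
      simp)

theorem groupAlgHom_apply {G : Type*} [Group G] [Fintype G] [DecidableEq G] {d : G → ConvDual k H}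
    (hd1 : ∀ σ, d σ 1 = if σ = 1 then 1 else 0)
    (hd : ∀ σ h h', d σ (h * h') = ∑ τ, d (σ * τ⁻¹) h * d τ h') (h : H) :
    groupAlgHom d hd1 hd h = ∑ σ, MonoidAlgebra.single σ (d σ h) := groupAlgMap_apply d h

/-- If moreover the functionals form a complete family of orthogonal idempotents, the map to the
group algebra is a map of bialgebras. -/
def groupBialgHom {G : Type*} [Group G] [Fintype G] [DecidableEq G] (d : G → ConvDual k H)
    (hd1 : ∀ σ, d σ 1 = if σ = 1 then 1 else 0)
    (hd : ∀ σ h h', d σ (h * h') = ∑ τ, d (σ * τ⁻¹) h * d τ h')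
    (hdd : ∀ σ τ, d σ * d τ = if σ = τ then d σ else 0) (hds : ∑ σ, d σ = 1) :
    H →ₐc[k] MonoidAlgebra k G :=
  BialgHom.ofAlgHom (groupAlgHom d hd1 hd)
    (by
      ext h
      have := WithConv.congr_fun hds h
      change counit (groupAlgHom d hd1 hd h) = counit h
      rw [groupAlgHom_apply, map_sum]
      simp only [MonoidAlgebra.counit_single]
      simpa using this)
    (by
      apply AlgHom.toLinearMap_injective
      ext h
      change TensorProduct.map (groupAlgMap d) (groupAlgMap d) (comul h) =
        comul (groupAlgMap d h)
      rw [groupAlgMap_apply, map_sum, ← (ℛ k h).eq, map_sum]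
      simp only [TensorProduct.map_tmul, groupAlgMap_apply, MonoidAlgebra.comul_single,
        TensorProduct.sum_tmul, TensorProduct.tmul_sum]
      -- Keeping the tensors of group elements opaque reduces the comparison to scalar coefficients.
      obtain ⟨E, h1⟩ : ∃ E : G → G → MonoidAlgebra k G ⊗[k] MonoidAlgebra k G,
          ∀ (σ τ : G) (x y : k), MonoidAlgebra.single σ x ⊗ₜ[k] MonoidAlgebra.single τ y =
          (x * y) • E σ τ := by
        refine ⟨fun σ τ => MonoidAlgebra.single σ 1 ⊗ₜ[k] MonoidAlgebra.single τ 1,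
          fun σ τ x y => ?_⟩
        rw [← mul_one x, ← mul_one y, ← smul_eq_mul, ← smul_eq_mul, ← MonoidAlgebra.smul_single,
          ← MonoidAlgebra.smul_single, TensorProduct.smul_tmul_smul]
        simp
      have h2 : ∀ (σ : G) (x : k), TensorProduct.map (MonoidAlgebra.lsingle (R := k) (S := k) σ)
          (MonoidAlgebra.lsingle (R := k) (S := k) σ) (comul x) =
          x • E σ σ := by
        intro σ x
        rw [CommSemiring.comul_apply]
        simp only [TensorProduct.map_tmul, MonoidAlgebra.lsingle_apply]
        rw [h1, one_mul]
      have h3 : ∀ σ τ, ∑ i ∈ (ℛ k h).index, d σ ((ℛ k h).left i) * d τ ((ℛ k h).right i) =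
          if σ = τ then d σ h else 0 := by
        intro σ τ
        rw [← (ℛ k h).convMul_apply, hdd]
        split_ifs <;> rfl
      simp only [h1, h2]
      rw [Finset.sum_comm]
      refine Finset.sum_congr rfl fun σ _ => ?_
      rw [Finset.sum_comm]
      simp only [← Finset.sum_smul, h3]
      simp)

end

/-! ### Surjectivity of the map to the group algebra of `S₃` -/

section

variable {k H : Type*} [Field k] [Ring H] [HopfAlgebra k H]

/-- Hitting by the idempotent d_σ kills all components other than σ. -/
theorem exists_groupAlgMap_eq_single {G : Type*} [Fintype G] [DecidableEq G] {d : G → ConvDual k H}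
    (hdd : ∀ σ τ, d σ * d τ = if σ = τ then d σ else 0) {σ : G} (hσ : d σ ≠ 0) :
    ∃ h, groupAlgMap d h = MonoidAlgebra.single σ 1 := by
  obtain ⟨h, hh⟩ : ∃ h, d σ h ≠ 0 := by
    by_contra! h0
    apply hσ
    ext h
    exact h0 h
  refine ⟨(d σ h)⁻¹ • leftHit (d σ) h, ?_⟩
  rw [map_smul, groupAlgMap_apply, Finset.sum_eq_single σ]
  · rw [apply_leftHit, hdd, if_pos rfl, MonoidAlgebra.smul_single, smul_eq_mul, inv_mul_cancel₀ hh]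
  · intro τ _ hτ
    rw [apply_leftHit, hdd, if_neg hτ.symm]
    exact MonoidAlgebra.single_zero _
  · simp

theorem groupAlgMap_surjective {G : Type*} [Fintype G] [DecidableEq G] {d : G → ConvDual k H}
    (hdd : ∀ σ τ, d σ * d τ = if σ = τ then d σ else 0) (hd0 : ∀ σ, d σ ≠ 0) :
    Function.Surjective (groupAlgMap d) := by
  choose f hf using fun σ => exists_groupAlgMap_eq_single hdd (hd0 σ)
  intro y
  induction y using MonoidAlgebra.induction_linear with
  | zero => exact ⟨0, map_zero _⟩
  | add x y hx hy =>
    obtain ⟨x, rfl⟩ := hx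
    obtain ⟨y, rfl⟩ := hy
    exact ⟨x + y, map_add _ _ _⟩
  | single σ c => exact ⟨c • f σ, by rw [map_smul, hf]; simp⟩

variable {C : Type*} [AddCommGroup C] [Module k C]
  {b : Module.Basis (Fin 3) k C} {ρ : H →ₐ[k] Module.End k C}

local notation "𝓭" => permIdem (coefFn b ρ)

theorem action_eq_sum_permIdem (hu : IsMagicUnitary (coefFn b ρ)) (h : H) (j : Fin 3) :
    ρ h (b j) = ∑ σ, 𝓭 σ h • b (σ j) := by
  rw [action_eq_sum_coefFn]
  simp_rw [hu.eq_sum_permIdem _ j, WithConv.ofConv_sum, LinearMap.sum_apply, Finset.sum_smul]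
  rw [Finset.sum_comm]
  refine Finset.sum_congr rfl fun σ _ => ?_
  rw [Finset.sum_eq_single (σ j)]
  · rw [if_pos rfl]
  · intro i _ hi
    rw [if_neg hi]
    exact zero_smul _ _
  · simp

/-- The image of H in kS₃ is a subalgebra containing σ whenever d_σ ≠ 0. If two such permutations
failed to commute they would generate S₃, and the image would contain ω, where d_ω has to be
nonzero. So only commuting permutations contribute to the action. -/
theorem action_commute_of_permIdem_eq_zero (hu : IsMagicUnitary (coefFn b ρ))
    {ω : Equiv.Perm (Fin 3)} (hω : 𝓭 ω = 0) (g h : H) : ρ g * ρ h = ρ h * ρ g := by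
  set φ := groupAlgHom 𝓭 permIdem_coefFn_one (permIdem_coefFn_mul hu)
  have hcomm : ∀ σ τ, 𝓭 σ ≠ 0 → 𝓭 τ ≠ 0 → σ * τ = τ * σ := by
    intro σ τ hσ hτ
    by_contra hne
    have hmul : ∀ {α β}, MonoidAlgebra.single α (1 : k) ∈ φ.range →
        MonoidAlgebra.single β (1 : k) ∈ φ.range → MonoidAlgebra.single (α * β) (1 : k) ∈ φ.range := by
      intro α β hα hβ
      have := mul_mem hα hβ
      rwa [MonoidAlgebra.single_mul_single, one_mul] at this
    have h1 : MonoidAlgebra.single σ (1 : k) ∈ φ.range :=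
      exists_groupAlgMap_eq_single hu.permIdem_mul hσ
    have h2 : MonoidAlgebra.single τ (1 : k) ∈ φ.range :=
      exists_groupAlgMap_eq_single hu.permIdem_mul hτ
    have h3 : MonoidAlgebra.single ω (1 : k) ∈ φ.range := by
      rcases Equiv.Perm.fin_three_generated σ τ ω hne with
        rfl | rfl | rfl | rfl | rfl | rfl | rfl | rfl
      · exact one_mem φ.range
      · exact h1
      · exact h2
      · exact hmul h1 h2
      · exact hmul h2 h1
      · exact hmul (hmul h1 h2) h1
      · exact hmul h1 h1
      · exact hmul h2 h2
    obtain ⟨x, hx⟩ := h3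
    have h4 := groupAlgMap_apply_coeff 𝓭 x ω
    rw [show groupAlgMap 𝓭 x = _ from hx, hω] at h4
    simp at h4
  have hexp : ∀ x y : H, ∀ j, (ρ x * ρ y) (b j) = ∑ σ, ∑ τ, (𝓭 σ x * 𝓭 τ y) • b ((σ * τ) j) := by
    intro x y j
    rw [Module.End.mul_apply, action_eq_sum_permIdem hu y, map_sum, Finset.sum_comm]
    refine Finset.sum_congr rfl fun τ _ => ?_
    rw [map_smul, action_eq_sum_permIdem hu x, Finset.smul_sum]
    refine Finset.sum_congr rfl fun σ _ => ?_
    rw [smul_smul, mul_comm]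
    rfl
  refine b.ext fun j => ?_
  rw [hexp, hexp, Finset.sum_comm]
  refine Finset.sum_congr rfl fun τ _ => Finset.sum_congr rfl fun σ _ => ?_
  by_cases hσ : 𝓭 σ = 0
  · rw [hσ]; simp
  by_cases hτ : 𝓭 τ = 0
  · rw [hτ]; simp
  rw [hcomm σ τ hσ hτ, mul_comm]

namespace HopfSubalgebra

/-- If some idempotent vanished, e and x would commute on the class of 1. This means ex − xe ∈ HA⁺,
that is, exe = xe. -/
theorem IsIntegral.permIdem_ne_zero {A : HopfSubalgebra k H} {e : H} (he : A.IsIntegral e)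
    (hcen : ¬ ∀ x, e * x * e = x * e) {b : Module.Basis (Fin 3) k (H ⧸ A.leftAugIdeal)}
    (hu : IsMagicUnitary (coefFn b A.action)) (σ : Equiv.Perm (Fin 3)) :
    permIdem (coefFn b A.action) σ ≠ 0 := by
  intro h0
  apply hcen
  intro x
  have h1 := LinearMap.congr_fun (action_commute_of_permIdem_eq_zero hu h0 e x) (A.leftAugIdeal.mkQ 1)
  have h2 : A.leftAugIdeal.mkQ (e * (x * 1)) = A.leftAugIdeal.mkQ (x * (e * 1)) := h1
  have h3 : e * (x * 1) - x * (e * 1) ∈ A.leftAugIdeal := by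
    rw [← Submodule.Quotient.mk_eq_zero]
    exact (map_sub A.leftAugIdeal.mkQ _ _).trans (sub_eq_zero.2 h2)
  rw [he.mem_leftAugIdeal, sub_mul, mul_one, mul_one, sub_eq_zero, mul_assoc x e e,
    he.mul_self] at h3
  exact h3

end HopfSubalgebra

end

/-! ### One-dimensional representations -/

section

variable {k H : Type*} [Field k] [Ring H] [HopfAlgebra k H]

local notation "𝓢" => antipode k (A := H)

variable (k H) in
/-- The one-dimensional representations of `H`, under convolution. -/
def charSubmonoid : Submonoid (ConvDual k H) where
  carrier := {x | x 1 = 1 ∧ ∀ a b, x (a * b) = x a * x b}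
  one_mem' := ⟨Bialgebra.counit_one, Bialgebra.counit_mul⟩
  mul_mem' := by
    rintro x y ⟨hx1, hx⟩ ⟨hy1, hy⟩
    refine ⟨by rw [convDual_mul_one, hx1, hy1, one_mul], fun a b => ?_⟩
    have := convMul_apply_mul_eq_sum (κ := Unit) (κ' := Unit) (f := x) (g := y)
      (f₁ := fun _ => x) (f₂ := fun _ => x) (g₁ := fun _ => y) (g₂ := fun _ => y)
      (by simpa using hx) (by simpa using hy) a b
    simpa using this

theorem comp_antipode_mem_charSubmonoid {x : ConvDual k H} (hx : x ∈ charSubmonoid k H) :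
    toConv (x.ofConv ∘ₗ 𝓢) ∈ charSubmonoid k H := by
  refine ⟨?_, fun a b => ?_⟩
  · change x (𝓢 1) = 1
    rw [antipode_one, hx.1]
  · change x (𝓢 (a * b)) = x (𝓢 a) * x (𝓢 b)
    rw [antipode_mul_antidistrib, hx.2, mul_comm]

/-- A one-dimensional representation as an algebra homomorphism. -/
def charAlgHom {x : ConvDual k H} (hx : x ∈ charSubmonoid k H) : H →ₐ[k] k :=
  AlgHom.ofLinearMap x.ofConv hx.1 hx.2

theorem comp_antipode_mul_char {x : ConvDual k H} (hx : x ∈ charSubmonoid k H) :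
    toConv (x.ofConv ∘ₗ 𝓢) * x = 1 :=
  algHom_antipode_convMul (charAlgHom hx)

instance : Group (charSubmonoid k H) where
  inv x := ⟨_, comp_antipode_mem_charSubmonoid x.2⟩
  inv_mul_cancel x := Subtype.ext (comp_antipode_mul_char x.2)

theorem coe_inv_charSubmonoid (x : charSubmonoid k H) :
    ((x⁻¹ : charSubmonoid k H) : ConvDual k H) = toConv ((x : ConvDual k H).ofConv ∘ₗ 𝓢) := rfl

theorem char_mul_inv (x : charSubmonoid k H) :
    (x : ConvDual k H) * ((x⁻¹ : charSubmonoid k H) : ConvDual k H) = 1 :=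
  congrArg Subtype.val (mul_inv_cancel x)

theorem char_inv_mul (x : charSubmonoid k H) :
    ((x⁻¹ : charSubmonoid k H) : ConvDual k H) * (x : ConvDual k H) = 1 :=
  congrArg Subtype.val (inv_mul_cancel x)

/-- The coinner automorphism `h ↦ x(h₁) h₂ x⁻¹(h₃)` of `H`. -/
def coinner (x : charSubmonoid k H) : Module.End k H :=
  leftHit (x : ConvDual k H) * rightHit ((x⁻¹ : charSubmonoid k H) : ConvDual k H)

theorem apply_coinner (x : charSubmonoid k H) (f : ConvDual k H) (h : H) :
    f (coinner x h) = ((x : ConvDual k H) * f * ((x⁻¹ : charSubmonoid k H) : ConvDual k H)) h := by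
  rw [coinner, Module.End.mul_apply, apply_leftHit, apply_rightHit]

theorem leftHit_char_mul {x : ConvDual k H} (hx : x ∈ charSubmonoid k H) (a b : H) :
    leftHit x (a * b) = leftHit x a * leftHit x b := by
  have hab : Coalgebra.comul (R := k) (a * b) = ∑ i ∈ (ℛ k a).index, ∑ j ∈ (ℛ k b).index,
      ((ℛ k a).left i * (ℛ k b).left j) ⊗ₜ[k] ((ℛ k a).right i * (ℛ k b).right j) := by
    rw [Bialgebra.comul_mul, ← (ℛ k a).eq, ← (ℛ k b).eq, Finset.sum_mul_sum]
    simp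
  have h1 : leftHit x (a * b) = (TensorProduct.lid k H).toLinearMap
      (x.ofConv.rTensor H (comul (a * b))) := rfl
  rw [h1, hab, leftHit_repr x (ℛ k a), leftHit_repr x (ℛ k b), Finset.sum_mul_sum]
  simp [hx.2, smul_smul, mul_comm]

theorem rightHit_char_mul {x : ConvDual k H} (hx : x ∈ charSubmonoid k H) (a b : H) :
    rightHit x (a * b) = rightHit x a * rightHit x b := by
  have hab : Coalgebra.comul (R := k) (a * b) = ∑ i ∈ (ℛ k a).index, ∑ j ∈ (ℛ k b).index,
      ((ℛ k a).left i * (ℛ k b).left j) ⊗ₜ[k] ((ℛ k a).right i * (ℛ k b).right j) := by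
    rw [Bialgebra.comul_mul, ← (ℛ k a).eq, ← (ℛ k b).eq, Finset.sum_mul_sum]
    simp
  rw [rightHit_apply, hab, rightHit_repr x (ℛ k a), rightHit_repr x (ℛ k b), Finset.sum_mul_sum]
  simp [hx.2, smul_smul, mul_comm]

theorem coinner_mul (x : charSubmonoid k H) (a b : H) :
    coinner x (a * b) = coinner x a * coinner x b := by
  simp only [coinner, Module.End.mul_apply]
  rw [rightHit_char_mul (x⁻¹).2, leftHit_char_mul x.2]

theorem counit_coinner (x : charSubmonoid k H) (h : H) :
    counit (R := k) (coinner x h) = counit (R := k) h := by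
  have h1 := apply_coinner x 1 h
  rw [mul_one, char_mul_inv] at h1
  exact h1

theorem coinner_coinner_inv (x : charSubmonoid k H) (h : H) : coinner x (coinner x⁻¹ h) = h := by
  refine convDual_ext k fun f => ?_
  rw [apply_coinner, apply_coinner, inv_inv]
  congr 2
  rw [mul_assoc, mul_assoc, mul_assoc, char_inv_mul, mul_one, ← mul_assoc, char_inv_mul, one_mul]

theorem convMul_coinner (x : charSubmonoid k H) (f g : ConvDual k H) (h : H) :
    (f * g) (coinner x h) = ((toConv (f.ofConv ∘ₗ coinner x) : ConvDual k H) *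
      toConv (g.ofConv ∘ₗ coinner x)) h := by
  have h1 : ∀ f : ConvDual k H, (toConv (f.ofConv ∘ₗ coinner x) : ConvDual k H) =
      (x : ConvDual k H) * f * ((x⁻¹ : charSubmonoid k H) : ConvDual k H) := by
    intro f
    ext h
    exact apply_coinner x f h
  rw [h1, h1, apply_coinner]
  congr 2
  simp only [mul_assoc]
  rw [← mul_assoc _ (x : ConvDual k H), char_inv_mul, one_mul]

/-! ### Coinner automorphisms acting on `H / HA⁺` -/

namespace HopfSubalgebra

variable (A : HopfSubalgebra k H)

theorem leftHit_mem (f : ConvDual k H) {a : H} (ha : a ∈ A.toSubalgebra) :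
    leftHit f a ∈ A.toSubalgebra := by
  obtain ⟨r, hr⟩ := A.exists_repr ha
  rw [leftHit_repr f r]
  exact Subalgebra.sum_mem _ fun i _ => A.toSubalgebra.smul_mem (hr i).2 _

theorem coinner_mem_leftAugIdeal (x : charSubmonoid k H) {h : H} (hh : h ∈ A.leftAugIdeal) :
    coinner x h ∈ A.leftAugIdeal := by
  refine Submodule.span_induction (p := fun h _ => coinner x h ∈ A.leftAugIdeal) ?_ ?_ ?_ ?_
    (show h ∈ Ideal.span _ from hh)
  · rintro a ⟨ha, ha0⟩
    refine Ideal.subset_span ⟨A.leftHit_mem _ (A.rightHit_mem _ ha), ?_⟩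
    rw [counit_coinner, ha0]
  · rw [map_zero]; exact Submodule.zero_mem _
  · intro a b _ _ ha hb
    rw [map_add]; exact Submodule.add_mem _ ha hb
  · intro a b _ hb
    rw [smul_eq_mul, coinner_mul]
    exact A.mul_mem_leftAugIdeal _ hb

/-- The coinner automorphisms permute the group-like basis of `H / HA⁺`. -/
theorem exists_perm_coefFn [FiniteDimensional k H]
    (b : Module.Basis (Fin 3) k (H ⧸ A.leftAugIdeal)) (hb : ∀ i, IsGroupLikeElem k (b i))
    (x : charSubmonoid k H) : ∃ π : Equiv.Perm (Fin 3), ∀ i j,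
      coefFn b A.action i j * (x : ConvDual k H) =
        (x : ConvDual k H) * coefFn b A.action (π i) (π j) := by
  set mkQ : H →ₗc[k] H ⧸ A.leftAugIdeal := Coalgebra.Quotient.mkQCoalgHom A.leftAugIdeal
  set B : charSubmonoid k H → Module.End k (H ⧸ A.leftAugIdeal) := fun x =>
    A.leftAugIdeal.mapQ A.leftAugIdeal (coinner x) fun _ => A.coinner_mem_leftAugIdeal x with hB
  have hBmk : ∀ x h, B x (mkQ h) = mkQ (coinner x h) := fun _ _ => rfl
  have hinj : Function.Injective (B x) := by
    have : ∀ m, B x⁻¹ (B x m) = m := by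
      intro m
      obtain ⟨h, rfl⟩ := A.leftAugIdeal.mkQ_surjective m
      have h1 := coinner_coinner_inv x⁻¹ h
      rw [inv_inv] at h1
      exact congrArg mkQ h1
    exact Function.LeftInverse.injective this
  have hgl : ∀ i, IsGroupLikeElem k (B x (b i)) := by
    intro i
    obtain ⟨h, hh⟩ := A.leftAugIdeal.mkQ_surjective (b i)
    have hh' : mkQ h = b i := hh
    rw [← hh', hBmk]
    refine isGroupLikeElem_of_convMul_apply ?_ fun f g => ?_
    · rw [CoalgHomClass.counit_comp_apply, counit_coinner, ← CoalgHomClass.counit_comp_apply mkQ,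
        hh', (hb i).counit_eq_one]
    · rw [convDual_mul_apply_map, convMul_coinner]
      have h1 := convDual_mul_apply_map mkQ (toConv (f.ofConv ∘ₗ B x)) (toConv (g.ofConv ∘ₗ B x)) h
      rw [hh', (hb i).convMul_apply, ← hh'] at h1
      exact h1.symm
  choose p hp using fun i => b.exists_eq_of_isGroupLikeElem hb (hgl i)
  have hpinj : Function.Injective p := by
    intro i j hij
    apply b.injective
    apply hinj
    rw [← hp, ← hp, hij]
  refine ⟨Equiv.ofBijective p (Finite.injective_iff_bijective.1 hpinj), fun i j => ?_⟩
  -- The coinner automorphism intertwines the action of h with that of its image, so conjugating the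
  -- coefficients by x only relabels the basis.
  have h1 : ∀ h, coefFn b A.action (p i) (p j) (coinner x h) = coefFn b A.action i j h := by
    intro h
    have h2 : A.action (coinner x h) (B x (b j)) = B x (A.action h (b j)) := by
      obtain ⟨y, hy⟩ := A.leftAugIdeal.mkQ_surjective (b j)
      rw [← hy]
      change mkQ (coinner x h * coinner x y) = mkQ (coinner x (h * y))
      rw [coinner_mul]
    rw [coefFn_apply, hp, h2, action_eq_sum_coefFn, map_sum, map_sum]
    simp_rw [map_smul, ← hp]
    rw [Finset.sum_eq_single i]
    · simp
    · intro l _ hl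
      simp [hpinj.ne hl]
    · simp
  have h3 : (x : ConvDual k H) * coefFn b A.action (p i) (p j) *
      ((x⁻¹ : charSubmonoid k H) : ConvDual k H) = coefFn b A.action i j := by
    ext h
    rw [← h1]
    exact (apply_coinner x _ h).symm
  rw [← h3, mul_assoc, char_inv_mul, mul_one]
  rfl

theorem exists_perm_permIdem [FiniteDimensional k H]
    {b : Module.Basis (Fin 3) k (H ⧸ A.leftAugIdeal)} (hb : ∀ i, IsGroupLikeElem k (b i))
    (hu : IsMagicUnitary (coefFn b A.action))
    (x : charSubmonoid k H) : ∃ π : Equiv.Perm (Fin 3), ∀ σ,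
      permIdem (coefFn b A.action) σ * (x : ConvDual k H) =
        (x : ConvDual k H) * permIdem (coefFn b A.action) (π * σ * π⁻¹) := by
  obtain ⟨π, hπ⟩ := A.exists_perm_coefFn b hb x
  refine ⟨π, fun σ => ?_⟩
  rw [permIdem, mul_assoc, hπ, ← mul_assoc, hπ, mul_assoc,
    ← hu.mul_eq_permIdem (π * σ * π⁻¹) (π.injective.ne (show (0 : Fin 3) ≠ 1 by decide))]
  simp

end HopfSubalgebra

end

/-! ### Twists of a map to the group algebra of `S₃` by one-dimensional representations -/

/-- The sign of a permutation, as an element of `k`. -/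
def permSign (k : Type*) [Ring k] {n : ℕ} (σ : Equiv.Perm (Fin n)) : k :=
  ((Equiv.Perm.sign σ : ℤ) : k)

theorem permSign_mul (k : Type*) [Ring k] {n : ℕ} (σ τ : Equiv.Perm (Fin n)) :
    permSign k (σ * τ) = permSign k σ * permSign k τ := by
  simp [permSign]

theorem permSign_mul_self (k : Type*) [Ring k] {n : ℕ} (σ : Equiv.Perm (Fin n)) :
    permSign k σ * permSign k σ = 1 := by
  rcases Int.units_eq_one_or (Equiv.Perm.sign σ) with h | h <;> simp [permSign, h]

theorem permSign_one (k : Type*) [Ring k] {n : ℕ} : permSign k (1 : Equiv.Perm (Fin n)) = 1 := by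
  simp [permSign]

theorem permSign_conj (k : Type*) [CommRing k] {n : ℕ} (π σ : Equiv.Perm (Fin n)) :
    permSign k (π * σ * π⁻¹) = permSign k σ := by
  rw [permSign_mul, mul_comm, ← permSign_mul]
  simp

/-- Transpositions are conjugate involutions, so c takes one value ±1 on all of them, and they
generate. -/
theorem permSign_eq_one_or (k : Type*) [Field k] (c : Equiv.Perm (Fin 3) → k) (h1 : c 1 = 1)
    (hc : ∀ σ τ, c (σ * τ) = c σ * c τ) : (∀ σ, c σ = 1) ∨ ∀ σ, c σ = permSign k σ := by
  set a : Equiv.Perm (Fin 3) := Equiv.swap 0 1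
  set t : Equiv.Perm (Fin 3) := Equiv.swap 0 2
  set u : Equiv.Perm (Fin 3) := Equiv.swap 1 2
  have hall : ∀ σ : Equiv.Perm (Fin 3), σ = 1 ∨ σ = a ∨ σ = t ∨ σ = u ∨ σ = a * t ∨ σ = t * a := by
    decide
  have hsq : c a * c a = 1 := by rw [← hc, ← h1]; congr 1; decide
  have hsq' : c u * c u = 1 := by rw [← hc, ← h1]; congr 1; decide
  have ht : c t = c a := by
    have : t = u * a * u := by decide
    rw [this, hc, hc, mul_right_comm, hsq', one_mul]
  have hu : c u = c a := by
    have : u = t * a * t := by decide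
    rw [this, hc, hc, ht, hsq, one_mul]
  have sa : permSign k a = -1 := by
    simp [permSign, a]
  have st : permSign k t = -1 := by
    simp [permSign, t]
  have su : permSign k u = -1 := by
    simp [permSign, u]
  rcases mul_self_eq_one_iff.1 hsq with h | h
  · left
    intro σ
    rcases hall σ with rfl | rfl | rfl | rfl | rfl | rfl <;> simp [hc, ht, hu, h, h1]
  · right
    intro σ
    rcases hall σ with rfl | rfl | rfl | rfl | rfl | rfl <;>
      simp [hc, ht, hu, h, h1, permSign_mul, sa, st, su, permSign_one]

section

variable {k H : Type*} [Field k] [Ring H] [HopfAlgebra k H]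

local notation "𝓢" => antipode k (A := H)

/-- A family of orthogonal idempotents in the dual, indexed by `S₃`, defining a surjective map of
Hopf algebras to the group algebra of `S₃` and normalized by the one-dimensional representations. -/
structure IsPermFamily (d : Equiv.Perm (Fin 3) → ConvDual k H) : Prop where
  apply_one : ∀ σ, d σ 1 = if σ = 1 then 1 else 0
  apply_mul : ∀ σ h h', d σ (h * h') = ∑ τ, d (σ * τ⁻¹) h * d τ h'
  mul : ∀ σ τ, d σ * d τ = if σ = τ then d σ else 0
  sum : ∑ σ, d σ = 1
  comp_antipode : ∀ σ, toConv ((d σ).ofConv ∘ₗ 𝓢) = d σ⁻¹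
  ne_zero : ∀ σ, d σ ≠ 0
  conj : ∀ x : charSubmonoid k H, ∃ π : Equiv.Perm (Fin 3), ∀ σ,
    d σ * (x : ConvDual k H) = (x : ConvDual k H) * d (π * σ * π⁻¹)

/-- The sign representation. -/
def signFn (d : Equiv.Perm (Fin 3) → ConvDual k H) : ConvDual k H := ∑ σ, permSign k σ • d σ

theorem signFn_apply (d : Equiv.Perm (Fin 3) → ConvDual k H) (h : H) :
    signFn d h = ∑ σ, permSign k σ * d σ h := by
  simp [signFn]

namespace IsPermFamily

variable {d : Equiv.Perm (Fin 3) → ConvDual k H} (hd : IsPermFamily d)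

include hd

theorem signFn_mem : signFn d ∈ charSubmonoid k H := by
  refine ⟨?_, fun a b => ?_⟩
  · rw [signFn_apply, Finset.sum_eq_single 1]
    · rw [hd.apply_one, if_pos rfl, permSign_one, one_mul]
    · intro σ _ hσ; rw [hd.apply_one, if_neg hσ, mul_zero]
    · simp
  · simp only [signFn_apply, hd.apply_mul]
    rw [Finset.sum_mul_sum]
    simp only [Finset.mul_sum]
    rw [Finset.sum_comm]
    conv_rhs => rw [Finset.sum_comm]
    refine Finset.sum_congr rfl fun τ _ => ?_
    refine Fintype.sum_equiv (Equiv.mulRight τ⁻¹) _ _ fun σ => ?_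
    rw [Equiv.coe_mulRight]
    have : permSign k σ = permSign k (σ * τ⁻¹) * permSign k τ := by
      rw [← permSign_mul, inv_mul_cancel_right]
    rw [this]
    ring

theorem mul_signFn (σ : Equiv.Perm (Fin 3)) : d σ * signFn d = permSign k σ • d σ := by
  rw [signFn, Finset.mul_sum, Finset.sum_eq_single σ]
  · rw [mul_smul_comm, hd.mul, if_pos rfl]
  · intro τ _ hτ; rw [mul_smul_comm, hd.mul, if_neg hτ.symm, smul_zero]
  · simp

theorem signFn_mul_self : signFn d * signFn d = 1 := by
  conv_lhs => enter [1]; rw [signFn]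
  rw [Finset.sum_mul, ← hd.sum]
  refine Finset.sum_congr rfl fun σ _ => ?_
  rw [smul_mul_assoc, hd.mul_signFn, smul_smul, permSign_mul_self, one_smul]

theorem signFn_ne_one [CharZero k] : signFn d ≠ 1 := by
  intro h
  have h1 := hd.mul_signFn (Equiv.swap 0 1)
  rw [h, mul_one] at h1
  have h2 : permSign k (Equiv.swap (0 : Fin 3) 1) = -1 := by
    simp [permSign]
  rw [h2, neg_one_smul, eq_neg_iff_add_eq_zero, ← two_smul k] at h1
  exact hd.ne_zero _ ((smul_eq_zero.1 h1).resolve_left two_ne_zero)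

/-- Conjugation by x permutes the d_σ within conjugacy classes, and the sign is a class function. -/
theorem signFn_mul_comm (x : charSubmonoid k H) :
    signFn d * (x : ConvDual k H) = (x : ConvDual k H) * signFn d := by
  obtain ⟨π, hπ⟩ := hd.conj x
  simp only [signFn, Finset.sum_mul, Finset.mul_sum, smul_mul_assoc, mul_smul_comm, hπ]
  refine Fintype.sum_equiv (MulAut.conj π).toEquiv _ _ fun σ => ?_
  change _ = permSign k (π * σ * π⁻¹) • ((x : ConvDual k H) * d (π * σ * π⁻¹))
  rw [permSign_conj]

theorem mul_char_apply_one (x : charSubmonoid k H) (σ : Equiv.Perm (Fin 3)) :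
    (d σ * (x : ConvDual k H)) 1 = if σ = 1 then 1 else 0 := by
  rw [convDual_mul_one, x.2.1, mul_one, hd.apply_one]

theorem mul_char_apply_mul (x : charSubmonoid k H) (σ : Equiv.Perm (Fin 3)) (h h' : H) :
    (d σ * (x : ConvDual k H)) (h * h') =
      ∑ τ, (d (σ * τ⁻¹) * (x : ConvDual k H)) h * (d τ * (x : ConvDual k H)) h' := by
  have := convMul_apply_mul_eq_sum (κ' := Unit) (hd.apply_mul σ)
    (g := (x : ConvDual k H)) (g₁ := fun _ => x) (g₂ := fun _ => x) (by simpa using x.2.2) h h'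
  simpa using this

/-- A preimage of ω under the untwisted map is corrected by the hit with x⁻¹, which undoes the
twist. -/
theorem exists_mul_char_apply_eq (x : charSubmonoid k H) (ω : Equiv.Perm (Fin 3)) :
    ∃ h, ∀ σ, (d σ * (x : ConvDual k H)) h = if σ = ω then 1 else 0 := by
  obtain ⟨h, hh⟩ := exists_groupAlgMap_eq_single hd.mul (hd.ne_zero ω)
  refine ⟨rightHit ((x⁻¹ : charSubmonoid k H) : ConvDual k H) h, fun σ => ?_⟩
  rw [apply_rightHit, mul_assoc, char_mul_inv, mul_one, ← groupAlgMap_apply_coeff d h σ, hh]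
  simp [Finsupp.single_apply, eq_comm]

variable {Λ : H} (hΛ : IsNormalizedIntegral k Λ)

include hΛ

/-- Multiplying Λ by a preimage of ω shows that its image in kS₃ is invariant under translation; the
six equal coefficients sum to ε(Λ) = 1. -/
theorem apply_integral [CharZero k] (σ : Equiv.Perm (Fin 3)) : d σ Λ = 6⁻¹ := by
  have h1 : ∀ ω, d ω Λ = d 1 Λ := by
    intro ω
    obtain ⟨h, hh⟩ := hd.exists_mul_char_apply_eq 1 ω
    simp only [OneMemClass.coe_one, mul_one] at hh
    have hε : counit (R := k) h = 1 := by
      have := WithConv.congr_fun (hd.sum) h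
      simp only [WithConv.ofConv_sum, LinearMap.sum_apply, hh] at this
      simpa using this.symm
    have h2 := hd.apply_mul ω h Λ
    rw [hΛ.mul_left, hε, one_smul, Finset.sum_eq_single 1] at h2
    · rw [h2, hh, inv_one, mul_one, if_pos rfl, one_mul]
    · intro τ _ hτ
      rw [hh, if_neg (by simpa using hτ), zero_mul]
    · simp
  have h2 := WithConv.congr_fun (hd.sum) Λ
  have h3 : (1 : ConvDual k H) Λ = 1 := hΛ.counit_eq
  simp only [WithConv.ofConv_sum, LinearMap.sum_apply] at h2
  rw [Finset.sum_congr rfl fun ω _ => h1 ω, Finset.sum_const, h3, Finset.card_univ,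
    Fintype.card_perm, Fintype.card_fin] at h2
  rw [h1]
  have h4 : (6 : k) * d 1 Λ = 1 := by
    have : Nat.factorial 3 = 6 := rfl
    rw [this] at h2
    simpa using h2
  exact eq_inv_of_mul_eq_one_right h4

/-- The image of Λ under the twisted map spans an invariant line of the regular representation of S₃
if it is nonzero. The character c of that line is trivial or the sign, and comparing with hΛ = ε(h)Λ
gives (Σ c(τ) d_τ) z = 1, so z is 1 or the sign representation. -/
theorem mul_char_apply_integral (z : charSubmonoid k H) (hz1 : (z : ConvDual k H) ≠ 1)
    (hzs : (z : ConvDual k H) ≠ signFn d) (σ : Equiv.Perm (Fin 3)) :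
    (d σ * (z : ConvDual k H)) Λ = 0 := by
  set T : Equiv.Perm (Fin 3) → k := fun σ => (d σ * (z : ConvDual k H)) Λ with hT
  choose h hh using hd.exists_mul_char_apply_eq z
  -- Expand T-values of h ω · Λ, where h ω is sent to ω by the twisted map: only τ = ω⁻¹σ survives.
  have h1 : ∀ ω σ, T (ω⁻¹ * σ) = counit (R := k) (h ω) * T σ := by
    intro ω σ
    have h2 := hd.mul_char_apply_mul z σ (h ω) Λ
    rw [hΛ.mul_left, map_smul, smul_eq_mul] at h2
    rw [hT]
    simp only
    rw [h2, Finset.sum_eq_single (ω⁻¹ * σ)]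
    · rw [hh, if_pos (by simp), one_mul]
    · intro τ _ hτ
      rw [hh, if_neg, zero_mul]
      rintro rfl
      exact hτ (by simp)
    · simp
  change T σ = 0
  by_contra hσ
  have hT1 : T 1 ≠ 0 := by
    intro h0
    have h2 := h1 σ σ
    rw [inv_mul_cancel, h0] at h2
    have h3 := h1 σ⁻¹ 1
    rw [h0, mul_zero, inv_inv, mul_one] at h3
    exact hσ h3
  set c : Equiv.Perm (Fin 3) → k := fun ω => counit (R := k) (h ω) with hc
  have hcT : ∀ ω, T ω⁻¹ = c ω * T 1 := by
    intro ω
    have := h1 ω 1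
    rwa [mul_one] at this
  have hc1 : c 1 = 1 := by
    have := hcT 1
    rw [inv_one] at this
    exact (mul_left_eq_self₀.1 this.symm).resolve_right hT1
  have hcm : ∀ σ τ, c (σ * τ) = c σ * c τ := by
    intro σ τ
    have h2 := hcT (σ * τ)
    rw [mul_inv_rev, h1, hcT] at h2
    apply mul_right_cancel₀ hT1
    rw [← h2, hc]
    ring
  have hkey : (∑ τ, c τ • d τ) * (z : ConvDual k H) = 1 := by
    ext x
    have h2 := hd.mul_char_apply_mul z 1 x Λ
    rw [hΛ.mul_left, map_smul, smul_eq_mul] at h2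
    have h3 : ∀ τ, (d (1 * τ⁻¹) * (z : ConvDual k H)) x * (d τ * (z : ConvDual k H)) Λ =
        (c τ⁻¹ * (d τ⁻¹ * (z : ConvDual k H)) x) * T 1 := by
      intro τ
      have h4 := hcT τ⁻¹
      rw [inv_inv] at h4
      rw [one_mul]
      change _ * T τ = _
      rw [h4]
      ring
    rw [Finset.sum_congr rfl fun τ _ => h3 τ, ← Finset.sum_mul] at h2
    have h5 := mul_right_cancel₀ hT1 h2
    change _ = counit (R := k) x
    rw [h5, Finset.sum_mul]
    simp only [WithConv.ofConv_sum, LinearMap.sum_apply, smul_mul_assoc]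
    refine Fintype.sum_equiv (Equiv.inv _) _ _ fun τ => ?_
    simp
  rcases permSign_eq_one_or k c hc1 hcm with h2 | h2
  · simp only [h2, one_smul] at hkey
    rw [hd.sum, one_mul] at hkey
    exact hz1 hkey
  · simp only [h2] at hkey
    apply hzs
    have : signFn d * (z : ConvDual k H) = 1 := hkey
    rw [← one_mul (z : ConvDual k H), ← hd.signFn_mul_self, mul_assoc, this, mul_one]

end IsPermFamily

end

/-! ### Counting one-dimensional representations -/

section

variable {k H : Type*} [Field k] [Ring H] [HopfAlgebra k H] [FiniteDimensional k H]

theorem mem_charSubmonoid_iff_isGroupLikeElem {x : ConvDual k H} :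
    x ∈ charSubmonoid k H ↔ IsGroupLikeElem k (A := Module.Dual k H) x.ofConv := by
  constructor
  · rintro ⟨h1, h2⟩
    refine ⟨h1, (TensorProduct.dualDistribEquiv k H H).injective ?_⟩
    refine TensorProduct.ext' fun a b => ?_
    refine (dual_comul_apply x.ofConv a b).trans ((h2 a b).trans ?_)
    exact (TensorProduct.dualDistrib_apply x.ofConv x.ofConv a b).symm
  · rintro ⟨h1, h2⟩
    refine ⟨h1, fun a b => ?_⟩
    refine (dual_comul_apply x.ofConv a b).symm.trans ?_
    rw [h2]
    exact TensorProduct.dualDistrib_apply x.ofConv x.ofConv a b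

/-- One-dimensional representations are the group-like elements of the dual. -/
def charEquivGroupLike : charSubmonoid k H ≃ GroupLike k (Module.Dual k H) where
  toFun x := ⟨(x : ConvDual k H).ofConv, mem_charSubmonoid_iff_isGroupLikeElem.1 x.2⟩
  invFun f := ⟨toConv f.val, mem_charSubmonoid_iff_isGroupLikeElem.2 f.isGroupLikeElem_val⟩
  left_inv _ := rfl
  right_inv _ := rfl

instance : Finite (charSubmonoid k H) :=
  have : Finite (GroupLike k (Module.Dual k H)) :=
    (linearIndep_groupLikeVal (R := k) (A := Module.Dual k H)).finite
  Finite.of_equiv _ charEquivGroupLike.symm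

namespace IsPermFamily

variable {d : Equiv.Perm (Fin 3) → ConvDual k H} (hd : IsPermFamily d)

include hd

omit [FiniteDimensional k H] in
theorem char_mul (x : charSubmonoid k H) (σ : Equiv.Perm (Fin 3)) :
    ∃ τ, (x : ConvDual k H) * d σ = d τ * (x : ConvDual k H) := by
  obtain ⟨π, hπ⟩ := hd.conj x
  exact ⟨π⁻¹ * σ * π, by rw [hπ]; congr 2; group⟩

omit [FiniteDimensional k H] in
theorem char_mul_one (x : charSubmonoid k H) :
    (x : ConvDual k H) * d 1 = d 1 * (x : ConvDual k H) := by
  obtain ⟨π, hπ⟩ := hd.conj x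
  rw [hπ]
  simp

/-- The sign representation as an element of the group of one-dimensional representations. -/
def signChar : charSubmonoid k H := ⟨signFn d, hd.signFn_mem⟩

omit [FiniteDimensional k H] in
theorem orderOf_signChar [CharZero k] : orderOf hd.signChar = 2 := by
  refine orderOf_eq_prime ?_ fun h => hd.signFn_ne_one (congrArg Subtype.val h)
  rw [sq]
  exact Subtype.ext hd.signFn_mul_self

omit [FiniteDimensional k H] in
theorem mem_zpowers_signChar [CharZero k] {z : charSubmonoid k H}
    (hz : z ∈ Subgroup.zpowers hd.signChar) : z = 1 ∨ z = hd.signChar := by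
  obtain ⟨n, rfl⟩ := Subgroup.mem_zpowers_iff.1 hz
  have h2 : hd.signChar ^ (2 : ℤ) = 1 := by
    rw [← orderOf_dvd_iff_zpow_eq_one, hd.orderOf_signChar]
    rfl
  rcases Int.even_or_odd' n with ⟨m, rfl | rfl⟩
  · left; rw [zpow_mul, h2, one_zpow]
  · right; rw [zpow_add, zpow_mul, h2, one_zpow, one_mul, zpow_one]

omit [FiniteDimensional k H] in
theorem card_quotient_signChar [CharZero k] :
    Nat.card (charSubmonoid k H) =
      Nat.card (charSubmonoid k H ⧸ Subgroup.zpowers hd.signChar) * 2 := by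
  rw [Subgroup.card_eq_card_quotient_mul_card_subgroup (Subgroup.zpowers hd.signChar),
    Nat.card_zpowers, hd.orderOf_signChar]

variable {Λ : H} (hΛ : IsNormalizedIntegral k Λ)

include hΛ

omit [FiniteDimensional k H] in
-- Evaluation at Λ pairs x⁻¹ d_τ with d_σ y to 1/6 when the indices agree and to 0 otherwise, since
-- x⁻¹y is outside {1, sign} for representatives of distinct cosets.
theorem linearIndependent_mul_char [CharZero k] :
    LinearIndependent k fun i : (charSubmonoid k H ⧸ Subgroup.zpowers hd.signChar) ×
      Equiv.Perm (Fin 3) => d i.2 * ((Quotient.out i.1 : charSubmonoid k H) : ConvDual k H) := by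
  rw [linearIndependent_iff']
  rintro S g hg ⟨q, τ⟩ hi
  have hpair : ∀ i : (charSubmonoid k H ⧸ Subgroup.zpowers hd.signChar) × Equiv.Perm (Fin 3),
      (((((Quotient.out q)⁻¹ : charSubmonoid k H) : ConvDual k H) * d τ) *
        (d i.2 * ((Quotient.out i.1 : charSubmonoid k H) : ConvDual k H))) Λ =
      if i = (q, τ) then 6⁻¹ else 0 := by
    rintro ⟨q', σ⟩
    obtain ⟨τ', hτ'⟩ := hd.char_mul (Quotient.out q)⁻¹ τ
    rw [mul_assoc, ← mul_assoc (d τ), hd.mul]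
    by_cases hστ : τ = σ
    · subst hστ
      rw [if_pos rfl, ← mul_assoc, hτ', mul_assoc, ← Submonoid.coe_mul]
      by_cases hq : q' = q
      · subst hq
        rw [inv_mul_cancel, OneMemClass.coe_one, mul_one, hd.apply_integral hΛ, if_pos rfl]
      · rw [if_neg (by simpa using hq)]
        have hz : (Quotient.out q)⁻¹ * Quotient.out q' ∉ Subgroup.zpowers hd.signChar := by
          rw [← QuotientGroup.eq]
          intro h
          apply hq
          rw [← Quotient.out_eq' q, ← Quotient.out_eq' q']
          exact h.symm
        refine hd.mul_char_apply_integral hΛ _ (fun h => hz ?_) (fun h => hz ?_) _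
        · rw [show (Quotient.out q)⁻¹ * Quotient.out q' = 1 from Subtype.ext h]
          exact one_mem _
        · rw [show (Quotient.out q)⁻¹ * Quotient.out q' = hd.signChar from Subtype.ext h]
          exact Subgroup.mem_zpowers _
    · rw [if_neg hστ, zero_mul, mul_zero, if_neg]
      · rfl
      · rintro h
        exact hστ (congrArg Prod.snd h).symm
  have h := WithConv.congr_fun (congrArg ((((Quotient.out q)⁻¹ : charSubmonoid k H) : ConvDual k H) * d τ * ·) hg) Λ
  simp only [Finset.mul_sum, mul_smul_comm, WithConv.ofConv_sum, LinearMap.sum_apply,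
    WithConv.ofConv_smul, LinearMap.smul_apply, hpair, mul_zero] at h
  rw [Finset.sum_eq_single (q, τ)] at h
  · rw [if_pos rfl] at h
    exact (smul_eq_zero.1 (h.trans rfl)).resolve_right (by norm_num)
  · intro i _ hne
    rw [if_neg hne, smul_zero]
  · exact fun h => absurd hi h

/-- F = Σ_x d_1 x satisfies F² = |G| F because d_1 commutes with every x. Only x = 1 and the sign
contribute to F(Λ), giving 1/6 + 1/6. The rank of the idempotent |G|⁻¹F on H is its trace, dim H ·
|G|⁻¹ · 1/3. -/
theorem three_mul_card_dvd [CharZero k] (hS : ∀ x : H, antipode k (antipode k x) = x) :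
    3 * Nat.card (charSubmonoid k H) ∣ Module.finrank k H := by
  classical
  have := Fintype.ofFinite (charSubmonoid k H)
  set N := Nat.card (charSubmonoid k H) with hN
  have hN0 : (N : k) ≠ 0 := Nat.cast_ne_zero.2 Nat.card_pos.ne'
  set F : ConvDual k H := ∑ x : charSubmonoid k H, d 1 * (x : ConvDual k H) with hF
  have hFF : F * F = (N : k) • F := by
    have h1 : ∀ x : charSubmonoid k H, (d 1 * (x : ConvDual k H)) * F = F := by
      intro x
      rw [hF, Finset.mul_sum]
      refine Fintype.sum_equiv (Equiv.mulLeft x) _ _ fun y => ?_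
      rw [mul_assoc, ← mul_assoc (x : ConvDual k H), hd.char_mul_one, mul_assoc, ← mul_assoc,
        hd.mul, if_pos rfl]
      rfl
    conv_lhs => enter [1]; rw [hF]
    rw [Finset.sum_mul, Finset.sum_congr rfl fun x _ => h1 x, Finset.sum_const, Finset.card_univ,
      ← Nat.card_eq_fintype_card, Nat.cast_smul_eq_nsmul]
  have hFΛ : F Λ = 3⁻¹ := by
    simp only [hF, WithConv.ofConv_sum, LinearMap.sum_apply]
    have hne : (1 : charSubmonoid k H) ≠ hd.signChar :=
      fun h => hd.signFn_ne_one (congrArg Subtype.val h).symm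
    rw [← Finset.sum_subset (Finset.subset_univ {1, hd.signChar}), Finset.sum_pair hne]
    · have h1 : d 1 * (hd.signChar : ConvDual k H) = d 1 := by
        rw [show (hd.signChar : ConvDual k H) = signFn d from rfl, hd.mul_signFn, permSign_one,
          one_smul]
      rw [h1, OneMemClass.coe_one, mul_one, hd.apply_integral hΛ]
      norm_num
    · intro x _ hx
      simp only [Finset.mem_insert, Finset.mem_singleton, not_or] at hx
      exact hd.mul_char_apply_integral hΛ x (fun h => hx.1 (Subtype.ext h))
        (fun h => hx.2 (Subtype.ext h)) 1
  have hidem : IsIdempotentElem (rightHit ((N : k)⁻¹ • F)) := by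
    rw [IsIdempotentElem, ← rightHit_mul, smul_mul_smul_comm, hFF, smul_smul, mul_assoc,
      inv_mul_cancel₀ hN0, mul_one]
  have h1 := LinearMap.exists_trace_eq_natCast_of_isIdempotentElem hidem
  rw [hΛ.trace_rightHit_self hS] at h1
  refine ⟨Module.finrank k (LinearMap.range (rightHit ((N : k)⁻¹ • F))), ?_⟩
  have h2 : ((N : k)⁻¹ • F) Λ = (N : k)⁻¹ * 3⁻¹ := by
    rw [← hFΛ]; rfl
  rw [h2] at h1
  have h3 : (Module.finrank k H : k) = 3 * N *
      (Module.finrank k (LinearMap.range (rightHit ((N : k)⁻¹ • F)))) := by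
    rw [← h1]
    field_simp
  exact_mod_cast h3

end IsPermFamily

end

/-! ### The group algebra of `S₃` -/

/-- The two-dimensional irreducible representation of `S₃`, over `ℤ`. -/
def permStdInt : Equiv.Perm (Fin 3) →* Matrix (Fin 2) (Fin 2) ℤ where
  toFun σ := Matrix.of fun i j =>
    (if σ j.castSucc = i.castSucc then 1 else 0) - (if σ 2 = i.castSucc then 1 else 0)
  map_one' := by decide
  map_mul' := by decide

theorem one_add_sign_add_two_mul_trace_permStdInt (σ : Equiv.Perm (Fin 3)) :
    1 + (Equiv.Perm.sign σ : ℤ) + 2 * (permStdInt σ).trace = if σ = 1 then 6 else 0 := by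
  revert σ
  decide

section

variable (k : Type*) [Field k]

/-- The algebra homomorphism `k S₃ → k` induced by the trivial representation. -/
def permAlgTriv : MonoidAlgebra k (Equiv.Perm (Fin 3)) →ₐ[k] k :=
  MonoidAlgebra.lift k k (Equiv.Perm (Fin 3)) 1

/-- The algebra homomorphism `k S₃ → k` induced by the sign representation. -/
def permAlgSign : MonoidAlgebra k (Equiv.Perm (Fin 3)) →ₐ[k] k :=
  MonoidAlgebra.lift k k (Equiv.Perm (Fin 3))
    { toFun := permSign k
      map_one' := permSign_one k
      map_mul' := permSign_mul k }

/-- The algebra homomorphism `k S₃ → M₂(k)` induced by the two-dimensional representation. -/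
def permAlgStd : MonoidAlgebra k (Equiv.Perm (Fin 3)) →ₐ[k] Matrix (Fin 2) (Fin 2) k :=
  MonoidAlgebra.lift k (Matrix (Fin 2) (Fin 2) k) (Equiv.Perm (Fin 3))
    (((Int.castRingHom k).mapMatrix.toMonoidHom).comp permStdInt)

/-- The regular character of `S₃` is the sum of its irreducible characters, with multiplicity. -/
theorem permAlgTriv_add_permAlgSign_add (x : MonoidAlgebra k (Equiv.Perm (Fin 3))) :
    permAlgTriv k x + permAlgSign k x + 2 * (permAlgStd k x).trace = 6 * x.coeff 1 := by
  induction x using MonoidAlgebra.induction_linear with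
  | zero => simp
  | add x y hx hy =>
    have : (x + y).coeff 1 = x.coeff 1 + y.coeff 1 := rfl
    rw [this, mul_add, ← hx, ← hy]
    simp only [map_add, Matrix.trace_add]
    ring
  | single σ c =>
    have h1 := congrArg (Int.cast : ℤ → k) (one_add_sign_add_two_mul_trace_permStdInt σ)
    have h2 : (((Int.castRingHom k).mapMatrix (permStdInt σ)).trace : k) =
        ((permStdInt σ).trace : ℤ) := by
      simp [Matrix.trace]
    simp only [permAlgTriv, permAlgSign, permAlgStd, MonoidAlgebra.lift_single]
    change c • 1 + c • permSign k σ +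
      2 * (c • (Int.castRingHom k).mapMatrix (permStdInt σ)).trace = _
    rw [Matrix.trace_smul, h2, MonoidAlgebra.coeff_single, Finsupp.single_apply]
    push_cast at h1
    split_ifs at h1 ⊢ <;> simp only [smul_eq_mul, permSign] <;> linear_combination c * h1

/-- The three representations determine the coefficient at 1 up to the factor 6, and translating by
σ⁻¹ recovers the coefficient at σ. -/
theorem eq_zero_of_permAlg_eq_zero [CharZero k] {x : MonoidAlgebra k (Equiv.Perm (Fin 3))}
    (h1 : permAlgTriv k x = 0) (h2 : permAlgSign k x = 0) (h3 : permAlgStd k x = 0) : x = 0 := by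
  have key : ∀ σ, x.coeff σ = 0 := by
    intro σ
    have h4 := permAlgTriv_add_permAlgSign_add k (MonoidAlgebra.single σ⁻¹ 1 * x)
    rw [map_mul, map_mul, map_mul, h1, h2, h3, mul_zero, mul_zero, mul_zero, Matrix.trace_zero,
      ← inv_mul_cancel σ, MonoidAlgebra.coeff_single_mul_mul] at h4
    simpa using h4
  ext σ
  exact key σ

theorem isOfAlgebraType_singleton {R : Type*} [Ring R] [Algebra k R] {n m d : ℕ}
    (e : R ≃ₐ[k] (Fin n → k) × (Fin m → Matrix (Fin d) (Fin d) k)) :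
    IsOfAlgebraType k R n [(d, m)] := by
  refine ⟨e.trans (AlgEquiv.prodCongr AlgEquiv.refl ?_)⟩
  let F : Fin [(d, m)].length → Type _ := fun i =>
    Fin ([(d, m)].get i).2 → Matrix (Fin ([(d, m)].get i).1) (Fin ([(d, m)].get i).1) k
  let f : (Fin m → Matrix (Fin d) (Fin d) k) →ₐ[k] ((i : Fin [(d, m)].length) → F i) :=
    AlgHom.pi fun i => match i with
      | ⟨0, _⟩ => AlgHom.id k _
  refine AlgEquiv.ofBijective f ⟨fun x y h => congrFun h ⟨0, by simp⟩, fun y => ⟨y ⟨0, by simp⟩, ?_⟩⟩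
  funext i
  match i with
  | ⟨0, _⟩ => rfl

/-- Each copy of kS₃ contributes the trivial and sign characters and one block of size two. The map
is injective, and the dimensions agree: 6 = 2 + 4. -/
theorem isOfAlgebraType_pi_permAlg [CharZero k] {Q : Type*} [Finite Q] {R : Type*} [Ring R] [Algebra k R]
    (e : R ≃ₐ[k] (Q → MonoidAlgebra k (Equiv.Perm (Fin 3)))) :
    IsOfAlgebraType k R (Nat.card Q * 2) [(2, Nat.card Q)] := by
  have := Fintype.ofFinite Q
  have e1 : Fin (Nat.card Q * 2) ≃ Q × Fin 2 :=
    finProdFinEquiv.symm.trans ((Finite.equivFin Q).symm.prodCongr (Equiv.refl _))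
  have e2 : Fin (Nat.card Q) ≃ Q := (Finite.equivFin Q).symm
  let ch : Fin 2 → MonoidAlgebra k (Equiv.Perm (Fin 3)) →ₐ[k] k := ![permAlgTriv k, permAlgSign k]
  let f : (Q → MonoidAlgebra k (Equiv.Perm (Fin 3))) →ₐ[k]
      (Fin (Nat.card Q * 2) → k) × (Fin (Nat.card Q) → Matrix (Fin 2) (Fin 2) k) :=
    AlgHom.prod
      (AlgHom.pi fun n => (ch (e1 n).2).comp (Pi.evalAlgHom k _ (e1 n).1))
      (AlgHom.pi fun n => (permAlgStd k).comp (Pi.evalAlgHom k _ (e2 n)))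
  have hinj : Function.Injective f := by
    rw [injective_iff_map_eq_zero]
    intro x hx
    have hx1 : ∀ n, ch (e1 n).2 (x (e1 n).1) = 0 := fun n => congrFun (congrArg Prod.fst hx) n
    have hx2 : ∀ n, permAlgStd k (x (e2 n)) = 0 := fun n => congrFun (congrArg Prod.snd hx) n
    funext q
    refine eq_zero_of_permAlg_eq_zero k ?_ ?_ ?_
    · simpa [ch] using hx1 (e1.symm (q, 0))
    · simpa [ch] using hx1 (e1.symm (q, 1))
    · simpa using hx2 (e2.symm q)
  have hdim : Module.finrank k (Q → MonoidAlgebra k (Equiv.Perm (Fin 3))) = Module.finrank k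
      ((Fin (Nat.card Q * 2) → k) × (Fin (Nat.card Q) → Matrix (Fin 2) (Fin 2) k)) := by
    have h6 : Module.finrank k (MonoidAlgebra k (Equiv.Perm (Fin 3))) = 6 := by
      rw [(MonoidAlgebra.coeffLinearEquiv k).finrank_eq, Module.finrank_finsupp_self,
        Fintype.card_perm]
      rfl
    rw [Module.finrank_pi_fintype, Module.finrank_prod, Module.finrank_pi,
      Module.finrank_pi_fintype]
    simp [h6, Module.finrank_matrix, Nat.card_eq_fintype_card]
    ring
  have hbij : Function.Bijective f :=
    ⟨hinj, (LinearMap.injective_iff_surjective_of_finrank_eq_finrank hdim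
      (f := f.toLinearMap)).1 hinj⟩
  exact isOfAlgebraType_singleton k (e.trans (AlgEquiv.ofBijective f hbij))

end

/-! ### Hopf ideals defined by functionals -/

section

variable {k H : Type*} [Field k] [Ring H] [HopfAlgebra k H]

local notation "𝓢" => antipode k (A := H)

theorem dualDistrib_map_comul {M : Type*} [AddCommGroup M] [Module k M] (π : H →ₗ[k] M)
    (f g : Module.Dual k M) (x : H) :
    TensorProduct.dualDistrib k M M (f ⊗ₜ[k] g) (TensorProduct.map π π (comul x)) =
      (toConv (f ∘ₗ π) * toConv (g ∘ₗ π) : ConvDual k H) x := by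
  rw [(ℛ k x).convMul_apply, ← (ℛ k x).eq]
  simp

/-- An ideal which is the common kernel of a family of functionals is a Hopf ideal, if it is killed
by the counit, by the convolution products of the functionals and by their composites with the
antipode. -/
theorem Ideal.isHopfIdeal_of_forall_apply [FiniteDimensional k H] {J : Ideal H} {ι : Type*}
    [Finite ι] {w : ι → ConvDual k H} (hJ : ∀ h, h ∈ J ↔ ∀ i, w i h = 0)
    (h1 : ∀ h ∈ J, counit (R := k) h = 0) (hmul : ∀ i j, ∀ h ∈ J, (w i * w j) h = 0)
    (hS : ∀ i, ∀ h ∈ J, w i (𝓢 h) = 0) : J.IsHopfIdeal k where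
  counit_eq_zero := h1
  antipode_mem h hh := (hJ _).2 fun i => hS i h hh
  map_mkQ_comul_eq_zero h hh := by
    -- J is the common kernel of finitely many w_i, so every functional that vanishes on J is a
    -- combination of them. The coideal condition can thus be tested on products of the w_i.
    have hspan : ∀ f : Module.Dual k (H ⧸ J.restrictScalars k),
        f ∘ₗ (J.restrictScalars k).mkQ ∈ Submodule.span k (Set.range fun i => (w i).ofConv) := by
      intro f
      refine mem_span_of_iInf_ker_le_ker fun x hx => ?_
      rw [Submodule.mem_iInf] at hx
      have hxJ : x ∈ J.restrictScalars k := (hJ x).2 hx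
      rw [LinearMap.mem_ker, LinearMap.comp_apply, Submodule.mkQ_apply,
        (Submodule.Quotient.mk_eq_zero _).2 hxJ, map_zero]
    have hprod : ∀ f ∈ Submodule.span k (Set.range fun i => (w i).ofConv),
        ∀ g ∈ Submodule.span k (Set.range fun i => (w i).ofConv),
        (toConv f * toConv g : ConvDual k H) h = 0 := by
      intro f hf g hg
      induction hf, hg using Submodule.span_induction₂ with
      | mem_mem f g hf hg =>
        obtain ⟨i, rfl⟩ := hf
        obtain ⟨j, rfl⟩ := hg
        exact hmul i j h hh
      | zero_left g _ => rw [toConv_zero, zero_mul]; rfl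
      | zero_right f _ => rw [toConv_zero, mul_zero]; rfl
      | add_left f f' g _ _ _ hf hf' =>
        rw [toConv_add, add_mul]
        exact (congrArg₂ _ hf hf').trans (add_zero _)
      | add_right f g g' _ _ _ hg hg' =>
        rw [toConv_add, mul_add]
        exact (congrArg₂ _ hg hg').trans (add_zero _)
      | smul_left c f g _ _ hf =>
        rw [toConv_smul, smul_mul_assoc]
        exact (congrArg (c • ·) hf).trans (smul_zero _)
      | smul_right c f g _ _ hf =>
        rw [toConv_smul, mul_smul_comm]
        exact (congrArg (c • ·) hf).trans (smul_zero _)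
    rw [← Module.forall_dual_apply_eq_zero_iff k]
    intro φ
    obtain ⟨t, rfl⟩ := (TensorProduct.dualDistribEquiv k (H ⧸ J.restrictScalars k)
      (H ⧸ J.restrictScalars k)).surjective φ
    induction t with
    | zero => simp
    | add s t hs ht => rw [map_add, LinearMap.add_apply, hs, ht, add_zero]
    | tmul f g =>
      exact (dualDistrib_map_comul _ f g h).trans (hprod _ (hspan f) _ (hspan g))

end

/-- A nonzero functional vanishing on the range would be a linear relation among the w_i. -/
theorem LinearIndependent.surjective_pi {k V ι : Type*} [Field k] [AddCommGroup V] [Module k V]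
    [Fintype ι] {w : ι → V →ₗ[k] k} (hw : LinearIndependent k w) :
    Function.Surjective (LinearMap.pi w) := by
  classical
  rw [← LinearMap.range_eq_top]
  by_contra h
  obtain ⟨f, hf0, hf⟩ := Submodule.exists_le_ker_of_lt_top _ (lt_top_iff_ne_top.2 h)
  apply hf0
  have h1 : ∑ i, f (Pi.single i 1) • w i = 0 := by
    ext v
    have h2 : f (LinearMap.pi w v) = 0 := hf ⟨v, rfl⟩
    rw [← LinearMap.sum_single_apply (fun _ : ι => k) (LinearMap.pi w v), map_sum] at h2
    rw [LinearMap.sum_apply, LinearMap.zero_apply, ← h2]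
    refine Finset.sum_congr rfl fun i _ => ?_
    have h3 : Pi.single i (w i v) = w i v • (Pi.single i 1 : ι → k) := by
      rw [← Pi.single_smul, smul_eq_mul, mul_one]
    change f (Pi.single i 1) * w i v = f (Pi.single i (w i v))
    rw [h3, map_smul, smul_eq_mul, mul_comm]
  have h2 := Fintype.linearIndependent_iff.1 hw _ h1
  exact LinearMap.pi_ext fun i x => by
    have h3 : Pi.single i x = x • (Pi.single i 1 : ι → k) := by
      rw [← Pi.single_smul, smul_eq_mul, mul_one]
    rw [h3, map_smul, h2, smul_zero, LinearMap.zero_apply]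

/-! ### Factoring maps through surjections -/

theorem CoalgHom.exists_factor {k V W M : Type*} [Field k] [AddCommGroup V] [Module k V]
    [Coalgebra k V] [AddCommGroup W] [Module k W] [Coalgebra k W] [AddCommGroup M] [Module k M]
    [Coalgebra k M] {p : V →ₗc[k] W} (hp : Function.Surjective p) {f : V →ₗc[k] M}
    (hpf : ∀ v, p v = 0 → f v = 0) : ∃ r : W →ₗc[k] M, ∀ v, r (p v) = f v := by
  obtain ⟨g, hg⟩ := p.toLinearMap.exists_rightInverse_of_surjective (LinearMap.range_eq_top.2 hp)
  have hr : ∀ v, f (g (p v)) = f v := by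
    intro v
    rw [← sub_eq_zero, ← map_sub]
    refine hpf _ ?_
    rw [map_sub, sub_eq_zero]
    exact LinearMap.congr_fun hg (p v)
  have hcomp : (f.toLinearMap ∘ₗ g) ∘ₗ p.toLinearMap = f.toLinearMap := LinearMap.ext hr
  refine ⟨{ toLinearMap := f.toLinearMap ∘ₗ g
            counit_comp := ?_
            map_comp_comul := ?_ }, hr⟩
  · rw [← LinearMap.cancel_right (show Function.Surjective p.toLinearMap from hp),
      LinearMap.comp_assoc, hcomp, p.counit_comp, f.counit_comp]
  · rw [← LinearMap.cancel_right (show Function.Surjective p.toLinearMap from hp)]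
    conv_rhs => rw [LinearMap.comp_assoc, hcomp, ← f.map_comp_comul]
    rw [LinearMap.comp_assoc, ← p.map_comp_comul, ← LinearMap.comp_assoc,
      ← TensorProduct.map_comp, hcomp]

theorem BialgHom.exists_factor {k V W M : Type*} [Field k] [Ring V] [Bialgebra k V] [Ring W]
    [Bialgebra k W] [Ring M] [Bialgebra k M] {p : V →ₐc[k] W} (hp : Function.Surjective p)
    {f : V →ₐc[k] M} (hpf : ∀ v, p v = 0 → f v = 0) : ∃ r : W →ₐc[k] M, ∀ v, r (p v) = f v := by
  obtain ⟨r, hr⟩ := CoalgHom.exists_factor (p := p.toCoalgHom) (f := f.toCoalgHom) hp hpf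
  have hr' : ∀ v, r (p v) = f v := hr
  refine ⟨{ toCoalgHom := r, map_one' := ?_, map_mul' := ?_ }, hr⟩
  · change r 1 = 1
    rw [← map_one p, hr', map_one]
  · intro x y
    change r (x * y) = r x * r y
    obtain ⟨x, rfl⟩ := hp x
    obtain ⟨y, rfl⟩ := hp y
    rw [← map_mul, hr', hr', hr', map_mul]

/-! ### The two quotient Hopf algebras -/

namespace IsPermFamily

variable {k H : Type*} [Field k] [Ring H] [HopfAlgebra k H]
  {d : Equiv.Perm (Fin 3) → ConvDual k H} (hd : IsPermFamily d)

/-- The map of Hopf algebras to the group algebra of `S₃`. -/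
def toPermAlg : H →ₐc[k] MonoidAlgebra k (Equiv.Perm (Fin 3)) :=
  groupBialgHom d hd.apply_one hd.apply_mul hd.mul hd.sum

theorem toPermAlg_surjective : Function.Surjective hd.toPermAlg :=
  groupAlgMap_surjective hd.mul hd.ne_zero

theorem toPermAlg_eq_zero_iff {h : H} : hd.toPermAlg h = 0 ↔ ∀ σ, d σ h = 0 := by
  constructor
  · intro hh σ
    rw [← groupAlgMap_apply_coeff d h σ, show groupAlgMap d h = 0 from hh]
    rfl
  · intro hh
    change groupAlgMap d h = 0
    rw [groupAlgMap_apply]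
    simp [hh]

/-- The product of the twists of the map to the group algebra of `S₃` by representatives of the
one-dimensional representations modulo the sign representation. -/
def toPiPermAlg : H →ₐ[k] (charSubmonoid k H ⧸ Subgroup.zpowers hd.signChar →
    MonoidAlgebra k (Equiv.Perm (Fin 3))) :=
  AlgHom.pi fun q => groupAlgHom _ (hd.mul_char_apply_one (Quotient.out q))
    (hd.mul_char_apply_mul (Quotient.out q))

theorem toPiPermAlg_eq_zero_iff_out {h : H} :
    hd.toPiPermAlg h = 0 ↔ ∀ i : (charSubmonoid k H ⧸ Subgroup.zpowers hd.signChar) ×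
      Equiv.Perm (Fin 3),
        (d i.2 * ((Quotient.out i.1 : charSubmonoid k H) : ConvDual k H)) h = 0 := by
  constructor
  · rintro hh ⟨q, σ⟩
    have h1 := congrFun hh q
    rw [← groupAlgMap_apply_coeff (fun σ => d σ * ((Quotient.out q : charSubmonoid k H) :
      ConvDual k H)) h σ]
    exact congrArg (fun y => MonoidAlgebra.coeff y σ) h1
  · intro hh
    funext q
    refine (groupAlgMap_apply (fun σ => d σ * ((Quotient.out q : charSubmonoid k H) :
      ConvDual k H)) h).trans (Finset.sum_eq_zero fun σ _ => ?_)
    rw [hh (q, σ), MonoidAlgebra.single_zero]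

/-- Changing the representative of a coset multiplies d_σ x at most by the sign of σ, so the kernel
does not depend on the choice. The choice-free description is the one suited to the Hopf ideal
property. -/
theorem toPiPermAlg_eq_zero_iff [CharZero k] {h : H} :
    hd.toPiPermAlg h = 0 ↔ ∀ (x : charSubmonoid k H) σ, (d σ * (x : ConvDual k H)) h = 0 := by
  rw [toPiPermAlg_eq_zero_iff_out]
  refine ⟨fun hh x σ => ?_, fun hh i => hh _ _⟩
  obtain ⟨z, hz⟩ := QuotientGroup.mk_out_eq_mul (Subgroup.zpowers hd.signChar) x
  have hx : x = Quotient.out (x : charSubmonoid k H ⧸ Subgroup.zpowers hd.signChar) *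
      (z : charSubmonoid k H)⁻¹ := by
    rw [hz, mul_inv_cancel_right]
  have h0 := hh (x, σ)
  rw [hx]
  rcases hd.mem_zpowers_signChar (inv_mem z.2) with h1 | h1
  · rw [h1, mul_one]
    exact h0
  · rw [h1, Submonoid.coe_mul, show (hd.signChar : ConvDual k H) = signFn d from rfl,
      ← hd.signFn_mul_comm, ← mul_assoc, hd.mul_signFn, smul_mul_assoc]
    exact (congrArg (permSign k σ • ·) h0).trans (smul_zero _)

theorem toPiPermAlg_surjective [FiniteDimensional k H] [CharZero k] {Λ : H}
    (hΛ : IsNormalizedIntegral k Λ) : Function.Surjective hd.toPiPermAlg := by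
  have := Fintype.ofFinite (charSubmonoid k H ⧸ Subgroup.zpowers hd.signChar)
  have h1 : LinearIndependent k fun i : (charSubmonoid k H ⧸ Subgroup.zpowers hd.signChar) ×
      Equiv.Perm (Fin 3) =>
        (d i.2 * ((Quotient.out i.1 : charSubmonoid k H) : ConvDual k H)).ofConv :=
    (hd.linearIndependent_mul_char hΛ).map' (WithConv.linearEquiv k (H →ₗ[k] k)).toLinearMap
      (LinearEquiv.ker _)
  intro y
  obtain ⟨h, hh⟩ := h1.surjective_pi fun i => (y i.1).coeff i.2
  refine ⟨h, ?_⟩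
  funext q
  ext σ
  refine (groupAlgMap_apply_coeff (fun σ => d σ * ((Quotient.out q : charSubmonoid k H) :
    ConvDual k H)) h σ).trans (congrFun hh (q, σ))

variable [FiniteDimensional k H]

theorem isHopfIdeal_ker_toPermAlg :
    (RingHom.ker (hd.toPermAlg : H →ₐ[k] MonoidAlgebra k (Equiv.Perm (Fin 3)))).IsHopfIdeal k := by
  have hker : ∀ h, h ∈ RingHom.ker (hd.toPermAlg : H →ₐ[k] MonoidAlgebra k (Equiv.Perm (Fin 3))) ↔
    ∀ σ, d σ h = 0 := fun h => hd.toPermAlg_eq_zero_iff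
  refine Ideal.isHopfIdeal_of_forall_apply hker ?_ ?_ ?_
  · intro h hh
    rw [hker] at hh
    rw [← convDual_one_apply, ← hd.sum, WithConv.ofConv_sum, LinearMap.sum_apply]
    exact Finset.sum_eq_zero fun σ _ => hh σ
  · intro σ τ h hh
    rw [hd.mul]
    split_ifs
    · exact (hker h).1 hh σ
    · rfl
  · intro σ h hh
    exact (WithConv.congr_fun (hd.comp_antipode σ) h).trans ((hker h).1 hh _)

/-- As every x normalizes the family d, a product (d_σ x)(d_τ y) is d_σ xy or zero, and composing
with the antipode gives another element of the form d_τ x⁻¹. -/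
theorem isHopfIdeal_ker_toPiPermAlg [CharZero k] :
    (RingHom.ker hd.toPiPermAlg).IsHopfIdeal k := by
  have hker : ∀ h, h ∈ RingHom.ker hd.toPiPermAlg ↔ ∀ i : charSubmonoid k H × Equiv.Perm (Fin 3),
      (d i.2 * (i.1 : ConvDual k H)) h = 0 := fun h =>
    hd.toPiPermAlg_eq_zero_iff.trans ⟨fun hh i => hh i.1 i.2, fun hh x σ => hh (x, σ)⟩
  refine Ideal.isHopfIdeal_of_forall_apply hker ?_ ?_ ?_
  · intro h hh
    rw [hker] at hh
    rw [← convDual_one_apply, ← hd.sum, WithConv.ofConv_sum, LinearMap.sum_apply]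
    refine Finset.sum_eq_zero fun σ _ => ?_
    have h1 := hh (1, σ)
    rwa [OneMemClass.coe_one, mul_one] at h1
  · rintro ⟨x, σ⟩ ⟨y, τ⟩ h hh
    obtain ⟨τ', hτ⟩ := hd.char_mul x τ
    rw [mul_assoc, ← mul_assoc (x : ConvDual k H), hτ, mul_assoc, ← mul_assoc, hd.mul]
    split_ifs
    · exact (hker h).1 hh (x * y, σ)
    · rw [zero_mul]; rfl
  · rintro ⟨x, σ⟩ h hh
    obtain ⟨τ, hτ⟩ := hd.char_mul x⁻¹ σ⁻¹
    have h1 := convDual_comp_antipode (x : ConvDual k H) (d σ)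
    rw [hd.comp_antipode, ← coe_inv_charSubmonoid, hτ] at h1
    exact (WithConv.congr_fun h1 h).symm.trans ((hker h).1 hh (x⁻¹, τ))

end IsPermFamily

/-! ### The family of idempotents attached to a non-normal Hopf subalgebra of index three -/

namespace HopfSubalgebra

variable {k H : Type*} [Field k] [Ring H] [HopfAlgebra k H] [FiniteDimensional k H]

theorem exists_isPermFamily [IsAlgClosed k] [CharZero k] [IsSemisimpleRing H]
    (A : HopfSubalgebra k H) (hindex : A.index = 3) (hA : ¬ A.IsNormal) :
    ∃ d : Equiv.Perm (Fin 3) → ConvDual k H, IsPermFamily d ∧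
      ∀ h, (∀ σ, d σ h = 0) → A.leftAugIdeal.mkQ h = 0 := by
  obtain ⟨Λ, hΛ⟩ := exists_isNormalizedIntegral (k := k) (H := H)
  have hS := hΛ.antipode_antipode
  have hn : Module.finrank k H ≠ 0 := by
    intro h
    rw [index, h, Nat.cast_zero, zero_div] at hindex
    exact absurd hindex (by norm_num)
  have hA0 : (Module.finrank k A.toSubalgebra : k) ≠ 0 := by
    intro h
    rw [index, Nat.cast_eq_zero.1 h, Nat.cast_zero, div_zero] at hindex
    exact absurd hindex (by norm_num)
  have hAn : (Module.finrank k H : k) = Module.finrank k A.toSubalgebra * 3 := by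
    have h1 : (Module.finrank k H : ℚ) = 3 * Module.finrank k A.toSubalgebra := by
      rw [← hindex, index, div_mul_cancel₀]
      exact_mod_cast Nat.cast_ne_zero.1 hA0
    have h2 : Module.finrank k H = 3 * Module.finrank k A.toSubalgebra := by exact_mod_cast h1
    rw [h2]
    push_cast
    ring
  have : Nontrivial H := Module.nontrivial_of_finrank_pos (Nat.pos_of_ne_zero hn)
  obtain ⟨e, he, hef⟩ := A.exists_isIntegral hS
  have hd : (Module.finrank k A.toSubalgebra : k) * antipodeSqTrace k H e =
      Module.finrank k H := by
    rw [hef _ fun x _ => hΛ.rightHit_antipodeSqTrace x, antipodeSqTrace_one hS]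
  have hq : Module.finrank k (H ⧸ A.leftAugIdeal) = 3 := by
    have h1 := he.finrank_quotient hS
    rw [hAn] at hd
    rw [mul_left_cancel₀ hA0 hd] at h1
    exact_mod_cast h1
  have hcen : ¬ ∀ x, e * x * e = x * e := fun h => hA (he.isNormal hΛ hS hd hn h)
  have := isSemisimpleRing_convDual he hΛ hS (by rw [hq]; norm_num)
  obtain ⟨b, hb⟩ := exists_basis_isGroupLikeElem hq
  set π : H →ₗc[k] H ⧸ A.leftAugIdeal := Coalgebra.Quotient.mkQCoalgHom A.leftAugIdeal
  have hπ : Function.Surjective π := A.leftAugIdeal.mkQ_surjective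
  have hρ : ∀ a h, A.action a (π h) = π (a * h) := fun _ _ => rfl
  have hu := isMagicUnitary_coefFn hb hπ hρ hS
  refine ⟨permIdem (coefFn b A.action),
    { apply_one := permIdem_coefFn_one
      apply_mul := permIdem_coefFn_mul hu
      mul := hu.permIdem_mul
      sum := hu.sum_permIdem
      comp_antipode := permIdem_comp_antipode hb hπ hρ hS
      ne_zero := he.permIdem_ne_zero hcen hu
      conj := A.exists_perm_permIdem hb hu }, fun h hh => ?_⟩
  -- The action on the quotient factors through kS₃, so an element killed by all d_σ acts as zero;
  -- applied to the class of 1 this says that its own class is zero.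
  have h1 : A.action h = 0 := b.ext fun j => by
    rw [action_eq_sum_permIdem hu, LinearMap.zero_apply]
    exact Finset.sum_eq_zero fun σ _ => by rw [hh, zero_smul]
  have h2 : A.action h (π 1) = π h := by rw [hρ, mul_one]
  exact h2.symm.trans (by rw [h1, LinearMap.zero_apply])

end HopfSubalgebra

end

theorem theorem2p5p1 {k : Type u} {H : Type v} [Field k] [IsAlgClosed k] [CharZero k]
    [Ring H] [HopfAlgebra k H] [FiniteDimensional k H] [IsSemisimpleRing H]
    (A : HopfSubalgebra k H) (hindex : A.index = 3) (hA : ¬ A.IsNormal) :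
    (∃ (Hbar : Type v) (_ : Ring Hbar) (_ : HopfAlgebra k Hbar)
        (B : Type v) (_ : Ring B) (_ : HopfAlgebra k B)
        (p : H →ₐc[k] Hbar) (q : Hbar →ₐc[k] B) (r : B →ₗc[k] H ⧸ A.leftAugIdeal),
      IsOfAlgebraType k Hbar (Nat.card (GroupLike k (Module.Dual k H)))
        [(2, Nat.card (GroupLike k (Module.Dual k H)) / 2)] ∧
      Nonempty (B ≃ₐc[k] MonoidAlgebra k (Equiv.Perm (Fin 3))) ∧
      Function.Surjective p ∧ Function.Surjective q ∧ Function.Surjective r ∧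
      ∀ h : H, r (q (p h)) = A.leftAugIdeal.mkQ h) ∧
    Even (Nat.card (GroupLike k (Module.Dual k H))) ∧
    3 * Nat.card (GroupLike k (Module.Dual k H)) ∣ Module.finrank k H := by
  obtain ⟨Λ, hΛ⟩ := exists_isNormalizedIntegral (k := k) (H := H)
  obtain ⟨d, hd, hdA⟩ := A.exists_isPermFamily hindex hA
  rw [← Nat.card_congr charEquivGroupLike]
  have hcard := hd.card_quotient_signChar
  refine ⟨?_, hcard ▸ even_two.mul_left _, hd.three_mul_card_dvd hΛ hΛ.antipode_antipode⟩
  have hI := hd.isHopfIdeal_ker_toPiPermAlg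
  have hJ := hd.isHopfIdeal_ker_toPermAlg
  set I := RingHom.ker hd.toPiPermAlg with hIdef
  set J := RingHom.ker (hd.toPermAlg : H →ₐ[k] MonoidAlgebra k (Equiv.Perm (Fin 3))) with hJdef
  have hIJ : I ≤ J := by
    intro h hh
    refine hd.toPermAlg_eq_zero_iff.2 fun σ => ?_
    have h1 := hd.toPiPermAlg_eq_zero_iff.1 hh 1 σ
    rwa [OneMemClass.coe_one, mul_one] at h1
  have hp : Function.Surjective (Bialgebra.Quotient.mkBialgHom (R := k) I) :=
    Ideal.Quotient.mk_surjective
  have hp' : Function.Surjective (Bialgebra.Quotient.mkBialgHom (R := k) J) :=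
    Ideal.Quotient.mk_surjective
  obtain ⟨q, hq⟩ := BialgHom.exists_factor hp (f := Bialgebra.Quotient.mkBialgHom (R := k) J)
    fun h hh => Ideal.Quotient.eq_zero_iff_mem.2 (hIJ (Ideal.Quotient.eq_zero_iff_mem.1 hh))
  obtain ⟨r, hr⟩ := CoalgHom.exists_factor
    (p := (Bialgebra.Quotient.mkBialgHom (R := k) J).toCoalgHom) hp'
    (f := Coalgebra.Quotient.mkQCoalgHom A.leftAugIdeal)
    fun h hh => hdA h (hd.toPermAlg_eq_zero_iff.1 (Ideal.Quotient.eq_zero_iff_mem.1 hh))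
  obtain ⟨φ, hφ⟩ := BialgHom.exists_factor hp' (f := hd.toPermAlg)
    fun h hh => Ideal.Quotient.eq_zero_iff_mem.1 hh
  have hφb : Function.Bijective φ := by
    refine ⟨(injective_iff_map_eq_zero φ).2 fun x hx => ?_, fun y => ?_⟩
    · obtain ⟨h, rfl⟩ := hp' x
      rw [hφ] at hx
      exact Ideal.Quotient.eq_zero_iff_mem.2 hx
    · obtain ⟨h, rfl⟩ := hd.toPermAlg_surjective y
      exact ⟨_, hφ h⟩
  -- B is taken as a quotient of H rather than kS₃ itself, which lives in the universe of k instead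
  -- of that of H.
  refine ⟨H ⧸ I, inferInstance, inferInstance, H ⧸ J, inferInstance, inferInstance,
    Bialgebra.Quotient.mkBialgHom I, q, r, ?_, ⟨BialgEquiv.ofBijective φ hφb⟩, hp, ?_, ?_, ?_⟩
  · have h1 := isOfAlgebraType_pi_permAlg k
      (Ideal.quotientKerAlgEquivOfSurjective (hd.toPiPermAlg_surjective hΛ))
    rw [hcard, Nat.mul_div_cancel _ two_pos]
    exact h1
  · intro y
    obtain ⟨h, rfl⟩ := hp' y
    exact ⟨_, hq h⟩
  · intro y
    obtain ⟨h, rfl⟩ := A.leftAugIdeal.mkQ_surjective y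
    exact ⟨_, hr h⟩
  · intro h
    rw [hq]
    exact hr h
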